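/- Let $-1\le r<1$ and let $g$ be a measurable, integrable function on $[r,1]$ with \[ g(t)=(t-r)^p g_1(t-r)=(1-t)^q g_2(1-t)\qquad (r<t<1), \] where $p,q\in\mathbb C$, $\operatorname{Re}p>-1$, $\operatorname{Re}q>-1$, $g_1(0)$ and $g_2(0)$ are finite and nonzero, and in a (one-sided) neighbourhood $[0,\delta)$ of $0$ the derivatives $g_1',g_2'$ exist and are bounded. Put \[ f(z)=\int_r^1 e^{zt}g(t)\,dt,\qquad p_n[f](z)=\sum_{k=0}^n\frac{z^k}{k!}\int_r^1t^kg(t)\,dt,\qquad A=\frac{g_1(0)\Gamma(p+1)}{g_2(0)\Gamma(q+1)}, \] so that $p_n[f]$ is the $n$th partial sum of the Maclaurin series of the entire function $f$, and let \[ S=\{z\in\mathbb C: |z\exp(1-z)|=1,\ |z|\le 1,\ \operatorname{Re}z>0\}. \] All powers and logarithms are principal. Call $z$ a limit point of the zeros if $z=\lim_{n\to\infty}\zeta_n$ where $p_{n-1}[f](n\zeta_n)=0$ for all large $n$, and a cluster point of the zeros if every neighbourhood of $z$ contains a zero of $p_{n-1}[f](n\,\cdot)$ for infinitely many $n$. (1)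 If $-1<r<1$, then the limit points of the zeros in the right half-plane $\operatorname{Re}z>0$ are precisely the points of $S$, and so are the cluster points. If $r=-1$, the limit points of the zeros which do not lie on the imaginary axis are precisely the points of $S\cup-S$. If $r=-1$, the same holds for the cluster points, except that when $\operatorname{Re}p=\operatorname{Re}q$ this is asserted only for points $z$ with $|1+z|\ne|A|\,|1-z|$: such a $z$ with $\operatorname{Re}z\neq0$ is a cluster point if and only if $z\in S\cup -S$. (2) Let $\xi\in S$, $\xi\ne1$, $\tau=\operatorname{Im}(\xi-1-\log\xi)$, and let $\tau_n,\sigma_n\in(-\pi,\pi]$ satisfy $\tau_n\equiv\tau n$ and $\sigma_n\equiv\pi n\pmod{2\pi}$. Put \[ z_n^1(w)=\xi\left(1+\frac{\log n}{2(1-\xi)n}-\frac{w-i\tau_n}{(1-\xi)n}\right),\qquad z_n^2(w)=\xi\left(1+\Bigl(p-q+\tfrac12\Bigr)\frac{\log n}{(1-\xi)n}-\frac{w-i\sigma_n-i\tau_n}{(1-\xi)n}\right). \] As $n\to\infty$, uniformly for $w$ in compact subsets of $\mathbb C$: if $-1<r<1$, or if $r=-1$ and $\operatorname{Re}q<\operatorname{Re}p$,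 \[ \frac{p_{n-1}[f](nz_n^1(w))}{f(nz_n^1(w))}\to1-\frac{\xi^{q+1}e^{-w}}{(1-\xi)\sqrt{2\pi}}; \] if $r=-1$ and $\operatorname{Re}q>\operatorname{Re}p$, \[ \frac{p_{n-1}[f](nz_n^2(w))}{f(nz_n^2(w))}\to1-\frac{A\,\xi^{q+1}e^{-w}}{(1+\xi)\sqrt{2\pi}}; \] if $r=-1$ and $\operatorname{Re}q=\operatorname{Re}p$, \[ \frac{p_{n-1}[f](nz_n^1(w))}{f(nz_n^1(w))}=1-\left(\frac1{1-\xi}+\frac{A(-1)^nn^{q-p}}{1+\xi}\right)\frac{\xi^{q+1}e^{-w}}{\sqrt{2\pi}}+o(1). \] (3) Let $\operatorname{erfc}(z)=\frac{2}{\sqrt\pi}\int_z^{\infty}e^{-s^2}\,ds$, integrated along the horizontal ray from $z$ to $z+\infty$. If $-1<r<1$, then \[ \lim_{n\to\infty}\frac{p_{n-1}[f](n+w\sqrt n)}{f(n+w\sqrt n)}=\frac12\operatorname{erfc}\left(\frac{w}{\sqrt2}\right) \] uniformly on compact subsets of $\operatorname{Re}w<0$. If $r=-1$, this uniform limit holds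 if and only if $\operatorname{Re}p-\operatorname{Re}q+\tfrac12>0$. -/

import Mathlib

open Filter Topology

noncomputable section

/-- `f(z) = ∫_r^1 e^{zt} g(t) dt`. -/
def expInt (r : ℝ) (g : ℝ → ℂ) (z : ℂ) : ℂ :=
  ∫ t in r..1, Complex.exp (z * (t : ℂ)) * g t

/-- The `n`-th partial sum of the Maclaurin series of `expInt r g`,
`p_n(z) = ∑_{k=0}^n (z^k / k!) ∫_r^1 t^k g(t) dt`. -/
def expIntPartialSum (r : ℝ) (g : ℝ → ℂ) (n : ℕ) (z : ℂ) : ℂ :=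
  ∑ k ∈ Finset.range (n + 1),
    z ^ k / (Nat.factorial k : ℂ) * ∫ t in r..1, (t : ℂ) ^ k * g t

/-- `h` is differentiable with bounded derivative near `0`; since `h` is only relevant on `[0, ∞)`,
the neighbourhood and the derivative at `0` are one-sided. -/
def HasBoundedDerivNearZero (h : ℝ → ℂ) : Prop :=
  ∃ (δ M : ℝ) (h' : ℝ → ℂ), 0 < δ ∧
    ∀ t ∈ Set.Ico 0 δ, HasDerivWithinAt h (h' t) (Set.Ici 0) t ∧ ‖h' t‖ ≤ M

/-- The part of the Szegő curve in the right half-plane. -/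
def szegoArc : Set ℂ :=
  {z : ℂ | ‖z * Complex.exp (1 - z)‖ = 1 ∧ ‖z‖ ≤ 1 ∧ 0 < z.re}

/-- `z` is the limit of a sequence `ζ_n` with `ζ_n` a zero of `P_n` (for all large `n`). -/
def IsLimitOfZeros (P : ℕ → ℂ → ℂ) (z : ℂ) : Prop :=
  ∃ ζ : ℕ → ℂ, (∀ᶠ n in atTop, P n (ζ n) = 0) ∧ Tendsto ζ atTop (𝓝 z)

/-- Every neighbourhood of `z` contains a zero of `P_n` for infinitely many `n`. -/
def IsClusterOfZeros (P : ℕ → ℂ → ℂ) (z : ℂ) : Prop :=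
  ∀ U ∈ 𝓝 z, ∃ᶠ n in atTop, ∃ x ∈ U, P n x = 0

/-- The complementary error function `(2 / √π) ∫_z^{z+∞} e^{-s²} ds`, integrated along the
horizontal ray starting at `z`. -/
def cerfc (z : ℂ) : ℂ :=
  2 / (Real.sqrt Real.pi : ℂ) * ∫ s in Set.Ioi (0 : ℝ), Complex.exp (-(z + (s : ℂ)) ^ 2)

/-- The representative of `x` modulo `2π` in `(-π, π]`. -/
def redTwoPi (x : ℝ) : ℝ := toIocMod Real.two_pi_pos (-Real.pi) x

/-- `τ = Im (ξ - 1 - log ξ)`. -/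
def arcTau (ξ : ℂ) : ℝ := (ξ - 1 - Complex.log ξ).im

/-- `τ_n`, with `τ_n ≡ τ n` modulo `2π` and `-π < τ_n ≤ π`. -/
def arcTauSeq (ξ : ℂ) (n : ℕ) : ℝ := redTwoPi (arcTau ξ * n)

/-- `σ_n`, with `σ_n ≡ π n` modulo `2π` and `-π < σ_n ≤ π`. -/
def arcSigmaSeq (n : ℕ) : ℝ := redTwoPi (Real.pi * n)

/-- `z_n^1(w) = ξ (1 + log n / (2(1-ξ)n) - (w - iτ_n) / ((1-ξ)n))`. -/
def arcZ₁ (ξ : ℂ) (n : ℕ) (w : ℂ) : ℂ :=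
  ξ * (1 + (Real.log n : ℂ) / (2 * (1 - ξ) * n)
    - (w - Complex.I * (arcTauSeq ξ n : ℂ)) / ((1 - ξ) * n))

/-- `z_n^2(w) = ξ (1 + (p - q + 1/2) log n / ((1-ξ)n) - (w - iσ_n - iτ_n) / ((1-ξ)n))`. -/
def arcZ₂ (p q ξ : ℂ) (n : ℕ) (w : ℂ) : ℂ :=
  ξ * (1 + (p - q + 1 / 2) * ((Real.log n : ℂ) / ((1 - ξ) * n))
    - (w - Complex.I * (arcSigmaSeq n : ℂ) - Complex.I * (arcTauSeq ξ n : ℂ)) / ((1 - ξ) * n))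

/-- The quotient `p_{n-1}[f](z) / f(z)`. -/
def expIntRatio (r : ℝ) (g : ℝ → ℂ) (n : ℕ) (z : ℂ) : ℂ :=
  expIntPartialSum r g (n - 1) z / expInt r g z

/-- The corner scaling limit: `p_{n-1}[f](n + w√n) / f(n + w√n) → erfc(w/√2) / 2`
uniformly on compact subsets of `Re w < 0`. -/
def CornerLimit (r : ℝ) (g : ℝ → ℂ) : Prop :=
  ∀ K : Set ℂ, IsCompact K → K ⊆ {w : ℂ | w.re < 0} →
    TendstoUniformlyOn
      (fun (n : ℕ) (w : ℂ) => expIntRatio r g n ((n : ℂ) + w * (Real.sqrt n : ℂ)))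
      (fun w : ℂ => 1 / 2 * cerfc (w / (Real.sqrt 2 : ℂ))) atTop K

end

/-! Let y be the distance to an endpoint of [-1,1]. Splitting at t = 0 turns f(x) into ∫_0^1 Gp(y)
e^{x(1-y)} dy + ∫_0^1 Gm(y) e^{-x(1-y)} dy, where Gp(y) ~ g₂(0) y^q and, if r = -1, Gm(y) ~ g₁(0)
y^p as y → 0. All asymptotics come from these two power laws through one form of Watson's lemma,
`EndpointAsymp.tendsto_integral`.

The exact identity behind everything (`scaledInt_sub`, `twoSum_div_twoInt`) is p_{n-1}(nz)/f(nz) = 1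
- (z e^{1-z})^n n^{-1/2} · B_n(z) · C_n(z). For Re z > 0 the endpoint 1 dominates f, and with
Stirling C_n → z^{q+1}/(√(2π) g₂(0)Γ(q+1)). The remainder of the exponential series is x^n/n! times
a kernel tending to 1/(1-ζ) (`exp_sub_expSum`, `tendsto_tailKernel`); so for |Re z| < 1, B_n = U_n +
(-1)^n n^{q-p} V_n with U_n → g₂(0)Γ(q+1)/(1-z) and V_n → g₁(0)Γ(p+1)/(1+z). The sign of Re p - Re q
decides which endpoint wins.

No zeros accumulate off the arc: for |z| ≤ 1 the factor (z e^{1-z})^n is exponentially small, so the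
ratio is near 1, or exponentially large, so B_n would have to nearly vanish; for |z| > 1 the partial
sum itself has limits of the same shape as B_n (`EndpointAsymp.tendsto_endSum`). The two terms of
B_n can cancel only if Re p = Re q and their moduli agree, and not for all large n, because (-1)^n
changes sign.

Zeros do accumulate on the arc: at z = ξ(1 + d/((1-ξ)n)) the power is about e^{d - iτn}. Letting d
absorb √n and the power of n gives the limit form 1 - K_n e^{-w}, and a Hurwitz argument produces
zeros (`eventually_exists_zero_near`). At z = 1 + w/√n the same identity gives a half-line Gaussian,
hence erfc, plus a left-endpoint term of order n^{Re(q-p)-1/2} (`tendsto_corner`).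

If r > -1, the left part vanishes near y = 0 and counts as a power law with coefficient 0 and
exponent q+1, so this case is subsumed under Re q < Re p.

Limits are taken along a general filter `l` with an index map `N`. With `atTop` this gives
sequences; with `atTop ×ˢ 𝓝 w₀`, locally uniform limits; with that filter restricted to the pairs
(n, z) where z is a zero, cluster points. -/

open MeasureTheory Set

/-! ### Watson's lemma at an endpoint. -/

/-- `G` is integrable on `(0, 1)` and behaves like `c y ^ a` as `y → 0+`. -/
structure EndpointAsymp (G : ℝ → ℂ) (a c : ℂ) : Prop where
  integrableOn : IntegrableOn G (Ioo 0 1)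
  neg_one_lt : -1 < a.re
  tendsto : Tendsto (fun y : ℝ => (y : ℂ) ^ (-a) * G y) (𝓝[>] 0) (𝓝 c)

theorem tendsto_rpow_mul_exp_neg_mul_zero {ι : Type*} {l : Filter ι} {N : ι → ℝ}
    (hN : Tendsto N l atTop) (s : ℝ) {b : ℝ} (hb : 0 < b) :
    Tendsto (fun i => N i ^ s * Real.exp (-b * N i)) l (𝓝 0) :=
  (tendsto_rpow_mul_exp_neg_mul_atTop_nhds_zero s b hb).comp hN

/-- Substitute y = s/N. Near 0 the power law of G and the decay of k give the dominating function
s^{Re a} e^{-εs}; on [δ,1) the kernel is exponentially small and only integrability of G is needed.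
-/
theorem EndpointAsymp.tendsto_integral {G : ℝ → ℂ} {a c : ℂ} (hG : EndpointAsymp G a c)
    {ι : Type*} {l : Filter ι} [l.IsCountablyGenerated] {N : ι → ℝ} (hN : Tendsto N l atTop)
    {k : ι → ℝ → ℂ} {κ : ℝ → ℂ} {B ε : ℝ} (hε : 0 < ε)
    (hcont : ∀ᶠ i in l, Continuous (k i))
    (hbound : ∀ᶠ i in l, ∀ y ∈ Ioo (0 : ℝ) 1, ‖k i y‖ ≤ B * Real.exp (-ε * (N i * y)))
    (hlim : ∀ y : ℝ, 0 < y → Tendsto (fun i => k i (y / N i)) l (𝓝 (κ y))) :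
    Tendsto (fun i => (N i : ℂ) ^ (a + 1) * ∫ y in Ioo (0 : ℝ) 1, G y * k i y) l
      (𝓝 (c * ∫ y in Ioi (0 : ℝ), (y : ℂ) ^ a * κ y)) := by
  obtain ⟨δ, hδ, hδ1, hC⟩ : ∃ δ : ℝ, 0 < δ ∧ δ < 1 ∧
      ∀ y ∈ Ioo 0 δ, ‖(y : ℂ) ^ (-a) * G y‖ ≤ ‖c‖ + 1 := by
    have h1 := (hG.tendsto.norm).eventually (ge_mem_nhds (lt_add_one ‖c‖))
    obtain ⟨d, hd, h2⟩ := mem_nhdsGT_iff_exists_Ioo_subset.1 h1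
    refine ⟨min d (1 / 2), lt_min hd (by norm_num), (min_le_right _ _).trans_lt (by norm_num), ?_⟩
    intro y hy
    exact h2 ⟨hy.1, hy.2.trans_le (min_le_left _ _)⟩
  -- The sign of B is forced by the bound on a norm, hence only eventually along `l`, which may be
  -- trivial.
  have hB : ∀ᶠ i in l, 0 ≤ B := by
    filter_upwards [hbound] with i hi
    have := (norm_nonneg _).trans (hi (1/2) (by norm_num))
    by_contra h
    exact absurd this (not_le.2 (mul_neg_of_neg_of_pos (not_le.1 h) (Real.exp_pos _)))
  have hGk : ∀ᶠ i in l, IntegrableOn (fun y => G y * k i y) (Ioo 0 1) := by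
    filter_upwards [hcont, hbound, hN.eventually_gt_atTop 0, hB] with i h1 h2 h3 hB
    refine hG.integrableOn.mul_bdd (c := B) h1.aestronglyMeasurable ?_
    refine (ae_restrict_iff' measurableSet_Ioo).2 (ae_of_all _ fun y hy => (h2 y hy).trans ?_)
    refine mul_le_of_le_one_right hB (Real.exp_le_one_iff.2 ?_)
    have := mul_pos hε (mul_pos h3 hy.1)
    linarith
  -- the part near the endpoint
  have hnear : Tendsto (fun i => (N i : ℂ) ^ (a + 1) * ∫ y in Ioo (0 : ℝ) δ, G y * k i y) l
      (𝓝 (c * ∫ y in Ioi (0 : ℝ), (y : ℂ) ^ a * κ y)) := by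
    set F : ι → ℝ → ℂ := fun i => (Ioo (0 : ℝ) δ).indicator (fun y => G y * k i y) with hF
    -- The substitution y = s/N uses up one of the a+1 powers of N.
    have key : ∀ᶠ i in l, (N i : ℂ) ^ (a + 1) * ∫ y in Ioo (0 : ℝ) δ, G y * k i y
        = ∫ s in Ioi (0 : ℝ), (N i : ℂ) ^ a * F i (s / N i) := by
      filter_upwards [hN.eventually_gt_atTop 0] with i hi
      have e1 : ∫ s in Ioi (0 : ℝ), (N i : ℂ) ^ a * F i (s / N i)
          = ∫ s : ℝ, (N i : ℂ) ^ a * F i (s / N i) := by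
        rw [← integral_indicator measurableSet_Ioi]
        congr 1
        ext s
        by_cases hs : 0 < s
        · rw [indicator_of_mem (mem_Ioi.2 hs)]
        · rw [indicator_of_notMem (by simpa using hs), hF]
          simp only
          rw [indicator_of_notMem, mul_zero]
          intro h
          exact hs (by simpa [hi] using (div_pos_iff_of_pos_right hi).1 h.1)
      rw [e1, integral_const_mul, Measure.integral_comp_div, abs_of_pos hi, hF,
        integral_indicator measurableSet_Ioo, Complex.cpow_add _ _ (by exact_mod_cast hi.ne'),
        Complex.cpow_one, Complex.real_smul]
      ring
    refine (tendsto_congr' key).2 ?_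
    rw [← integral_const_mul]
    refine tendsto_integral_filter_of_dominated_convergence
      (fun s => (‖c‖ + 1) * B * (s ^ a.re * Real.exp (-ε * s ^ (1 : ℝ)))) ?_ ?_ ?_ ?_
    · filter_upwards [hGk, hN.eventually_gt_atTop 0] with i h1 hi
      have : Integrable (F i) :=
        (integrable_indicator_iff measurableSet_Ioo).2 (h1.mono_set (Ioo_subset_Ioo_right hδ1.le))
      exact ((this.comp_div hi.ne').const_mul _).aestronglyMeasurable.restrict
    · filter_upwards [hbound, hN.eventually_gt_atTop 0, hB] with i h1 hi hB
      refine (ae_restrict_iff' measurableSet_Ioi).2 (ae_of_all _ fun s hs => ?_)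
      rw [mem_Ioi] at hs
      have hpos : 0 ≤ (‖c‖ + 1) * B * (s ^ a.re * Real.exp (-ε * s ^ (1 : ℝ))) := by positivity
      by_cases hm : s / N i ∈ Ioo 0 δ
      · have h2 := hC _ hm
        have h3 := h1 _ ⟨hm.1, hm.2.trans hδ1⟩
        simp only [hF, indicator_of_mem hm]
        rw [Real.rpow_one]
        -- N^a = s^a (s/N)^{-a} exposes the quotient whose limit is c.
        have e : (N i : ℂ) ^ a * (G (s / N i) * k i (s / N i))
            = (s : ℂ) ^ a * (((s / N i : ℝ) : ℂ) ^ (-a) * G (s / N i)) * k i (s / N i) := by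
          have h4 : (s : ℂ) ^ a = (N i : ℂ) ^ a * ((s / N i : ℝ) : ℂ) ^ a := by
            rw [← Complex.mul_cpow_ofReal_nonneg hi.le hm.1.le, ← Complex.ofReal_mul]
            congr 2
            field_simp
          have h5 : ((s / N i : ℝ) : ℂ) ^ a ≠ 0 := by
            rw [Complex.cpow_ne_zero_iff]
            left
            exact_mod_cast hm.1.ne'
          rw [h4, Complex.cpow_neg]
          field_simp
        rw [e, norm_mul, norm_mul, Complex.norm_cpow_eq_rpow_re_of_pos hs]
        have h6 : N i * (s / N i) = s := by field_simp
        rw [h6] at h3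
        calc _ ≤ s ^ a.re * (‖c‖ + 1) * (B * Real.exp (-ε * s)) := by gcongr
          _ = _ := by ring
      · simp only [hF, indicator_of_notMem hm, mul_zero, norm_zero]
        exact hpos
    · exact (integrableOn_rpow_mul_exp_neg_mul_rpow hG.neg_one_lt one_pos hε).const_mul _
    · refine (ae_restrict_iff' measurableSet_Ioi).2 (ae_of_all _ fun s hs => ?_)
      rw [mem_Ioi] at hs
      have h0 : Tendsto (fun i => s / N i) l (𝓝[>] 0) := by
        refine tendsto_nhdsWithin_iff.2 ⟨hN.const_div_atTop s, ?_⟩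
        filter_upwards [hN.eventually_gt_atTop 0] with i hi
        exact div_pos hs hi
      have h1 := ((hG.tendsto.comp h0).mul (hlim s hs)).const_mul ((s : ℂ) ^ a)
      have : c * ((s : ℂ) ^ a * κ s) = (s : ℂ) ^ a * (c * κ s) := by ring
      rw [this]
      refine h1.congr' ?_
      filter_upwards [hN.eventually_gt_atTop 0, h0.eventually (Ioo_mem_nhdsGT hδ)] with i hi hm
      simp only [hF, indicator_of_mem (show s / N i ∈ Ioo 0 δ from hm), Function.comp]
      have h4 : (s : ℂ) ^ a = (N i : ℂ) ^ a * ((s / N i : ℝ) : ℂ) ^ a := by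
        rw [← Complex.mul_cpow_ofReal_nonneg hi.le hm.1.le, ← Complex.ofReal_mul]
        congr 2
        field_simp
      have h5 : ((s / N i : ℝ) : ℂ) ^ a ≠ 0 := by
        rw [Complex.cpow_ne_zero_iff]
        left
        exact_mod_cast hm.1.ne'
      rw [h4, Complex.cpow_neg]
      field_simp
  -- the rest
  have hfar : Tendsto (fun i => (N i : ℂ) ^ (a + 1) * ∫ y in Ico δ 1, G y * k i y) l (𝓝 0) := by
    refine squeeze_zero_norm' (a := fun i => (B * ∫ y in Ioo (0:ℝ) 1, ‖G y‖) *
      (N i ^ (a + 1).re * Real.exp (-(ε * δ) * N i))) ?_ ?_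
    · filter_upwards [hbound, hN.eventually_gt_atTop 0, hB] with i h1 hi hB
      rw [norm_mul, Complex.norm_cpow_eq_rpow_re_of_pos hi]
      have h2 : ‖∫ y in Ico δ 1, G y * k i y‖
          ≤ ∫ y in Ico δ 1, ‖G y‖ * (B * Real.exp (-(ε * δ) * N i)) := by
        refine norm_integral_le_of_norm_le ?_ ?_
        · exact ((hG.integrableOn.mono_set
            (fun y hy => ⟨hδ.trans_le hy.1, hy.2⟩)).norm).mul_const _
        · refine (ae_restrict_iff' measurableSet_Ico).2 (ae_of_all _ fun y hy => ?_)
          rw [norm_mul]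
          refine mul_le_mul_of_nonneg_left ((h1 y ⟨hδ.trans_le hy.1, hy.2⟩).trans ?_)
            (norm_nonneg _)
          refine mul_le_mul_of_nonneg_left (Real.exp_le_exp.2 ?_) hB
          have := mul_le_mul_of_nonneg_left hy.1 (mul_pos hε hi).le
          nlinarith
      rw [integral_mul_const] at h2
      have h3 : ∫ y in Ico δ 1, ‖G y‖ ≤ ∫ y in Ioo (0:ℝ) 1, ‖G y‖ :=
        setIntegral_mono_set hG.integrableOn.norm (ae_of_all _ fun _ => norm_nonneg _)
          (LE.le.eventuallyLE fun y hy => ⟨hδ.trans_le hy.1, hy.2⟩)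
      calc _ ≤ N i ^ (a + 1).re *
            ((∫ y in Ioo (0:ℝ) 1, ‖G y‖) * (B * Real.exp (-(ε * δ) * N i))) := by
            gcongr
            exact h2.trans (by gcongr)
        _ = _ := by ring
    · simpa using (tendsto_rpow_mul_exp_neg_mul_zero hN (a + 1).re (mul_pos hε hδ)).const_mul
        (B * ∫ y in Ioo (0:ℝ) 1, ‖G y‖)
  rw [← add_zero (c * _)]
  refine (hnear.add hfar).congr' ?_
  filter_upwards [hGk] with i hi
  rw [← mul_add, ← setIntegral_union _ measurableSet_Ico
    (hi.mono_set (Ioo_subset_Ioo_right hδ1.le))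
    (hi.mono_set (fun y hy => ⟨hδ.trans_le hy.1, hy.2⟩)), Ioo_union_Ico_eq_Ioo hδ hδ1.le]
  exact Set.disjoint_left.2 fun y h1 h2 => absurd h1.2 (not_lt.2 h2.1)

/-! ### The Laplace transform of a complex power, and Stirling's formula. -/

theorem integrableOn_cpow_mul_exp_neg_mul {a z : ℂ} (ha : -1 < a.re) (hz : 0 < z.re) :
    IntegrableOn (fun t : ℝ => (t : ℂ) ^ a * Complex.exp (-(z * t))) (Ioi 0) := by
  have h := integrableOn_rpow_mul_exp_neg_mul_rpow ha one_pos hz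
  refine Integrable.mono' h ?_ ?_
  · refine ContinuousOn.aestronglyMeasurable ?_ measurableSet_Ioi
    refine ContinuousOn.mul ?_ (by fun_prop)
    intro t ht
    exact (Complex.continuousAt_ofReal_cpow_const t a (Or.inr (ne_of_gt ht))).continuousWithinAt
  · refine (ae_restrict_iff' measurableSet_Ioi).2 (ae_of_all _ fun t ht => ?_)
    rw [norm_mul, Complex.norm_cpow_eq_rpow_re_of_pos ht, Complex.norm_exp, Real.rpow_one]
    simp

/-- Identity theorem: both sides are analytic in z on the right half-plane and agree for real z > 0
by the definition of Γ after rescaling. -/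
theorem integral_cpow_mul_exp_neg_mul_Ioi_of_re_pos {a z : ℂ} (ha : -1 < a.re) (hz : 0 < z.re) :
    ∫ t in Ioi (0 : ℝ), (t : ℂ) ^ a * Complex.exp (-(z * t))
      = z ^ (-(a + 1)) * Complex.Gamma (a + 1) := by
  set U : Set ℂ := {w | 0 < w.re} with hU
  have hUo : IsOpen U := isOpen_lt continuous_const Complex.continuous_re
  have hUc : IsPreconnected U := (convex_halfSpace_re_gt 0).isPreconnected
  have hL : DifferentiableOn ℂ
      (fun w => ∫ t in Ioi (0 : ℝ), (t : ℂ) ^ a * Complex.exp (-(w * t))) U := by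
    intro w hw
    have hw' : 0 < w.re := hw
    refine DifferentiableAt.differentiableWithinAt ?_
    refine HasDerivAt.differentiableAt (f' := ∫ t in Ioi (0 : ℝ),
      (t : ℂ) ^ a * (Complex.exp (-(w * t)) * (-t))) ?_
    refine (hasDerivAt_integral_of_dominated_loc_of_deriv_le
      (F := fun w (t : ℝ) => (t : ℂ) ^ a * Complex.exp (-(w * t)))
      (F' := fun w (t : ℝ) => (t : ℂ) ^ a * (Complex.exp (-(w * t)) * (-t)))
      (bound := fun t => t ^ (a.re + 1) * Real.exp (-(w.re / 2) * t ^ (1 : ℝ)))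
      (Metric.ball_mem_nhds w (half_pos hw')) ?_ ?_ ?_ ?_ ?_ ?_).2
    · filter_upwards [hUo.mem_nhds hw] with x hx
      exact (integrableOn_cpow_mul_exp_neg_mul ha hx).aestronglyMeasurable
    · exact integrableOn_cpow_mul_exp_neg_mul ha hw
    · have := ((integrableOn_cpow_mul_exp_neg_mul ha hw').aestronglyMeasurable.mul
        (g := fun t : ℝ => -(t : ℂ)) (by fun_prop))
      refine this.congr (ae_of_all _ fun t => ?_)
      simp [mul_assoc]
    · refine (ae_restrict_iff' measurableSet_Ioi).2 (ae_of_all _ fun t ht x hx => ?_)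
      rw [mem_Ioi] at ht
      rw [norm_mul, norm_mul, Complex.norm_cpow_eq_rpow_re_of_pos ht, Complex.norm_exp,
        Real.rpow_one, norm_neg, Complex.norm_real, Real.norm_of_nonneg ht.le,
        Real.rpow_add_one ht.ne']
      have h1 : (-(x * (t : ℂ))).re ≤ -(w.re / 2) * t := by
        have h2 : |x.re - w.re| < w.re / 2 := by
          have := Complex.abs_re_le_norm (x - w)
          rw [Complex.sub_re] at this
          exact this.trans_lt (by simpa [dist_eq_norm] using hx)
        have h3 := (abs_lt.1 h2).1
        simp only [Complex.neg_re, Complex.mul_re, Complex.ofReal_re, Complex.ofReal_im, mul_zero,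
          sub_zero]
        nlinarith
      calc t ^ a.re * (Real.exp (-(x * (t : ℂ))).re * t)
          ≤ t ^ a.re * (Real.exp (-(w.re / 2) * t) * t) := by gcongr
        _ = _ := by ring
    · exact integrableOn_rpow_mul_exp_neg_mul_rpow (by linarith) one_pos (half_pos hw')
    · refine ae_of_all _ fun t x _ => ?_
      have h1 : HasDerivAt (fun x : ℂ => -(x * (t : ℂ))) (-(t : ℂ)) x := by
        simpa using ((hasDerivAt_id x).mul_const (t : ℂ)).fun_neg
      exact h1.cexp.const_mul _
  have hR : DifferentiableOn ℂ (fun w : ℂ => w ^ (-(a + 1)) * Complex.Gamma (a + 1)) U := by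
    intro w hw
    refine DifferentiableAt.differentiableWithinAt ?_
    refine DifferentiableAt.mul_const ?_ _
    exact DifferentiableAt.cpow_const differentiableAt_id (Or.inl hw)
  refine (hL.analyticOnNhd hUo).eqOn_of_preconnected_of_frequently_eq (hR.analyticOnNhd hUo) hUc
    (z₀ := 1) (by simp [hU]) ?_ hz
  -- The real points 1 + 1/(n+1) accumulate at 1 without reaching it, which is all the identity
  -- theorem asks.
  have h1 : Tendsto (fun n : ℕ => (((1 + 1 / ((n : ℝ) + 1) : ℝ)) : ℂ)) atTop (𝓝[≠] 1) := by
    refine tendsto_nhdsWithin_iff.2 ⟨?_, Eventually.of_forall fun n => ?_⟩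
    · have := (tendsto_one_div_add_atTop_nhds_zero_nat (𝕜 := ℝ)).const_add 1
      rw [add_zero] at this
      exact_mod_cast (Complex.continuous_ofReal.tendsto _).comp this
    · rw [mem_compl_iff, mem_singleton_iff]
      have : (0 : ℝ) < 1 / ((n : ℝ) + 1) := by positivity
      exact fun h => (lt_add_of_pos_right (1 : ℝ) this).ne' (by exact_mod_cast h)
  refine h1.frequently (Eventually.frequently (Eventually.of_forall fun n => ?_))
  have hpos : (0 : ℝ) < 1 + 1 / ((n : ℝ) + 1) := by positivity
  have h2 := Complex.integral_cpow_mul_exp_neg_mul_Ioi (a := a + 1) (by simpa using by linarith)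
    hpos
  rw [add_sub_cancel_right] at h2
  refine h2.trans ?_
  rw [one_div, Complex.inv_cpow, Complex.cpow_neg]
  rw [Complex.arg_ofReal_of_nonneg hpos.le]
  exact Real.pi_pos.ne

theorem tendsto_pow_mul_exp_neg_div_factorial :
    Tendsto (fun n : ℕ => (n : ℝ) ^ n * Real.exp (-n) * √n / n.factorial) atTop
      (𝓝 (1 / √(2 * Real.pi))) := by
  have h := (Stirling.tendsto_stirlingSeq_sqrt_pi.const_mul √2).inv₀ (by positivity)
  rw [← Real.sqrt_mul (by norm_num), ← one_div] at h
  refine h.congr fun n => ?_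
  rw [Stirling.stirlingSeq, Real.sqrt_mul (by norm_num), div_pow, ← Real.exp_nat_mul, mul_one,
    Real.exp_neg]
  field_simp

/-! ### The integral remainder of the exponential series. -/

/-- The first `n` terms of the exponential series. -/
noncomputable def expSum (n : ℕ) (x : ℂ) : ℂ := ∑ k ∈ Finset.range n, x ^ k / (k.factorial : ℂ)

/-- The normalized remainder `n ∫_0^1 (1 - v)^{n-1} e^{nζv} dv` of the exponential series. -/
noncomputable def tailKernel (n : ℕ) (ζ : ℂ) : ℂ :=
  n * ∫ v in Ioo (0 : ℝ) 1, (1 : ℂ) * ((1 - v : ℂ) ^ (n - 1) * Complex.exp (n * ζ * v))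

theorem continuous_expSum (n : ℕ) : Continuous (expSum n) := by
  unfold expSum
  fun_prop

theorem hasDerivAt_expSum_succ (n : ℕ) (x : ℂ) :
    HasDerivAt (expSum (n + 1)) (expSum n x) x := by
  induction n with
  | zero =>
    have : expSum 1 = fun _ => 1 := by ext; simp [expSum]
    rw [zero_add, this]
    simpa [expSum] using hasDerivAt_const x (1 : ℂ)
  | succ n ih =>
    have e : expSum (n + 1 + 1) = fun y => expSum (n + 1) y + y ^ (n + 1) / ((n + 1).factorial : ℂ) := by
      ext y
      rw [expSum, Finset.sum_range_succ]
      rfl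
    have e' : expSum (n + 1) x = expSum n x + x ^ n / (n.factorial : ℂ) := by
      rw [expSum, Finset.sum_range_succ]
      rfl
    rw [e, e']
    refine ih.add ?_
    have := (hasDerivAt_pow (n + 1) x).div_const ((n + 1).factorial : ℂ)
    convert! this using 1
    have h1 : (n.factorial : ℂ) ≠ 0 := by exact_mod_cast n.factorial_ne_zero
    have h2 : (n : ℂ) + 1 ≠ 0 := by exact_mod_cast n.succ_ne_zero
    rw [Nat.factorial_succ]
    push_cast
    field_simp

/-- The function v ↦ e^{xv} E_n(x(1-v)), with E_n the truncated series, runs from E_n(x) to e^x on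
[0,1]. In its derivative all but one term of the series cancel, which leaves the kernel. -/
theorem exp_sub_expSum {n : ℕ} (hn : n ≠ 0) (x : ℂ) :
    Complex.exp x - expSum n x = x ^ n / (n.factorial : ℂ) * tailKernel n (x / n) := by
  obtain ⟨m, rfl⟩ := Nat.exists_eq_succ_of_ne_zero hn
  have hF : ∀ v : ℝ, HasDerivAt
      (fun v : ℝ => Complex.exp (x * v) * expSum (m + 1) (x * (1 - v)))
      (x ^ (m + 1) / (m.factorial : ℂ) * ((1 - v : ℂ) ^ m * Complex.exp (x * v))) v := by
    intro v
    have h0 : HasDerivAt (fun v : ℝ => (v : ℂ)) 1 v := Complex.ofRealCLM.hasDerivAt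
    have h1 : HasDerivAt (fun v : ℝ => Complex.exp (x * v)) (Complex.exp (x * v) * x) v := by
      have := (h0.const_mul x).cexp
      simpa using this
    have h2 : HasDerivAt (fun v : ℝ => x * (1 - (v : ℂ))) (-x) v := by
      have := (h0.const_sub 1).const_mul x
      simpa using this
    have h3 := h1.mul ((hasDerivAt_expSum_succ m (x * (1 - v))).comp_of_eq v h2 rfl)
    refine h3.congr_deriv ?_
    have e' : expSum (m + 1) (x * (1 - v))
        = expSum m (x * (1 - v)) + (x * (1 - v)) ^ m / (m.factorial : ℂ) := by
      rw [expSum, Finset.sum_range_succ]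
      rfl
    simp only [Function.comp]
    rw [e', mul_pow]
    ring
  have hint := intervalIntegral.integral_eq_sub_of_hasDerivAt (fun v _ => hF v)
    (a := 0) (b := 1) (Continuous.intervalIntegrable (by fun_prop) _ _)
  have e0 : expSum (m + 1) 0 = 1 := by
    rw [expSum, Finset.sum_range_succ']
    simp
  simp only [Complex.ofReal_one, sub_self, mul_zero, mul_one, Complex.ofReal_zero, sub_zero,
    Complex.exp_zero, one_mul, e0] at hint
  rw [← hint, intervalIntegral.integral_const_mul, intervalIntegral.integral_of_le zero_le_one,
    integral_Ioc_eq_integral_Ioo, tailKernel, Nat.succ_sub_one]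
  have h1 : (m.factorial : ℂ) ≠ 0 := by exact_mod_cast m.factorial_ne_zero
  have h2 : (m : ℂ) + 1 ≠ 0 := by exact_mod_cast m.succ_ne_zero
  have h3 : ((m.succ : ℕ) : ℂ) * (x / (m.succ : ℕ)) = x := by
    push_cast
    field_simp
  simp_rw [h3, one_mul]
  generalize ∫ v in Ioo (0 : ℝ) 1, (1 - (v : ℂ)) ^ m * Complex.exp (x * v) = I
  rw [Nat.factorial_succ]
  push_cast
  field_simp

theorem continuous_tailKernel (n : ℕ) : Continuous (tailKernel n) := by
  have : tailKernel n = fun ζ => n * ∫ v in (0 : ℝ)..1,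
      (1 : ℂ) * ((1 - v : ℂ) ^ (n - 1) * Complex.exp (n * ζ * v)) := by
    ext ζ
    rw [intervalIntegral.integral_of_le zero_le_one, integral_Ioc_eq_integral_Ioo, tailKernel]
  rw [this]
  refine continuous_const.mul
    (intervalIntegral.continuous_parametric_intervalIntegral_of_continuous' ?_ 0 1)
  fun_prop

/-- At a real argument the integrand is positive, so taking moduli costs nothing there, and it
increases with Re ζ. This makes one real value of the kernel a majorant for all arguments z(1-y) in
`endTail`. -/
theorem norm_tailKernel_le {n : ℕ} {ζ : ℂ} {b : ℝ} (h : ζ.re ≤ b) :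
    ‖tailKernel n ζ‖ ≤ ‖tailKernel n b‖ := by
  have hI : ∀ c : ℂ, IntegrableOn
      (fun v : ℝ => (1 : ℂ) * ((1 - v : ℂ) ^ (n - 1) * Complex.exp (n * c * v))) (Ioo 0 1) :=
    fun c => (Continuous.integrableOn_Icc (by fun_prop)).mono_set Ioo_subset_Icc_self
  have key : ∫ v in Ioo (0 : ℝ) 1, (1 : ℂ) * ((1 - v : ℂ) ^ (n - 1) * Complex.exp (n * b * v))
      = ((∫ v in Ioo (0 : ℝ) 1, (1 - v) ^ (n - 1) * Real.exp (n * b * v) : ℝ) : ℂ) := by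
    rw [← integral_complex_ofReal]
    congr 1
    ext v
    push_cast
    ring
  rw [tailKernel, tailKernel, norm_mul, norm_mul]
  refine mul_le_mul_of_nonneg_left ?_ (norm_nonneg _)
  rw [key, Complex.norm_real]
  refine le_trans ?_ (Real.le_norm_self _)
  refine norm_integral_le_of_norm_le
    ((Continuous.integrableOn_Icc (by fun_prop)).mono_set Ioo_subset_Icc_self) ?_
  refine (ae_restrict_iff' measurableSet_Ioo).2 (ae_of_all _ fun v hv => ?_)
  rw [one_mul, norm_mul, norm_pow, Complex.norm_exp]
  have e1 : ‖(1 - v : ℂ)‖ = 1 - v := by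
    have : (1 - v : ℂ) = ((1 - v : ℝ) : ℂ) := by push_cast; ring
    rw [this, Complex.norm_real, Real.norm_of_nonneg (by linarith [hv.2])]
  rw [e1]
  have h1 : (0 : ℝ) ≤ 1 - v := by linarith [hv.2]
  have h2 : (n * ζ * v : ℂ).re = n * ζ.re * v := by simp
  rw [h2]
  have := hv.1.le
  gcongr

/-- The constant weight makes the integral in `tailKernel`, written with a factor 1, an instance of
Watson's lemma. -/
theorem endpointAsymp_one : EndpointAsymp (fun _ => 1) 0 1 where
  integrableOn := integrableOn_const (by simp)
  neg_one_lt := by simp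
  tendsto := by simp

/-! ### Limits of the remainder kernel, for Re ζ < 1 and at the corner ζ = 1. -/

section

variable {ι : Type*} {l : Filter ι} {N : ι → ℕ}

theorem tendsto_natCast_real (hN : Tendsto N l atTop) :
    Tendsto (fun i => (N i : ℝ)) l atTop :=
  tendsto_natCast_atTop_atTop.comp hN

theorem tendsto_sqrt_natCast (hN : Tendsto N l atTop) :
    Tendsto (fun i => √(N i : ℝ)) l atTop :=
  Real.tendsto_sqrt_atTop.comp (tendsto_natCast_real hN)

theorem tendsto_ofReal_div_zero {M : ι → ℝ} (hM : Tendsto M l atTop) (y : ℝ) :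
    Tendsto (fun i => ((y / M i : ℝ) : ℂ)) l (𝓝 0) := by
  have := (Complex.continuous_ofReal.tendsto 0).comp (hM.const_div_atTop y)
  simpa [Function.comp_def] using this

theorem tendsto_one_sub_div_pow (hN : Tendsto N l atTop) (y : ℝ) :
    Tendsto (fun i => (1 - ((y / N i : ℝ) : ℂ)) ^ N i) l (𝓝 (Complex.exp (-y))) := by
  have h := (Complex.tendsto_one_add_div_pow_exp (-y : ℂ)).comp hN
  refine h.congr fun i => ?_
  simp only [Function.comp]
  push_cast
  ring

theorem tendsto_one_sub_div_pow_pred (hN : Tendsto N l atTop) (y : ℝ) :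
    Tendsto (fun i => (1 - ((y / N i : ℝ) : ℂ)) ^ (N i - 1)) l (𝓝 (Complex.exp (-y))) := by
  have h0 : Tendsto (fun i => 1 - ((y / N i : ℝ) : ℂ)) l (𝓝 1) := by
    simpa using (tendsto_ofReal_div_zero (tendsto_natCast_real hN) y).const_sub 1
  have h := (tendsto_one_sub_div_pow hN y).div h0 one_ne_zero
  rw [div_one] at h
  refine h.congr' ?_
  filter_upwards [hN.eventually_ge_atTop 1, h0.eventually_ne one_ne_zero] with i hi h1
  have : N i = (N i - 1) + 1 := by omega
  simp only [Pi.div_apply]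
  nth_rw 2 [this]
  rw [pow_succ, mul_div_assoc, div_self h1, mul_one]

theorem norm_one_sub_pow_le {n : ℕ} {v : ℝ} (hv : v ∈ Ioo (0 : ℝ) 1) :
    ‖(1 - (v : ℂ)) ^ n‖ ≤ Real.exp (-(n * v)) := by
  have : (1 - v : ℂ) = ((1 - v : ℝ) : ℂ) := by push_cast; ring
  rw [norm_pow, this, Complex.norm_real, Real.norm_of_nonneg (by linarith [hv.2])]
  calc (1 - v) ^ n ≤ (Real.exp (-v)) ^ n := by
        gcongr
        · linarith [hv.2]
        · exact Real.one_sub_le_exp_neg v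
    _ = _ := by rw [← Real.exp_nat_mul]; ring_nf

/-- On the scale v = y/n the integrand becomes e^{-y} e^{ζ₀y}, whose integral over the half-line is
1/(1-ζ₀). -/
theorem tendsto_tailKernel [l.IsCountablyGenerated] (hN : Tendsto N l atTop) {ζ : ι → ℂ} {ζ₀ : ℂ}
    (hζ : Tendsto ζ l (𝓝 ζ₀)) (h₀ : ζ₀.re < 1) :
    Tendsto (fun i => tailKernel (N i) (ζ i)) l (𝓝 (1 / (1 - ζ₀))) := by
  -- The bound B = e pays for the exponent n-1 in place of n; ε is half the gap 1 - Re ζ₀, the other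
  -- half absorbing the variation of ζ.
  have h := endpointAsymp_one.tendsto_integral (tendsto_natCast_real hN)
    (k := fun i v => (1 - v : ℂ) ^ (N i - 1) * Complex.exp (N i * ζ i * v))
    (κ := fun y => Complex.exp (-((1 - ζ₀) * y))) (B := Real.exp 1) (ε := (1 - ζ₀.re) / 2)
    (by linarith) (Eventually.of_forall fun i => by fun_prop) ?_ ?_
  · have hre : 0 < (1 - ζ₀).re := by simpa using h₀
    have h1 := integral_cpow_mul_exp_neg_mul_Ioi_of_re_pos (a := 0) (by simp) hre
    have hne : (1 - ζ₀) ≠ 0 := fun h => by simp [h] at hre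
    rw [h1] at h
    simp only [zero_add, Complex.cpow_one, Complex.cpow_neg, Complex.Gamma_one, mul_one,
      one_mul] at h
    rw [one_div]
    refine h.congr fun i => ?_
    simp [tailKernel]
  · have h1 : ∀ᶠ i in l, (ζ i).re < ζ₀.re + (1 - ζ₀.re) / 2 :=
      ((Complex.continuous_re.tendsto _).comp hζ).eventually_lt_const (by linarith)
    filter_upwards [h1, hN.eventually_ge_atTop 1] with i h1 hi v hv
    rw [norm_mul, Complex.norm_exp]
    have h2 : (N i * ζ i * v : ℂ).re = N i * (ζ i).re * v := by simp
    rw [h2]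
    have hnv : (0 : ℝ) ≤ N i * v := mul_nonneg (Nat.cast_nonneg _) hv.1.le
    calc _ ≤ Real.exp (-(((N i - 1 : ℕ) : ℝ) * v)) * Real.exp (N i * (ζ i).re * v) :=
          mul_le_mul_of_nonneg_right (norm_one_sub_pow_le hv) (Real.exp_pos _).le
      _ ≤ Real.exp 1 * Real.exp (-((1 - ζ₀.re) / 2) * (N i * v)) := by
          rw [← Real.exp_add, ← Real.exp_add, Nat.cast_sub hi]
          refine Real.exp_le_exp.2 ?_
          have := mul_le_mul_of_nonneg_right h1.le hnv
          push_cast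
          nlinarith [hv.1, hv.2]
  · intro y hy
    have h1 := tendsto_one_sub_div_pow_pred hN y
    have h2 : Tendsto (fun i => Complex.exp (N i * ζ i * ((y / N i : ℝ) : ℂ))) l
        (𝓝 (Complex.exp (ζ₀ * y))) := by
      refine (Complex.continuous_exp.tendsto _).comp ?_
      refine (hζ.mul_const (y : ℂ)).congr' ?_
      filter_upwards [hN.eventually_ge_atTop 1] with i hi
      have : (N i : ℂ) ≠ 0 := by exact_mod_cast (by omega : N i ≠ 0)
      push_cast
      field_simp
    have e : Complex.exp (-((1 - ζ₀) * y)) = Complex.exp (-y) * Complex.exp (ζ₀ * y) := by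
      rw [← Complex.exp_add]; ring_nf
    rw [e]
    exact h1.mul h2

/-- `∫_0^∞ e^{wu - u²/2} du`. -/
noncomputable def halfGauss (w : ℂ) : ℂ :=
  ∫ u in Ioi (0 : ℝ), Complex.exp (w * u - u ^ 2 / 2)

theorem tendsto_exp_sub_sq {M : ι → ℝ} (hM : Tendsto M l atTop) (u : ℝ) :
    Tendsto (fun i => ((M i) ^ 2 * (Real.log (1 - u / M i) + u / M i))) l (𝓝 (-(u ^ 2 / 2))) := by
  have h0 : Tendsto (fun i => u / M i) l (𝓝 0) := hM.const_div_atTop u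
  have hb : Tendsto (fun i => 2 * |u| ^ 3 * (M i)⁻¹) l (𝓝 0) := by
    simpa using (tendsto_inv_atTop_zero.comp hM).const_mul (2 * |u| ^ 3)
  refine tendsto_iff_norm_sub_tendsto_zero.2 (squeeze_zero' (Eventually.of_forall fun _ =>
    norm_nonneg _) ?_ hb)
  have h1 : ∀ᶠ i in l, |u / M i| < 1 / 2 := by
    simpa using (h0.abs).eventually_lt_const (by norm_num : |(0:ℝ)| < 1 / 2)
  filter_upwards [h1, hM.eventually_gt_atTop 0] with i h1 h2
  have h3 := Real.abs_log_sub_add_sum_range_le (h1.trans (by norm_num)) 2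
  simp only [Finset.sum_range_succ, Finset.sum_range_zero] at h3
  norm_num at h3
  have e : M i ^ 2 * (Real.log (1 - u / M i) + u / M i) - -(u ^ 2 / 2)
      = M i ^ 2 * (u / M i + (u / M i) ^ 2 / 2 + Real.log (1 - u / M i)) := by
    field_simp
    ring
  rw [Real.norm_eq_abs, e, abs_mul, abs_of_pos (by positivity : 0 < M i ^ 2)]
  have h4 : |u / M i| ^ 3 / (1 - |u / M i|) ≤ 2 * |u / M i| ^ 3 := by
    rw [div_le_iff₀ (by linarith)]
    nlinarith [pow_nonneg (abs_nonneg (u / M i)) 3]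
  calc _ ≤ M i ^ 2 * (2 * |u / M i| ^ 3) := by
        refine mul_le_mul_of_nonneg_left (le_trans ?_ h4) (by positivity)
        convert h3 using 2
    _ = _ := by
      rw [abs_div, abs_of_pos h2]
      field_simp

theorem tendsto_one_sub_div_sqrt_pow_pred (hN : Tendsto N l atTop) (u : ℝ) :
    Tendsto (fun i => (1 - ((u / √(N i) : ℝ) : ℂ)) ^ (N i - 1) * Complex.exp (√(N i) * u)) l
      (𝓝 (Complex.exp (-(u ^ 2 / 2)))) := by
  have hM := tendsto_sqrt_natCast hN
  have h0 : Tendsto (fun i => u / √(N i)) l (𝓝 0) := hM.const_div_atTop u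
  have h1 := (Real.continuous_exp.tendsto _).comp (tendsto_exp_sub_sq hM u)
  have h2 := h1.div (h0.const_sub 1) (by norm_num)
  have h3 := (Complex.continuous_ofReal.tendsto _).comp h2
  simp only [sub_zero, div_one, Complex.ofReal_exp] at h3
  push_cast at h3
  refine h3.congr' ?_
  have hs : ∀ᶠ i in l, u / √(N i) < 1 := h0.eventually_lt_const one_pos
  filter_upwards [hN.eventually_ge_atTop 1, hs] with i hi h1
  have hpos : 0 < 1 - u / √(N i) := by linarith
  have e : N i = (N i - 1) + 1 := by omega
  have hsq : √(N i : ℝ) ^ 2 = N i := Real.sq_sqrt (Nat.cast_nonneg _)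
  have hs0 : √(N i : ℝ) ≠ 0 := (Real.sqrt_pos.2 (by exact_mod_cast hi)).ne'
  simp only [Function.comp, Pi.div_apply]
  rw [mul_add, Real.exp_add, hsq, Real.exp_nat_mul, Real.exp_log hpos]
  have e2 : (N i : ℝ) * (u / √(N i)) = √(N i) * u := by
    rw [← mul_div_assoc, div_eq_iff hs0, mul_right_comm, Real.mul_self_sqrt (Nat.cast_nonneg _)]
  rw [e2]
  nth_rw 2 [e]
  rw [pow_succ]
  push_cast
  have hne : (1 - (u : ℂ) / (√(N i : ℝ) : ℂ)) ≠ 0 := by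
    exact_mod_cast hpos.ne'
  field_simp

/-- At ζ = 1 + w/√n the terms linear in nv cancel, so the kernel concentrates at v of order n^{-1/2}
instead of 1/n, and the quadratic term of n log(1-v) survives as e^{-u²/2}. Watson's lemma is
therefore used with large parameter √n. -/
theorem tendsto_tailKernel_corner [l.IsCountablyGenerated] (hN : Tendsto N l atTop)
    {w : ι → ℂ} {w₀ : ℂ} (hw : Tendsto w l (𝓝 w₀)) (h₀ : w₀.re < 0) :
    Tendsto (fun i => tailKernel (N i) (1 + w i / √(N i)) / √(N i)) l (𝓝 (halfGauss w₀)) := by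
  have hM := tendsto_sqrt_natCast hN
  -- The domination keeps only the factor e^{√n v Re w}; this is where Re w₀ < 0 enters.
  have h := endpointAsymp_one.tendsto_integral hM
    (k := fun i v => (1 - v : ℂ) ^ (N i - 1) * Complex.exp (N i * (1 + w i / √(N i)) * v))
    (κ := fun u => Complex.exp (w₀ * u - u ^ 2 / 2)) (B := Real.exp 1) (ε := -w₀.re / 2)
    (by linarith) (Eventually.of_forall fun i => by fun_prop) ?_ ?_
  · simp only [Complex.cpow_zero, zero_add, Complex.cpow_one, one_mul] at h
    rw [halfGauss]
    refine h.congr' ?_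
    filter_upwards [hM.eventually_gt_atTop 0] with i hi
    have hs : (√(N i : ℝ) : ℂ) ≠ 0 := by exact_mod_cast hi.ne'
    have hsq : (N i : ℂ) = (√(N i : ℝ) : ℂ) * (√(N i : ℝ) : ℂ) := by
      rw [← Complex.ofReal_mul, Real.mul_self_sqrt (Nat.cast_nonneg _), Complex.ofReal_natCast]
    simp only [tailKernel, one_mul]
    rw [eq_div_iff hs]
    generalize ∫ v in Ioo (0 : ℝ) 1, (1 - (v : ℂ)) ^ (N i - 1)
      * Complex.exp (N i * (1 + w i / √(N i)) * v) = I
    rw [hsq]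
    ring
  · have h1 : ∀ᶠ i in l, (w i).re < w₀.re / 2 :=
      ((Complex.continuous_re.tendsto _).comp hw).eventually_lt_const (by linarith)
    filter_upwards [h1, hN.eventually_ge_atTop 1, hM.eventually_gt_atTop 0] with i h1 hi hs v hv
    rw [norm_mul, Complex.norm_exp]
    have hsq : (N i : ℝ) = √(N i : ℝ) * √(N i : ℝ) :=
      (Real.mul_self_sqrt (Nat.cast_nonneg _)).symm
    have h2 : (N i * (1 + w i / √(N i)) * v : ℂ).re = N i * v + √(N i) * v * (w i).re := by
      have : (1 + w i / √(N i)).re = 1 + (w i).re / √(N i) := by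
        rw [Complex.add_re, Complex.div_ofReal_re, Complex.one_re]
      rw [Complex.re_mul_ofReal, ← Complex.ofReal_natCast, Complex.re_ofReal_mul, this]
      have : √(N i : ℝ) * (√(N i : ℝ) * ((w i).re / √(N i))) = √(N i) * (w i).re := by
        field_simp
      calc _ = N i * v + √(N i : ℝ) * (√(N i : ℝ) * ((w i).re / √(N i))) * v := by
            rw [← mul_assoc (√(N i : ℝ)), ← hsq]; ring
        _ = _ := by rw [this]; ring
    rw [h2]
    have hsv : 0 ≤ √(N i : ℝ) * v := mul_nonneg hs.le hv.1.le
    calc _ ≤ Real.exp (-(((N i - 1 : ℕ) : ℝ) * v)) * Real.exp (N i * v + √(N i) * v * (w i).re) :=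
          mul_le_mul_of_nonneg_right (norm_one_sub_pow_le hv) (Real.exp_pos _).le
      _ ≤ Real.exp 1 * Real.exp (-(-w₀.re / 2) * (√(N i) * v)) := by
          rw [← Real.exp_add, ← Real.exp_add, Nat.cast_sub hi]
          refine Real.exp_le_exp.2 ?_
          have := mul_le_mul_of_nonneg_left h1.le hsv
          push_cast
          nlinarith [hv.1, hv.2]
  · intro u hu
    have h1 := tendsto_one_sub_div_sqrt_pow_pred hN u
    have h2 : Tendsto (fun i => Complex.exp (w i * u)) l (𝓝 (Complex.exp (w₀ * u))) :=
      (Complex.continuous_exp.tendsto _).comp (hw.mul_const (u : ℂ))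
    have e : Complex.exp (w₀ * u - u ^ 2 / 2)
        = Complex.exp (-(u ^ 2 / 2)) * Complex.exp (w₀ * u) := by
      rw [← Complex.exp_add]; ring_nf
    rw [e]
    refine (h1.mul h2).congr' ?_
    filter_upwards [hM.eventually_gt_atTop 0] with i hi
    have hs : (√(N i : ℝ) : ℂ) ≠ 0 := by exact_mod_cast hi.ne'
    have hsq : (N i : ℂ) = (√(N i : ℝ) : ℂ) * (√(N i : ℝ) : ℂ) := by
      rw [← Complex.ofReal_mul, Real.mul_self_sqrt (Nat.cast_nonneg _), Complex.ofReal_natCast]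
    rw [mul_assoc, ← Complex.exp_add]
    congr 2
    rw [hsq]
    push_cast
    field_simp

end

/-! ### Contribution of a single endpoint. -/

/-- `∫_0^1 e^{x t} G(1 - t) dt`, written in the variable `y = 1 - t`. -/
noncomputable def endInt (G : ℝ → ℂ) (x : ℂ) : ℂ :=
  ∫ y in Ioo (0 : ℝ) 1, G y * Complex.exp (x * (1 - y))

/-- The sum of the first `n` Maclaurin terms of `endInt G`. -/
noncomputable def endSum (G : ℝ → ℂ) (n : ℕ) (x : ℂ) : ℂ :=
  ∫ y in Ioo (0 : ℝ) 1, G y * expSum n (x * (1 - y))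

/-- The normalized Maclaurin remainder of `endInt G` at `n z`. -/
noncomputable def endTail (G : ℝ → ℂ) (n : ℕ) (z : ℂ) : ℂ :=
  ∫ y in Ioo (0 : ℝ) 1, G y * ((1 - y) ^ n * tailKernel n (z * (1 - y)))

theorem integrableOn_mul_continuous {G k : ℝ → ℂ} (hG : IntegrableOn G (Ioo 0 1))
    (hk : Continuous k) : IntegrableOn (fun y => G y * k y) (Ioo 0 1) := by
  obtain ⟨C, hC⟩ := (isCompact_Icc (a := (0 : ℝ)) (b := 1)).exists_bound_of_continuousOn
    hk.continuousOn
  exact hG.mul_bdd hk.aestronglyMeasurable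
    ((ae_restrict_iff' measurableSet_Ioo).2 (ae_of_all _ fun y hy => hC y (Ioo_subset_Icc_self hy)))

theorem endInt_sub_endSum {G : ℝ → ℂ} (hG : IntegrableOn G (Ioo 0 1)) {n : ℕ} (hn : n ≠ 0) (z : ℂ) :
    endInt G (n * z) - endSum G n (n * z)
      = (n * z) ^ n / (n.factorial : ℂ) * endTail G n z := by
  have hc := continuous_expSum n
  rw [endInt, endSum, endTail, ← integral_sub (integrableOn_mul_continuous hG (by fun_prop))
    (integrableOn_mul_continuous hG (by fun_prop)), ← integral_const_mul]
  congr 1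
  ext y
  have hn' : (n : ℂ) ≠ 0 := by exact_mod_cast hn
  rw [← mul_sub, exp_sub_expSum hn, mul_pow, mul_assoc (n : ℂ), mul_div_cancel_left₀ _ hn']
  ring

section

variable {ι : Type*} {l : Filter ι} {N : ι → ℕ} {G : ℝ → ℂ} {a c : ℂ}

theorem EndpointAsymp.tendsto_endInt (hG : EndpointAsymp G a c) [l.IsCountablyGenerated]
    (hN : Tendsto N l atTop) {z : ι → ℂ} {z₀ : ℂ} (hz : Tendsto z l (𝓝 z₀)) (h₀ : 0 < z₀.re) :
    Tendsto (fun i => (N i : ℂ) ^ (a + 1) * (Complex.exp (-(N i * z i)) * endInt G (N i * z i))) l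
      (𝓝 (c * Complex.Gamma (a + 1) * z₀ ^ (-(a + 1)))) := by
  have h := hG.tendsto_integral (tendsto_natCast_real hN)
    (k := fun i y => Complex.exp (-(N i * z i * y)))
    (κ := fun y => Complex.exp (-(z₀ * y))) (B := 1) (ε := z₀.re / 2)
    (by linarith) (Eventually.of_forall fun i => by fun_prop) ?_ ?_
  · rw [integral_cpow_mul_exp_neg_mul_Ioi_of_re_pos hG.neg_one_lt h₀, mul_comm (z₀ ^ _),
      ← mul_assoc] at h
    refine h.congr fun i => ?_
    rw [endInt, ← integral_const_mul (Complex.exp (-(N i * z i))), Complex.ofReal_natCast]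
    congr 1
    refine integral_congr_ae (ae_of_all _ fun y => ?_)
    beta_reduce
    rw [mul_left_comm, ← Complex.exp_add]
    ring_nf
  · have h1 : ∀ᶠ i in l, z₀.re / 2 < (z i).re :=
      ((Complex.continuous_re.tendsto _).comp hz).eventually_const_lt (by linarith)
    filter_upwards [h1] with i h1 y hy
    rw [Complex.norm_exp, one_mul]
    refine Real.exp_le_exp.2 ?_
    have : (-(N i * z i * y) : ℂ).re = -(N i * (z i).re * y) := by simp
    rw [this]
    have := mul_le_mul_of_nonneg_right h1.le (mul_nonneg (Nat.cast_nonneg (N i)) hy.1.le)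
    nlinarith
  · intro y hy
    refine (Complex.continuous_exp.tendsto _).comp ?_
    refine (hz.mul_const (y : ℂ)).neg.congr' ?_
    filter_upwards [hN.eventually_ge_atTop 1] with i hi
    have : (N i : ℂ) ≠ 0 := by exact_mod_cast (by omega : N i ≠ 0)
    push_cast
    field_simp

/-- Shared by the bulk and the corner: on the scale y = s/N the factor (1-y)^N supplies e^{-s},
while the kernel, normalized by β, is frozen at its limit L, so the s-integral is Γ(a+1). -/
theorem EndpointAsymp.tendsto_endTail_of_kernel (hG : EndpointAsymp G a c)
    [l.IsCountablyGenerated] (hN : Tendsto N l atTop) {z β : ι → ℂ} {b : ι → ℝ} {L : ℂ} {B : ℝ}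
    (hb : ∀ᶠ i in l, 0 ≤ b i ∧ (z i).re ≤ b i)
    (hbB : ∀ᶠ i in l, ‖β i * tailKernel (N i) (b i)‖ ≤ B)
    (hlim : ∀ y : ℝ, 0 < y →
      Tendsto (fun i => β i * tailKernel (N i) (z i * (1 - ((y / N i : ℝ) : ℂ)))) l (𝓝 L)) :
    Tendsto (fun i => (N i : ℂ) ^ (a + 1) * (β i * endTail G (N i) (z i))) l
      (𝓝 (c * Complex.Gamma (a + 1) * L)) := by
  have h := hG.tendsto_integral (tendsto_natCast_real hN)
    (k := fun i y => (1 - y : ℂ) ^ (N i) * (β i * tailKernel (N i) (z i * (1 - y))))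
    (κ := fun y => Complex.exp (-(1 * y)) * L) (B := B) (ε := 1)
    one_pos (Eventually.of_forall fun i => by have := continuous_tailKernel (N i); fun_prop) ?_ ?_
  · have e := integral_cpow_mul_exp_neg_mul_Ioi_of_re_pos (z := 1) hG.neg_one_lt (by simp)
    rw [Complex.one_cpow, one_mul] at e
    simp_rw [← mul_assoc _ _ L] at h
    rw [integral_mul_const, e, ← mul_assoc] at h
    refine h.congr fun i => ?_
    rw [endTail, ← integral_const_mul (β i), Complex.ofReal_natCast]
    congr 1
    refine integral_congr_ae (ae_of_all _ fun y => ?_)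
    beta_reduce
    ring
  · filter_upwards [hb, hbB] with i ⟨h0, h1⟩ h2 y hy
    rw [norm_mul, mul_comm]
    have h3 : (z i * (1 - y)).re ≤ b i := by
      have : (z i * (1 - y)).re = (z i).re * (1 - y) := by
        have : (1 - y : ℂ) = ((1 - y : ℝ) : ℂ) := by push_cast; ring
        rw [this, Complex.re_mul_ofReal]
      rw [this]
      nlinarith [hy.1, hy.2]
    refine mul_le_mul ?_ ?_ (norm_nonneg _) ((norm_nonneg _).trans h2)
    · refine le_trans ?_ h2
      rw [norm_mul, norm_mul]
      exact mul_le_mul_of_nonneg_left (norm_tailKernel_le h3) (norm_nonneg _)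
    · refine (norm_one_sub_pow_le hy).trans_eq (by ring_nf)
  · intro y hy
    have := tendsto_one_sub_div_pow hN y
    simp only [one_mul]
    exact this.mul (hlim y hy)

theorem EndpointAsymp.tendsto_endTail (hG : EndpointAsymp G a c) [l.IsCountablyGenerated]
    (hN : Tendsto N l atTop) {z : ι → ℂ} {z₀ : ℂ} (hz : Tendsto z l (𝓝 z₀)) (h₀ : z₀.re < 1) :
    Tendsto (fun i => (N i : ℂ) ^ (a + 1) * endTail G (N i) (z i)) l
      (𝓝 (c * Complex.Gamma (a + 1) * (1 / (1 - z₀)))) := by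
  -- b ≥ 0 ensures that b also bounds Re(z(1-y)); b < 1 keeps the majorant kernel convergent.
  obtain ⟨b, hb0, hb, hb1⟩ : ∃ b : ℝ, 0 ≤ b ∧ z₀.re < b ∧ b < 1 :=
    ⟨max 0 ((z₀.re + 1) / 2), le_max_left _ _, lt_max_of_lt_right (by linarith),
      max_lt one_pos (by linarith)⟩
  have hB := ((tendsto_tailKernel hN (tendsto_const_nhds (x := (b : ℂ))) (by simpa)).norm).eventually_le_const
    (lt_add_one _)
  have h := hG.tendsto_endTail_of_kernel hN (β := fun _ => 1) (z := z) (b := fun _ => b)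
    (L := 1 / (1 - z₀)) ?_ (by simpa only [one_mul] using hB) ?_
  · simpa only [one_mul] using h
  · filter_upwards [((Complex.continuous_re.tendsto _).comp hz).eventually_lt_const hb] with i hi
    exact ⟨hb0, hi.le⟩
  · intro y hy
    simp only [one_mul]
    refine tendsto_tailKernel hN ?_ h₀
    simpa using hz.mul ((tendsto_ofReal_div_zero (tendsto_natCast_real hN) y).const_sub 1)

theorem EndpointAsymp.tendsto_endTail_corner (hG : EndpointAsymp G a c) [l.IsCountablyGenerated]
    (hN : Tendsto N l atTop) {w : ι → ℂ} {w₀ : ℂ} (hw : Tendsto w l (𝓝 w₀)) (h₀ : w₀.re < 0) :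
    Tendsto (fun i => (N i : ℂ) ^ (a + 1) * ((√(N i) : ℂ)⁻¹ * endTail G (N i) (1 + w i / √(N i)))) l
      (𝓝 (c * Complex.Gamma (a + 1) * halfGauss w₀)) := by
  have hM := tendsto_sqrt_natCast hN
  have hre : Tendsto (fun i => (((w i).re : ℝ) : ℂ)) l (𝓝 (w₀.re : ℂ)) :=
    (Complex.continuous_ofReal.tendsto _).comp ((Complex.continuous_re.tendsto _).comp hw)
  have hB := ((tendsto_tailKernel_corner hN hre (by simpa)).norm).eventually_le_const
    (lt_add_one _)
  have h0 : Tendsto (fun i => 1 + (w i).re / √(N i)) l (𝓝 1) := by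
    have := ((Complex.continuous_re.tendsto _).comp hw).mul
      (tendsto_inv_atTop_zero.comp hM)
    simpa [Function.comp_def, div_eq_mul_inv] using this.const_add 1
  refine hG.tendsto_endTail_of_kernel hN (b := fun i => 1 + (w i).re / √(N i))
    (B := ‖halfGauss (w₀.re : ℂ)‖ + 1) ?_ ?_ ?_
  · filter_upwards [h0.eventually_const_lt one_pos] with i hi
    refine ⟨hi.le, ?_⟩
    rw [Complex.add_re, Complex.div_ofReal_re, Complex.one_re]
  · filter_upwards [hB] with i hi
    rw [mul_comm, ← div_eq_mul_inv]
    push_cast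
    exact hi
  · intro y hy
    -- This is the w' for which (1 + w/√N)(1 - y/N) = 1 + w'/√N.
    have hw' : Tendsto (fun i => w i - ((y / √(N i) : ℝ) : ℂ) - w i * ((y / N i : ℝ) : ℂ)) l
        (𝓝 w₀) := by
      have := (hw.sub (tendsto_ofReal_div_zero hM y)).sub
        (hw.mul (tendsto_ofReal_div_zero (tendsto_natCast_real hN) y))
      simpa using this
    refine (tendsto_tailKernel_corner hN hw' h₀).congr' ?_
    filter_upwards [hM.eventually_gt_atTop 0] with i hi
    have hs : (√(N i : ℝ) : ℂ) ≠ 0 := by exact_mod_cast hi.ne'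
    have hsq : (N i : ℂ) = (√(N i : ℝ) : ℂ) * (√(N i : ℝ) : ℂ) := by
      rw [← Complex.ofReal_mul, Real.mul_self_sqrt (Nat.cast_nonneg _), Complex.ofReal_natCast]
    rw [div_eq_inv_mul]
    congr 2
    push_cast
    rw [hsq]
    field_simp
    ring

/-! ### Partial sums outside the unit disc. -/

theorem tendsto_descFactorial_div_pow (hN : Tendsto N l atTop) (j : ℕ) :
    Tendsto (fun i => (((N i).descFactorial j : ℕ) : ℂ) / (N i : ℂ) ^ j) l (𝓝 1) := by
  induction j with
  | zero => simpa using tendsto_const_nhds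
  | succ j ih =>
    have h1 : Tendsto (fun i => 1 - (j : ℂ) * ((1 / N i : ℝ) : ℂ)) l (𝓝 1) := by
      simpa using ((tendsto_ofReal_div_zero (tendsto_natCast_real hN) 1).const_mul
        (j : ℂ)).const_sub 1
    have h2 := h1.mul ih
    rw [one_mul] at h2
    refine h2.congr' ?_
    filter_upwards [hN.eventually_ge_atTop (j + 1)] with i hi
    have : (N i : ℂ) ≠ 0 := by exact_mod_cast (by omega : N i ≠ 0)
    rw [Nat.descFactorial_succ, Nat.cast_mul, Nat.cast_sub (by omega), pow_succ]
    push_cast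
    field_simp

/-- For |z| > 1 the last terms of the truncated series dominate, so it is summed backwards: a
perturbed geometric series in 1/z. It is written as an infinite sum with a cutoff, ready for
Tannery's theorem. -/
theorem factorial_div_mul_expSum {n : ℕ} {z : ℂ} (hz : z ≠ 0) (hn : n ≠ 0) (t : ℂ) :
    (n.factorial : ℂ) / (n * z) ^ n * expSum n (n * z * t)
      = ∑' j : ℕ, if j < n then
          ((n.descFactorial (j + 1) : ℕ) : ℂ) / (n : ℂ) ^ (j + 1) * (z⁻¹ ^ (j + 1) * t ^ (n - 1 - j))
        else 0 := by
  rw [tsum_eq_sum (s := Finset.range n) (fun j hj => if_neg (by simpa using hj)), expSum,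
    ← Finset.sum_range_reflect, Finset.mul_sum]
  refine Finset.sum_congr rfl fun j hj => ?_
  have hj : j < n := by simpa using hj
  rw [if_pos hj]
  have h1 : n = (n - 1 - j) + (j + 1) := by omega
  have h2 := Nat.factorial_mul_descFactorial (n := n) (k := j + 1) (by omega)
  have h3 : n - (j + 1) = n - 1 - j := by omega
  rw [h3] at h2
  rw [← h2]
  have h4 : (((n - 1 - j).factorial : ℕ) : ℂ) ≠ 0 := by exact_mod_cast Nat.factorial_ne_zero _
  have h5 : (n * z : ℂ) ^ n = (n * z) ^ (n - 1 - j) * (n * z) ^ (j + 1) := by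
    rw [← pow_add, ← h1]
  have hn' : (n : ℂ) ≠ 0 := by exact_mod_cast hn
  rw [h5]
  push_cast
  rw [mul_pow, mul_pow, mul_pow, mul_pow, inv_pow]
  field_simp

theorem norm_factorial_div_mul_expSum_le {n : ℕ} {z : ℂ} {ε y : ℝ} (hz : z ≠ 0) (hn : n ≠ 0)
    (hε : 0 < ε) (hε1 : ε ≤ 1) (hzε : ‖z⁻¹‖ ≤ Real.exp (-(2 * ε))) (hy : y ∈ Ioo (0 : ℝ) 1) :
    ‖(n.factorial : ℂ) / (n * z) ^ n * expSum n (n * z * (1 - y))‖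
      ≤ (1 - Real.exp (-ε))⁻¹ * Real.exp (-ε * (n * y)) := by
  have hlt : Real.exp (-ε) < 1 := Real.exp_zero ▸ Real.exp_lt_exp.2 (by linarith)
  rw [factorial_div_mul_expSum hz hn,
    tsum_eq_sum (s := Finset.range n) (fun j hj => if_neg (by simpa using hj))]
  have hs : ∑ j ∈ Finset.range n, Real.exp (-ε) ^ j ≤ (1 - Real.exp (-ε))⁻¹ := by
    rw [← tsum_geometric_of_lt_one (Real.exp_pos _).le hlt]
    exact (summable_geometric_of_lt_one (Real.exp_pos _).le hlt).sum_le_tsum _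
      fun _ _ => by positivity
  refine (norm_sum_le _ _).trans (le_trans ?_ (mul_le_mul_of_nonneg_right hs (Real.exp_pos _).le))
  rw [Finset.sum_mul]
  refine Finset.sum_le_sum fun j hj => ?_
  have hj : j < n := by simpa using hj
  rw [if_pos hj, norm_mul, norm_mul, norm_pow, norm_pow]
  have h1 : ‖((n.descFactorial (j + 1) : ℕ) : ℂ) / (n : ℂ) ^ (j + 1)‖ ≤ 1 := by
    rw [norm_div, norm_pow, Complex.norm_natCast, Complex.norm_natCast]
    refine div_le_one_of_le₀ ?_ (by positivity)
    exact_mod_cast Nat.descFactorial_le_pow n (j + 1)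
  have h2 : ‖(1 - y : ℂ)‖ ≤ Real.exp (-(ε * y)) := by
    have : (1 - y : ℂ) = ((1 - y : ℝ) : ℂ) := by push_cast; ring
    rw [this, Complex.norm_real, Real.norm_of_nonneg (by linarith [hy.2])]
    refine (Real.one_sub_le_exp_neg y).trans (Real.exp_le_exp.2 ?_)
    nlinarith [hy.1]
  -- Half of the decay 2ε makes the series in j summable; the other half, since y < 1, combines with
  -- the powers of 1-y into e^{-εny}.
  have h3 : ‖z⁻¹‖ ≤ Real.exp (-ε) * Real.exp (-(ε * y)) := by
    refine hzε.trans ?_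
    rw [← Real.exp_add]
    refine Real.exp_le_exp.2 ?_
    nlinarith [hy.2]
  have hnn : n = (n - 1 - j) + (j + 1) := by omega
  calc _ ≤ 1 * ((Real.exp (-ε) * Real.exp (-(ε * y))) ^ (j + 1)
          * Real.exp (-(ε * y)) ^ (n - 1 - j)) := by gcongr
    _ = Real.exp (-ε) ^ (j + 1) * Real.exp (-(ε * y)) ^ n := by
        have h4 : Real.exp (-(ε * y)) ^ n
            = Real.exp (-(ε * y)) ^ (n - 1 - j) * Real.exp (-(ε * y)) ^ (j + 1) := by
          rw [← pow_add, ← hnn]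
        rw [h4, mul_pow]
        ring
    _ ≤ Real.exp (-ε) ^ j * Real.exp (-(ε * y)) ^ n := by
        refine mul_le_mul_of_nonneg_right ?_ (by positivity)
        exact pow_le_pow_of_le_one (Real.exp_pos _).le hlt.le (Nat.le_succ j)
    _ = _ := by
        rw [← Real.exp_nat_mul (-(ε * y))]
        ring_nf

/-- Tannery's theorem: each coefficient n(n-1)⋯(n-j)/n^{j+1} tends to 1 and (1-y/n)^{n-1-j} to
e^{-y}, leaving the geometric series Σ z₀^{-(j+1)} = 1/(z₀-1). -/
theorem tendsto_factorial_div_mul_expSum (hN : Tendsto N l atTop) {z : ι → ℂ} {z₀ : ℂ}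
    (hz : Tendsto z l (𝓝 z₀)) (h₀ : 1 < ‖z₀‖) {y : ℝ} (hy : 0 < y) :
    Tendsto (fun i => ((N i).factorial : ℂ) / (N i * z i) ^ (N i)
      * expSum (N i) (N i * z i * (1 - ((y / N i : ℝ) : ℂ)))) l
      (𝓝 (Complex.exp (-y) * (1 / (z₀ - 1)))) := by
  have hz0 : z₀ ≠ 0 := norm_pos_iff.1 (one_pos.trans h₀)
  have hinv : Tendsto (fun i => (z i)⁻¹) l (𝓝 z₀⁻¹) := hz.inv₀ hz0
  have hlt : ‖z₀⁻¹‖ < 1 := by rw [norm_inv]; exact inv_lt_one_of_one_lt₀ h₀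
  obtain ⟨ρ, hρ, hρ1⟩ := exists_between hlt
  have hρ0 : 0 < ρ := (norm_nonneg _).trans_lt hρ
  have hval : ∑' j : ℕ, z₀⁻¹ ^ (j + 1) * Complex.exp (-y) = Complex.exp (-y) * (1 / (z₀ - 1)) := by
    rw [tsum_mul_right, mul_comm]
    congr 1
    simp_rw [pow_succ]
    rw [tsum_mul_right, tsum_geometric_of_norm_lt_one hlt]
    have : z₀ - 1 ≠ 0 := fun h => by
      rw [sub_eq_zero.1 h] at h₀
      simp at h₀
    have h2 : 1 - z₀⁻¹ ≠ 0 := fun h => by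
      rw [← sub_eq_zero.1 h] at hlt
      simp at hlt
    field_simp
  rw [← hval]
  have h0 := tendsto_ofReal_div_zero (tendsto_natCast_real hN) y
  have h1 : Tendsto (fun i => 1 - ((y / N i : ℝ) : ℂ)) l (𝓝 1) := by simpa using h0.const_sub 1
  have key := tendsto_tsum_of_dominated_convergence (𝓕 := l) (bound := fun j : ℕ => ρ ^ (j + 1))
    (f := fun i j => if j < N i then
          (((N i).descFactorial (j + 1) : ℕ) : ℂ) / (N i : ℂ) ^ (j + 1)
            * ((z i)⁻¹ ^ (j + 1) * (1 - ((y / N i : ℝ) : ℂ)) ^ (N i - 1 - j))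
        else 0) (g := fun j => z₀⁻¹ ^ (j + 1) * Complex.exp (-y)) ?_ ?_ ?_
  · refine key.congr' ?_
    filter_upwards [hN.eventually_ge_atTop 1, hz.eventually_ne hz0] with i hi hi2
    rw [factorial_div_mul_expSum hi2 (by omega)]
  · exact ((summable_geometric_of_lt_one hρ0.le hρ1).mul_left ρ).congr fun j => by ring
  · intro j
    have h2 := (tendsto_one_sub_div_pow hN y).div (h1.pow (j + 1)) (by simp)
    have h3 := (tendsto_descFactorial_div_pow hN (j + 1)).mul ((hinv.pow (j + 1)).mul h2)
    rw [one_pow, div_one, one_mul] at h3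
    refine h3.congr' ?_
    filter_upwards [hN.eventually_ge_atTop (j + 1), h1.eventually_ne one_ne_zero] with i hi h4
    rw [if_pos (by omega)]
    simp only [Pi.div_apply]
    have hnn : N i = (N i - 1 - j) + (j + 1) := by omega
    congr 2
    rw [div_eq_iff (pow_ne_zero _ h4), ← pow_add, ← hnn]
  · filter_upwards [hinv.norm.eventually_lt_const hρ,
      (tendsto_natCast_real hN).eventually_gt_atTop y] with i h2 h3 j
    split_ifs with hj
    · have h4 : ‖(((N i).descFactorial (j + 1) : ℕ) : ℂ) / (N i : ℂ) ^ (j + 1)‖ ≤ 1 := by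
        rw [norm_div, norm_pow, Complex.norm_natCast, Complex.norm_natCast]
        refine div_le_one_of_le₀ ?_ (by positivity)
        exact_mod_cast Nat.descFactorial_le_pow (N i) (j + 1)
      have h5 : ‖1 - ((y / N i : ℝ) : ℂ)‖ ≤ 1 := by
        rw [← Complex.ofReal_one, ← Complex.ofReal_sub, Complex.norm_real]
        have : y / N i ≤ 1 := (div_le_one (hy.trans h3)).2 h3.le
        have : 0 ≤ y / N i := by have := hy.trans h3; positivity
        rw [Real.norm_of_nonneg] <;> linarith
      rw [norm_mul, norm_mul, norm_pow, norm_pow]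
      calc _ ≤ 1 * (ρ ^ (j + 1) * 1 ^ (N i - 1 - j)) := by gcongr
        _ = _ := by simp
    · rw [norm_zero]
      positivity

theorem EndpointAsymp.tendsto_endSum (hG : EndpointAsymp G a c) [l.IsCountablyGenerated]
    (hN : Tendsto N l atTop) {z : ι → ℂ} {z₀ : ℂ} (hz : Tendsto z l (𝓝 z₀)) (h₀ : 1 < ‖z₀‖) :
    Tendsto (fun i => (N i : ℂ) ^ (a + 1)
      * (((N i).factorial : ℂ) / (N i * z i) ^ (N i) * endSum G (N i) (N i * z i))) l
      (𝓝 (c * Complex.Gamma (a + 1) * (1 / (z₀ - 1)))) := by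
  have hz0 : z₀ ≠ 0 := norm_pos_iff.1 (one_pos.trans h₀)
  have hinv : Tendsto (fun i => (z i)⁻¹) l (𝓝 z₀⁻¹) := hz.inv₀ hz0
  have hlog := Real.log_pos h₀
  obtain ⟨ε, hε, hε1, hε2⟩ : ∃ ε : ℝ, 0 < ε ∧ ε ≤ 1 ∧ ‖z₀⁻¹‖ < Real.exp (-(2 * ε)) := by
    refine ⟨min 1 (Real.log ‖z₀‖ / 4), lt_min one_pos (by positivity), min_le_left _ _, ?_⟩
    rw [norm_inv, ← Real.exp_log (one_pos.trans h₀), ← Real.exp_neg, Real.exp_lt_exp, Real.exp_log (one_pos.trans h₀)]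
    have := min_le_right 1 (Real.log ‖z₀‖ / 4)
    linarith
  have h := hG.tendsto_integral (tendsto_natCast_real hN)
    (k := fun i y => ((N i).factorial : ℂ) / (N i * z i) ^ (N i)
      * expSum (N i) (N i * z i * (1 - y)))
    (κ := fun y => Complex.exp (-(1 * y)) * (1 / (z₀ - 1))) (B := (1 - Real.exp (-ε))⁻¹) (ε := ε)
    hε (Eventually.of_forall fun i => by have := continuous_expSum (N i); fun_prop) ?_ ?_
  · have e := integral_cpow_mul_exp_neg_mul_Ioi_of_re_pos (z := 1) hG.neg_one_lt (by simp)
    rw [Complex.one_cpow, one_mul] at e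
    simp_rw [← mul_assoc _ _ (1 / (z₀ - 1))] at h
    rw [integral_mul_const, e, ← mul_assoc] at h
    refine h.congr fun i => ?_
    rw [endSum, ← integral_const_mul (((N i).factorial : ℂ) / (N i * z i) ^ (N i)), Complex.ofReal_natCast]
    congr 1
    refine integral_congr_ae (ae_of_all _ fun y => ?_)
    beta_reduce
    ring
  · filter_upwards [hN.eventually_ge_atTop 1, hz.eventually_ne hz0,
      hinv.norm.eventually_lt_const hε2] with i h1 h2 h3 y hy
    exact norm_factorial_div_mul_expSum_le h2 (by omega) hε hε1 h3.le hy
  · intro y hy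
    simpa only [one_mul] using tendsto_factorial_div_mul_expSum hN hz h₀ hy

end

/-! ### Both endpoints: the exact formula for the normalized remainder. -/

/-- `∫_{-1}^1 e^{x t} g(t) dt` with `Gp y = g (1 - y)` and `Gm y = g (y - 1)`. -/
noncomputable def twoInt (Gp Gm : ℝ → ℂ) (x : ℂ) : ℂ := endInt Gp x + endInt Gm (-x)

/-- The sum of the first `n` Maclaurin terms of `twoInt Gp Gm`. -/
noncomputable def twoSum (Gp Gm : ℝ → ℂ) (n : ℕ) (x : ℂ) : ℂ := endSum Gp n x + endSum Gm n (-x)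

/-- The Maclaurin remainder of `twoInt Gp Gm` at `n z`, normalized by `n ^ (q + 1) n! / (n z)^n`. -/
noncomputable def bracket (q : ℂ) (Gp Gm : ℝ → ℂ) (n : ℕ) (z : ℂ) : ℂ :=
  (n : ℂ) ^ (q + 1) * (endTail Gp n z + (-1) ^ n * endTail Gm n (-z))

/-- `n^n e^{-n} √n / n!`. -/
noncomputable def stirlingFactor (n : ℕ) : ℂ :=
  (((n : ℝ) ^ n * Real.exp (-n) * √n / n.factorial : ℝ) : ℂ)

/-- `n ^ (q + 1) e^{-n z} ∫_{-1}^1 e^{n z t} g(t) dt`. -/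
noncomputable def scaledInt (q : ℂ) (Gp Gm : ℝ → ℂ) (n : ℕ) (z : ℂ) : ℂ :=
  (n : ℂ) ^ (q + 1) * (Complex.exp (-(n * z)) * twoInt Gp Gm (n * z))

/-- The function `z ↦ z e^{1 - z}` that defines the Szegő curve. -/
noncomputable def szegoFun (z : ℂ) : ℂ := z * Complex.exp (1 - z)

theorem natCast_cpow_ne_zero {n : ℕ} (hn : n ≠ 0) (a : ℂ) : (n : ℂ) ^ a ≠ 0 := by
  rw [Complex.cpow_ne_zero_iff]
  exact Or.inl (by exact_mod_cast hn)

theorem norm_natCast_cpow {n : ℕ} (hn : n ≠ 0) (a : ℂ) : ‖(n : ℂ) ^ a‖ = (n : ℝ) ^ a.re := by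
  rw [← Complex.ofReal_natCast, Complex.norm_cpow_eq_rpow_re_of_pos]
  exact_mod_cast Nat.pos_of_ne_zero hn

theorem natCast_cpow_split {n : ℕ} (hn : n ≠ 0) (p q : ℂ) :
    (n : ℂ) ^ (q + 1) = (n : ℂ) ^ (q - p) * (n : ℂ) ^ (p + 1) := by
  rw [← Complex.cpow_add _ _ (by exact_mod_cast hn)]
  ring_nf

theorem bracket_eq {n : ℕ} (hn : n ≠ 0) (p q : ℂ) (Gp Gm : ℝ → ℂ) (z : ℂ) :
    bracket q Gp Gm n z = (n : ℂ) ^ (q + 1) * endTail Gp n z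
      + (-1) ^ n * (n : ℂ) ^ (q - p) * ((n : ℂ) ^ (p + 1) * endTail Gm n (-z)) := by
  rw [bracket, natCast_cpow_split hn p q]
  ring

/-- The remainders at the two endpoints share the prefactor (nz)^n/n! up to (-1)^n. After
multiplication by e^{-nz} it splits into (z e^{1-z})^n n^{-1/2} and the Stirling quotient. -/
theorem scaledInt_sub {Gp Gm : ℝ → ℂ} (hGp : IntegrableOn Gp (Ioo 0 1))
    (hGm : IntegrableOn Gm (Ioo 0 1)) {n : ℕ} (hn : n ≠ 0) (q z : ℂ) :
    scaledInt q Gp Gm n z - (n : ℂ) ^ (q + 1) * (Complex.exp (-(n * z)) * twoSum Gp Gm n (n * z))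
      = szegoFun z ^ n / (√n : ℂ) * bracket q Gp Gm n z * stirlingFactor n := by
  have h1 := endInt_sub_endSum hGp hn z
  have h2 := endInt_sub_endSum hGm hn (-z)
  rw [mul_neg] at h2
  have h3 : twoInt Gp Gm (n * z) - twoSum Gp Gm n (n * z) = (n * z) ^ n / (n.factorial : ℂ)
      * (endTail Gp n z + (-1) ^ n * endTail Gm n (-z)) := by
    rw [twoInt, twoSum, add_sub_add_comm, h1, h2, neg_pow]
    ring
  have hs : ((√(n : ℝ) : ℝ) : ℂ) ≠ 0 := by
    exact_mod_cast (Real.sqrt_pos.2 (by exact_mod_cast Nat.pos_of_ne_zero hn)).ne'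
  rw [scaledInt, ← mul_sub, ← mul_sub, h3, bracket, stirlingFactor, szegoFun]
  push_cast
  have h4 : Complex.exp (-(n * z)) = Complex.exp (1 - z) ^ n * Complex.exp (-n) := by
    rw [← Complex.exp_nat_mul, ← Complex.exp_add]
    ring_nf
  rw [h4, mul_pow, mul_pow]
  field_simp

theorem twoSum_div_twoInt {Gp Gm : ℝ → ℂ} (hGp : IntegrableOn Gp (Ioo 0 1))
    (hGm : IntegrableOn Gm (Ioo 0 1)) {n : ℕ} (hn : n ≠ 0) (q z : ℂ)
    (h : scaledInt q Gp Gm n z ≠ 0) :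
    twoSum Gp Gm n (n * z) / twoInt Gp Gm (n * z)
      = 1 - szegoFun z ^ n / (√n : ℂ) * bracket q Gp Gm n z
        * (stirlingFactor n / scaledInt q Gp Gm n z) := by
  have h1 := scaledInt_sub hGp hGm hn q z
  rw [← mul_div_assoc, ← h1, sub_div, div_self h, sub_sub_cancel, scaledInt, ← mul_assoc,
    ← mul_assoc, mul_div_mul_left]
  exact mul_ne_zero (natCast_cpow_ne_zero hn _) (Complex.exp_ne_zero _)

/-! ### Size of f, and the competition between the two endpoints. -/

section

variable {ι : Type*} {l : Filter ι} {N : ι → ℕ} {Gp Gm : ℝ → ℂ} {p q c₁ c₂ : ℂ}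

theorem tendsto_stirlingFactor (hN : Tendsto N l atTop) :
    Tendsto (fun i => stirlingFactor (N i)) l (𝓝 (1 / (√(2 * Real.pi) : ℂ))) := by
  have := ((Complex.continuous_ofReal.tendsto _).comp tendsto_pow_mul_exp_neg_div_factorial).comp hN
  simpa [Function.comp_def, stirlingFactor] using this

theorem norm_endInt_neg_le {G : ℝ → ℂ} (hG : IntegrableOn G (Ioo 0 1)) {x : ℂ} (hx : 0 ≤ x.re) :
    ‖endInt G (-x)‖ ≤ ∫ y in Ioo (0 : ℝ) 1, ‖G y‖ := by
  refine norm_integral_le_of_norm_le hG.norm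
    ((ae_restrict_iff' measurableSet_Ioo).2 (ae_of_all _ fun y hy => ?_))
  rw [norm_mul, Complex.norm_exp]
  refine mul_le_of_le_one_right (norm_nonneg _) (Real.exp_le_one_iff.2 ?_)
  have : (-x * (1 - y)).re = -(x.re * (1 - y)) := by
    have : (1 - y : ℂ) = ((1 - y : ℝ) : ℂ) := by push_cast; ring
    rw [this, Complex.re_mul_ofReal, Complex.neg_re]
    ring
  rw [this]
  have := mul_nonneg hx (sub_nonneg.2 hy.2.le)
  linarith

/-- For Re z > 0 the integral over the left half is bounded, so e^{-nz} kills it against any power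
of n. -/
theorem tendsto_scaledInt [l.IsCountablyGenerated] (hGp : EndpointAsymp Gp q c₂)
    (hGm : IntegrableOn Gm (Ioo 0 1)) (hN : Tendsto N l atTop) {z : ι → ℂ} {z₀ : ℂ}
    (hz : Tendsto z l (𝓝 z₀)) (h₀ : 0 < z₀.re) :
    Tendsto (fun i => scaledInt q Gp Gm (N i) (z i)) l
      (𝓝 (c₂ * Complex.Gamma (q + 1) * z₀ ^ (-(q + 1)))) := by
  have h1 := hGp.tendsto_endInt hN hz h₀
  have h2 : Tendsto (fun i => (N i : ℂ) ^ (q + 1)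
      * (Complex.exp (-(N i * z i)) * endInt Gm (-(N i * z i)))) l (𝓝 0) := by
    refine squeeze_zero_norm' (a := fun i => (∫ y in Ioo (0:ℝ) 1, ‖Gm y‖) *
      ((N i : ℝ) ^ (q + 1).re * Real.exp (-(z₀.re / 2) * N i))) ?_ ?_
    · have h1 : ∀ᶠ i in l, z₀.re / 2 < (z i).re :=
        ((Complex.continuous_re.tendsto _).comp hz).eventually_const_lt (by linarith)
      filter_upwards [h1, hN.eventually_ge_atTop 1] with i h1 hi
      have hre : (N i * z i : ℂ).re = N i * (z i).re := by simp
      have h3 := norm_endInt_neg_le hGm (x := N i * z i) (by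
        rw [hre]
        exact mul_nonneg (Nat.cast_nonneg _) (by linarith))
      rw [norm_mul, norm_mul, norm_natCast_cpow (by omega), Complex.norm_exp, Complex.neg_re, hre]
      have h4 : Real.exp (-(N i * (z i).re)) ≤ Real.exp (-(z₀.re / 2) * N i) := by
        refine Real.exp_le_exp.2 ?_
        have := mul_le_mul_of_nonneg_left h1.le (Nat.cast_nonneg (α := ℝ) (N i))
        linarith
      calc _ ≤ (N i : ℝ) ^ (q + 1).re * (Real.exp (-(z₀.re / 2) * N i)
            * ∫ y in Ioo (0:ℝ) 1, ‖Gm y‖) := by gcongr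
        _ = _ := by ring
    · simpa using (tendsto_rpow_mul_exp_neg_mul_zero (tendsto_natCast_real hN) (q + 1).re
        (half_pos h₀)).const_mul (∫ y in Ioo (0:ℝ) 1, ‖Gm y‖)
  have h3 := h1.add h2
  rw [add_zero] at h3
  refine h3.congr fun i => ?_
  rw [scaledInt, twoInt]
  ring

theorem continuous_szegoFun : Continuous szegoFun := by
  unfold szegoFun
  fun_prop

theorem tendsto_rpow_mul_pow_zero (hN : Tendsto N l atTop) {x : ι → ℂ} {x₀ : ℂ}
    (hx : Tendsto x l (𝓝 x₀)) (h₀ : ‖x₀‖ < 1) (M : ℝ) :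
    Tendsto (fun i => (N i : ℝ) ^ M * ‖x i ^ N i‖) l (𝓝 0) := by
  obtain ⟨ρ, hρ, hρ1⟩ := exists_between h₀
  have hρ0 : 0 < ρ := (norm_nonneg _).trans_lt hρ
  have hlog : 0 < -Real.log ρ := by
    have := Real.log_neg hρ0 hρ1
    linarith
  refine squeeze_zero' (Eventually.of_forall fun _ => by positivity) ?_
    (tendsto_rpow_mul_exp_neg_mul_zero (tendsto_natCast_real hN) M hlog)
  filter_upwards [hx.norm.eventually_lt_const hρ] with i hi
  rw [norm_pow, neg_neg, mul_comm (Real.log ρ), Real.exp_nat_mul, Real.exp_log hρ0]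
  gcongr

theorem tendsto_bracket_right {U V : ι → ℂ} {u v : ℂ} (hN : Tendsto N l atTop)
    (hU : Tendsto U l (𝓝 u)) (hV : Tendsto V l (𝓝 v)) (h : q.re < p.re) :
    Tendsto (fun i => U i + (-1) ^ N i * (N i : ℂ) ^ (q - p) * V i) l (𝓝 u) := by
  have h1 : Tendsto (fun i => (-1 : ℂ) ^ N i * (N i : ℂ) ^ (q - p)) l (𝓝 0) := by
    refine squeeze_zero_norm' (a := fun i => (N i : ℝ) ^ (-(p.re - q.re))) ?_
      ((tendsto_rpow_neg_atTop (by linarith)).comp (tendsto_natCast_real hN))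
    filter_upwards [hN.eventually_ge_atTop 1] with i hi
    rw [norm_mul, norm_pow, norm_neg, norm_one, one_pow, one_mul, norm_natCast_cpow (by omega)]
    simp
  simpa using hU.add (h1.mul hV)

/-- Dividing by the alternating factor exchanges the roles of the endpoints and of p and q. -/
theorem tendsto_bracket_left {U V : ι → ℂ} {u v : ℂ} (hN : Tendsto N l atTop)
    (hU : Tendsto U l (𝓝 u)) (hV : Tendsto V l (𝓝 v)) (h : p.re < q.re) :
    Tendsto (fun i => (-1) ^ N i * (N i : ℂ) ^ (p - q)
      * (U i + (-1) ^ N i * (N i : ℂ) ^ (q - p) * V i)) l (𝓝 v) := by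
  refine (tendsto_bracket_right hN hV hU h).congr' ?_
  filter_upwards [hN.eventually_ge_atTop 1] with i hi
  have h1 : (N i : ℂ) ^ (p - q) * (N i : ℂ) ^ (q - p) = 1 := by
    rw [← Complex.cpow_add _ _ (by exact_mod_cast (by omega : N i ≠ 0))]
    simp
  have h2 : (-1 : ℂ) ^ N i * (-1) ^ N i = 1 := by
    rw [← mul_pow]
    simp
  linear_combination (-V i) * h2 * ((N i : ℂ) ^ (p - q) * (N i : ℂ) ^ (q - p)) - V i * h1

theorem norm_alternating_cpow {n : ℕ} (hn : n ≠ 0) (h : p.re = q.re) :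
    ‖(-1 : ℂ) ^ n * (n : ℂ) ^ (q - p)‖ = 1 := by
  rw [norm_mul, norm_pow, norm_neg, norm_one, one_pow, one_mul, norm_natCast_cpow hn]
  simp [h]

/-- The factor (-1)^n n^{q-p} now has modulus 1 and keeps oscillating, so only the distance to an
oscillating expression is asserted to vanish. -/
theorem tendsto_bracket_balanced {U V : ι → ℂ} {u v : ℂ} (hN : Tendsto N l atTop)
    (hU : Tendsto U l (𝓝 u)) (hV : Tendsto V l (𝓝 v)) (h : p.re = q.re) :
    Tendsto (fun i => U i + (-1) ^ N i * (N i : ℂ) ^ (q - p) * V i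
      - (u + (-1) ^ N i * (N i : ℂ) ^ (q - p) * v)) l (𝓝 0) := by
  have h1 : Tendsto (fun i => (-1 : ℂ) ^ N i * (N i : ℂ) ^ (q - p) * (V i - v)) l (𝓝 0) := by
    refine squeeze_zero_norm' (a := fun i => ‖V i - v‖) ?_ ?_
    · filter_upwards [hN.eventually_ge_atTop 1] with i hi
      rw [norm_mul, norm_alternating_cpow (by omega) h, one_mul]
    · simpa using (hV.sub_const v).norm
  have h2 := (hU.sub_const u).add h1
  rw [sub_self, add_zero] at h2
  refine h2.congr fun i => ?_
  ring

/-- When one endpoint wins, the suitably rescaled bracket tends to its nonzero coefficient. In the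
balanced case its modulus stays above roughly | ‖u‖ - ‖v‖ |. -/
theorem false_of_tendsto_bracket_zero [l.NeBot] {U V : ι → ℂ} {u v : ℂ} (hN : Tendsto N l atTop)
    (hU : Tendsto U l (𝓝 u)) (hV : Tendsto V l (𝓝 v)) (hu : u ≠ 0)
    (h : q.re < p.re ∨ (p.re < q.re ∧ v ≠ 0) ∨ (p.re = q.re ∧ ‖u‖ ≠ ‖v‖))
    (hB : ∀ M : ℝ, Tendsto (fun i => (N i : ℝ) ^ M
      * ‖U i + (-1) ^ N i * (N i : ℂ) ^ (q - p) * V i‖) l (𝓝 0)) : False := by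
  have hB0 : Tendsto (fun i => U i + (-1) ^ N i * (N i : ℂ) ^ (q - p) * V i) l (𝓝 0) := by
    rw [tendsto_zero_iff_norm_tendsto_zero]
    simpa using hB 0
  rcases h with h | ⟨h, hv⟩ | ⟨h, hv⟩
  · exact hu (tendsto_nhds_unique (tendsto_bracket_right hN hU hV h) hB0)
  · refine hv (tendsto_nhds_unique (tendsto_bracket_left hN hU hV h) ?_)
    rw [tendsto_zero_iff_norm_tendsto_zero]
    refine (hB (p - q).re).congr' ?_
    filter_upwards [hN.eventually_ge_atTop 1] with i hi
    rw [norm_mul, norm_mul, norm_pow, norm_neg, norm_one, one_pow, one_mul,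
      norm_natCast_cpow (by omega)]
  · have h1 := (tendsto_bracket_balanced hN hU hV h).sub hB0
    have h2 : Tendsto (fun i => ‖u + (-1) ^ N i * (N i : ℂ) ^ (q - p) * v‖) l (𝓝 0) := by
      have := h1.norm
      simp only [sub_self, norm_zero] at this
      refine this.congr fun i => ?_
      rw [← norm_neg]
      ring_nf
    have h3 : ∀ᶠ i in l, |‖u‖ - ‖v‖| ≤ ‖u + (-1) ^ N i * (N i : ℂ) ^ (q - p) * v‖ := by
      filter_upwards [hN.eventually_ge_atTop 1] with i hi
      have e : ‖v‖ = ‖-((-1) ^ N i * (N i : ℂ) ^ (q - p) * v)‖ := by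
        rw [norm_neg, norm_mul, norm_alternating_cpow (by omega) h, one_mul]
      rw [e, ← sub_neg_eq_add]
      exact abs_norm_sub_norm_le _ _
    have := ge_of_tendsto h2 h3
    exact hv (sub_eq_zero.1 (abs_nonpos_iff.1 this))

/-- Along all integers the moduli may coincide: passing from n to n+1 flips the sign of (-1)^n while
n^{q-p} changes by a factor tending to 1, so the two terms cannot keep cancelling. -/
theorem false_of_tendsto_bracket_zero_atTop {U V : ℕ → ℂ} {u v : ℂ}
    (hU : Tendsto U atTop (𝓝 u)) (hV : Tendsto V atTop (𝓝 v)) (hu : u ≠ 0) (h : p.re = q.re)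
    (hB : Tendsto (fun n : ℕ => U n + (-1) ^ n * (n : ℂ) ^ (q - p) * V n) atTop (𝓝 0)) :
    False := by
  have h1 := (tendsto_bracket_balanced tendsto_id hU hV h).sub hB
  simp only [id, sub_self] at h1
  have hx : Tendsto (fun n : ℕ => (-1) ^ n * (n : ℂ) ^ (q - p) * v) atTop (𝓝 (-u)) := by
    have := (h1.neg).sub_const u
    rw [neg_zero, zero_sub] at this
    refine this.congr fun n => ?_
    ring
  have hr : Tendsto (fun n : ℕ => ((1 + 1 / (n : ℝ) : ℝ) : ℂ) ^ (q - p)) atTop (𝓝 1) := by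
    have h0 : Tendsto (fun n : ℕ => ((1 + 1 / (n : ℝ) : ℝ) : ℂ)) atTop (𝓝 1) := by
      have := (tendsto_ofReal_div_zero (tendsto_natCast_real (tendsto_id (α := ℕ))) 1).const_add 1
      simpa using this
    have := (continuousAt_cpow_const (a := 1) (b := q - p) (by simp)).tendsto.comp h0
    simpa [Function.comp_def] using this
  -- The two summands cancel exactly for every n ≥ 1, yet their sum tends to -2u.
  have h2 := (hx.comp (tendsto_add_atTop_nat 1)).add (hr.mul hx)
  have h3 : Tendsto (fun _ : ℕ => (0 : ℂ)) atTop (𝓝 (-u + 1 * -u)) := by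
    refine h2.congr' ?_
    filter_upwards [eventually_ge_atTop 1] with n hn
    have hn0 : (0 : ℝ) < n := by exact_mod_cast hn
    have e : ((n + 1 : ℕ) : ℂ) ^ (q - p)
        = ((1 + 1 / (n : ℝ) : ℝ) : ℂ) ^ (q - p) * (n : ℂ) ^ (q - p) := by
      rw [← Complex.ofReal_natCast n, ← Complex.mul_cpow_ofReal_nonneg (by positivity) hn0.le,
        ← Complex.ofReal_mul]
      congr 1
      push_cast
      have : (n : ℂ) ≠ 0 := by exact_mod_cast hn0.ne'
      field_simp
    simp only [Function.comp]
    rw [e, pow_succ]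
    ring
  have := tendsto_nhds_unique h3 tendsto_const_nhds
  refine hu ?_
  linear_combination (-1 / 2 : ℂ) * this

end

/-! ### Zeros cannot accumulate off the arc. -/

theorem one_mem_szegoArc : (1 : ℂ) ∈ szegoArc := by simp [szegoArc]

theorem re_lt_one_of_norm_le_one {z : ℂ} (h : ‖z‖ ≤ 1) (h1 : z ≠ 1) : z.re < 1 := by
  refine lt_of_le_of_ne ((Complex.re_le_norm z).trans h) fun hre => h1 ?_
  have h2 : z.re ^ 2 + z.im ^ 2 ≤ 1 := by
    have := Complex.sq_norm z
    rw [Complex.normSq_apply] at this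
    nlinarith [norm_nonneg z]
  have him : z.im = 0 := by
    rw [hre] at h2
    nlinarith
  exact Complex.ext hre him

theorem szegoArc_re_lt_one {ξ : ℂ} (hξ : ξ ∈ szegoArc) (h1 : ξ ≠ 1) : ξ.re < 1 :=
  re_lt_one_of_norm_le_one hξ.2.1 h1

theorem ne_zero_of_re_pos {z : ℂ} (h : 0 < z.re) : z ≠ 0 := fun h0 => by simp [h0] at h

theorem gamma_add_one_ne_zero {a : ℂ} (h : -1 < a.re) : Complex.Gamma (a + 1) ≠ 0 :=
  Complex.Gamma_ne_zero_of_re_pos (by simpa using by linarith)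

section

variable {ι : Type*} {l : Filter ι} {N : ι → ℕ} {Gp Gm : ℝ → ℂ} {p q c₁ c₂ : ℂ}

theorem tendsto_bracket_terms [l.IsCountablyGenerated] (hGp : EndpointAsymp Gp q c₂)
    (hGm : EndpointAsymp Gm p c₁) (hN : Tendsto N l atTop) {z : ι → ℂ} {z₀ : ℂ}
    (hz : Tendsto z l (𝓝 z₀)) (h₀ : -1 < z₀.re) (h₁ : z₀.re < 1) :
    Tendsto (fun i => (N i : ℂ) ^ (q + 1) * endTail Gp (N i) (z i)) l
      (𝓝 (c₂ * Complex.Gamma (q + 1) * (1 / (1 - z₀)))) ∧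
    Tendsto (fun i => (N i : ℂ) ^ (p + 1) * endTail Gm (N i) (-z i)) l
      (𝓝 (c₁ * Complex.Gamma (p + 1) * (1 / (1 + z₀)))) := by
  refine ⟨hGp.tendsto_endTail hN hz h₁, ?_⟩
  have := hGm.tendsto_endTail hN hz.neg (by rw [Complex.neg_re]; linarith)
  rwa [sub_neg_eq_add] at this

/-- Reduces zeros converging to a point off the arc to one statement about brackets, valid inside
and outside the unit disc. Only the moduli of u and v are recorded, since the two regions differ by
signs. -/
theorem exists_bracket_of_zeros [l.IsCountablyGenerated] [l.NeBot] (hGp : EndpointAsymp Gp q c₂)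
    (hGm : EndpointAsymp Gm p c₁) (hc₂ : c₂ ≠ 0) (hN : Tendsto N l atTop) {z : ι → ℂ} {z₀ : ℂ}
    (hz : Tendsto z l (𝓝 z₀)) (h₀ : 0 < z₀.re) (hS : z₀ ∉ szegoArc)
    (hzero : ∀ᶠ i in l, twoSum Gp Gm (N i) (N i * z i) = 0) :
    ∃ (U V : ι → ℂ) (u v : ℂ), Tendsto U l (𝓝 u) ∧ Tendsto V l (𝓝 v) ∧
      ‖u‖ = ‖c₂ * Complex.Gamma (q + 1)‖ / ‖1 - z₀‖ ∧
      ‖v‖ = ‖c₁ * Complex.Gamma (p + 1)‖ / ‖1 + z₀‖ ∧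
      ∀ M : ℝ, Tendsto (fun i => (N i : ℝ) ^ M
        * ‖U i + (-1) ^ N i * (N i : ℂ) ^ (q - p) * V i‖) l (𝓝 0) := by
  have hz0 := ne_zero_of_re_pos h₀
  have hcR : c₂ * Complex.Gamma (q + 1) ≠ 0 := mul_ne_zero hc₂ (gamma_add_one_ne_zero hGp.neg_one_lt)
  have hN1 := hN.eventually_ge_atTop 1
  -- Outside the disc U and V come from the partial sums at the two endpoints, and a zero makes the
  -- combination vanish exactly.
  by_cases hlarge : 1 < ‖z₀‖
  · refine ⟨_, _, _, _, hGp.tendsto_endSum hN hz hlarge,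
      hGm.tendsto_endSum hN hz.neg (by rwa [norm_neg]), ?_, ?_, fun M => ?_⟩
    · rw [norm_mul, norm_div, norm_one, norm_sub_rev, ← div_eq_mul_one_div]
    · rw [norm_mul, norm_div, norm_one, ← neg_add', norm_neg, add_comm z₀, ← div_eq_mul_one_div]
    · refine tendsto_const_nhds.congr' ?_
      filter_upwards [hN1, hzero, hz.eventually_ne hz0] with i hi h h1
      have h2 : (-1 : ℂ) ^ N i * ((-1) ^ N i)⁻¹ = 1 := mul_inv_cancel₀ (by simp)
      rw [twoSum] at h
      rw [mul_neg, neg_pow (N i * z i), natCast_cpow_split (by omega) p q]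
      have : (N i : ℂ) ^ (q - p) * (N i : ℂ) ^ (p + 1)
            * ((N i).factorial / (N i * z i) ^ N i * endSum Gp (N i) (N i * z i))
          + (-1) ^ N i * (N i : ℂ) ^ (q - p) * ((N i : ℂ) ^ (p + 1)
            * ((N i).factorial / ((-1) ^ N i * (N i * z i) ^ N i) * endSum Gm (N i) (-(N i * z i))))
          = 0 := by
        rw [← div_div, div_right_comm, div_eq_mul_inv _ ((-1 : ℂ) ^ N i)]
        rw [div_eq_mul_inv]
        linear_combination (N i : ℂ) ^ (q - p) * (N i : ℂ) ^ (p + 1)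
          * ((N i).factorial * ((N i * z i) ^ N i)⁻¹) * h
          + (N i : ℂ) ^ (q - p) * (N i : ℂ) ^ (p + 1)
          * ((N i).factorial * ((N i * z i) ^ N i)⁻¹) * endSum Gm (N i) (-(N i * z i)) * h2
      rw [this, norm_zero, mul_zero]
  · rw [not_lt] at hlarge
    have hne1 : z₀ ≠ 1 := fun h => hS (h ▸ one_mem_szegoArc)
    have hre1 := re_lt_one_of_norm_le_one hlarge hne1
    obtain ⟨hU, hV⟩ := tendsto_bracket_terms hGp hGm hN hz (by linarith) hre1
    have ha := tendsto_scaledInt hGp hGm.integrableOn hN hz h₀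
    have hs := tendsto_stirlingFactor hN
    have hφ := (continuous_szegoFun.tendsto z₀).comp hz
    have hφ1 : ‖szegoFun z₀‖ ≠ 1 := fun h => hS ⟨h, hlarge, h₀⟩
    have hs0 : (1 / (√(2 * Real.pi) : ℂ)) ≠ 0 := by
      have : (√(2 * Real.pi)) ≠ 0 := (Real.sqrt_pos.2 (by positivity)).ne'
      exact one_div_ne_zero (by exact_mod_cast this)
    -- at a zero the scaled remainder equals the scaled integral
    have key : ∀ᶠ i in l, scaledInt q Gp Gm (N i) (z i)
        = szegoFun (z i) ^ N i / (√(N i) : ℂ) * bracket q Gp Gm (N i) (z i)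
          * stirlingFactor (N i) := by
      filter_upwards [hN1, hzero] with i hi h
      have := scaledInt_sub hGp.integrableOn hGm.integrableOn (by omega : N i ≠ 0) q (z i)
      rwa [h, mul_zero, mul_zero, sub_zero] at this
    refine ⟨_, _, _, _, hU, hV, ?_, ?_, ?_⟩
    · rw [norm_mul, norm_div, norm_one, ← div_eq_mul_one_div]
    · rw [norm_mul, norm_div, norm_one, ← div_eq_mul_one_div]
    have hbr : ∀ᶠ i in l, (N i : ℂ) ^ (q + 1) * endTail Gp (N i) (z i)
        + (-1) ^ N i * (N i : ℂ) ^ (q - p) * ((N i : ℂ) ^ (p + 1) * endTail Gm (N i) (-z i))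
        = bracket q Gp Gm (N i) (z i) := by
      filter_upwards [hN1] with i hi
      rw [bracket_eq (by omega) p q]
    -- If |z₀e^{1-z₀}| < 1, the remainder is negligible against f, whose scaled limit is nonzero, so
    -- there are no zeros. If it exceeds 1, a zero forces the bracket to decay exponentially.
    rcases lt_or_gt_of_ne hφ1 with hlt | hgt
    · exfalso
      have hb : Tendsto (fun i => (szegoFun (z i) ^ N i / (√(N i) : ℂ)
          * bracket q Gp Gm (N i) (z i))) l (𝓝 0) := by
        have e1 := tendsto_rpow_mul_pow_zero hN hφ hlt 0
        have e2 := tendsto_rpow_mul_pow_zero hN hφ hlt (q - p).re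
        have e3 := (e1.mul hU.norm).add (e2.mul hV.norm)
        simp only [zero_mul, add_zero] at e3
        refine squeeze_zero_norm' ?_ e3
        filter_upwards [hN1, hbr] with i hi h
        rw [← h, norm_mul, norm_div]
        have hs1 : 1 ≤ ‖(√(N i : ℝ) : ℂ)‖ := by
          rw [Complex.norm_real, Real.norm_of_nonneg (Real.sqrt_nonneg _)]
          exact Real.one_le_sqrt.2 (by exact_mod_cast hi)
        have h5 : ‖szegoFun (z i) ^ N i‖ / ‖(√(N i : ℝ) : ℂ)‖ ≤ ‖szegoFun (z i) ^ N i‖ :=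
          div_le_self (norm_nonneg _) hs1
        calc _ ≤ ‖szegoFun (z i) ^ N i‖ * (‖(N i : ℂ) ^ (q + 1) * endTail Gp (N i) (z i)‖
              + ‖(-1) ^ N i * (N i : ℂ) ^ (q - p)
                * ((N i : ℂ) ^ (p + 1) * endTail Gm (N i) (-z i))‖) :=
              mul_le_mul h5 (norm_add_le _ _) (norm_nonneg _) (norm_nonneg _)
          _ = _ := by
              have : ‖(-1 : ℂ) ^ N i‖ = 1 := by simp
              rw [norm_mul ((-1 : ℂ) ^ N i * _) _, norm_mul ((-1 : ℂ) ^ N i) _, this,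
                norm_natCast_cpow (by omega : N i ≠ 0) (q - p), Real.rpow_zero]
              simp only [Function.comp]
              ring
      have h0 := (ha.congr' key).sub (hb.mul hs)
      simp only [sub_self, zero_mul, sub_zero] at h0
      have := tendsto_nhds_unique h0 tendsto_const_nhds
      refine mul_ne_zero hcR ?_ this
      rw [Complex.cpow_ne_zero_iff]
      exact Or.inl hz0
    · intro M
      have hφ0 : szegoFun z₀ ≠ 0 := norm_pos_iff.1 (one_pos.trans hgt)
      have e1 := tendsto_rpow_mul_pow_zero hN (hφ.inv₀ hφ0)
        (by rw [norm_inv]; exact inv_lt_one_of_one_lt₀ hgt) (M + 1 / 2)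
      have e2 := e1.mul (ha.norm.mul (hs.norm.inv₀ (norm_ne_zero_iff.2 hs0)))
      rw [zero_mul] at e2
      refine e2.congr' ?_
      filter_upwards [hN1, hbr, key, hφ.eventually_ne hφ0, hs.eventually_ne hs0] with i hi h h2 h3 h4
      simp only [Function.comp] at h3 ⊢
      have hpos : (0 : ℝ) < N i := by exact_mod_cast hi
      have hs1 : ‖(√(N i : ℝ) : ℂ)‖ = (N i : ℝ) ^ (1 / 2 : ℝ) := by
        rw [Complex.norm_real, Real.norm_of_nonneg (Real.sqrt_nonneg _), Real.sqrt_eq_rpow]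
      rw [h, h2, norm_mul, norm_mul, norm_div, hs1, Real.rpow_add hpos, inv_pow, norm_inv]
      have h5 : ‖szegoFun (z i) ^ N i‖ ≠ 0 := norm_ne_zero_iff.2 (pow_ne_zero _ h3)
      have h6 := norm_ne_zero_iff.2 h4
      have h7 : (N i : ℝ) ^ (1 / 2 : ℝ) ≠ 0 := (Real.rpow_pos_of_pos hpos _).ne'
      field_simp

theorem false_of_zeros [l.IsCountablyGenerated] [l.NeBot] (hGp : EndpointAsymp Gp q c₂)
    (hGm : EndpointAsymp Gm p c₁) (hc₂ : c₂ ≠ 0) (hN : Tendsto N l atTop) {z : ι → ℂ} {z₀ : ℂ}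
    (hz : Tendsto z l (𝓝 z₀)) (h₀ : 0 < z₀.re) (hS : z₀ ∉ szegoArc)
    (h : q.re < p.re ∨ (p.re < q.re ∧ c₁ ≠ 0) ∨ (p.re = q.re ∧
      ‖c₂ * Complex.Gamma (q + 1)‖ * ‖1 + z₀‖ ≠ ‖c₁ * Complex.Gamma (p + 1)‖ * ‖1 - z₀‖))
    (hzero : ∀ᶠ i in l, twoSum Gp Gm (N i) (N i * z i) = 0) : False := by
  obtain ⟨U, V, u, v, hU, hV, hu, hv, hB⟩ := exists_bracket_of_zeros hGp hGm hc₂ hN hz h₀ hS hzero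
  have hne1 : 1 - z₀ ≠ 0 := fun h => hS ((sub_eq_zero.1 h) ▸ one_mem_szegoArc)
  have hne2 : 1 + z₀ ≠ 0 := ne_zero_of_re_pos (by rw [Complex.add_re, Complex.one_re]; linarith)
  have h1 := norm_pos_iff.2 hne1
  have h2 := norm_pos_iff.2 hne2
  refine false_of_tendsto_bracket_zero (p := p) (q := q) hN hU hV ?_ ?_ hB
  · rw [← norm_pos_iff, hu]
    exact div_pos (norm_pos_iff.2 (mul_ne_zero hc₂ (gamma_add_one_ne_zero hGp.neg_one_lt))) h1
  · refine h.imp_right (Or.imp (And.imp_right fun hc => ?_) (And.imp_right fun hc => ?_))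
    · rw [← norm_pos_iff, hv]
      exact div_pos (norm_pos_iff.2 (mul_ne_zero hc (gamma_add_one_ne_zero hGm.neg_one_lt))) h2
    · rwa [hu, hv, Ne, div_eq_div_iff h1.ne' h2.ne']

theorem false_of_zeros_atTop (hGp : EndpointAsymp Gp q c₂)
    (hGm : EndpointAsymp Gm p c₁) (hc₂ : c₂ ≠ 0) (hc₁ : q.re < p.re ∨ c₁ ≠ 0) {z : ℕ → ℂ} {z₀ : ℂ}
    (hz : Tendsto z atTop (𝓝 z₀)) (h₀ : 0 < z₀.re) (hS : z₀ ∉ szegoArc)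
    (hzero : ∀ᶠ n in atTop, twoSum Gp Gm n (n * z n) = 0) : False := by
  rcases lt_trichotomy p.re q.re with h | h | h
  · exact false_of_zeros hGp hGm hc₂ tendsto_id hz h₀ hS
      (Or.inr (Or.inl ⟨h, hc₁.resolve_left (not_lt.2 h.le)⟩)) hzero
  · obtain ⟨U, V, u, v, hU, hV, hu, hv, hB⟩ :=
      exists_bracket_of_zeros hGp hGm hc₂ tendsto_id hz h₀ hS hzero
    have hne1 : 1 - z₀ ≠ 0 := fun h => hS ((sub_eq_zero.1 h) ▸ one_mem_szegoArc)
    refine false_of_tendsto_bracket_zero_atTop hU hV ?_ h ?_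
    · rw [← norm_pos_iff, hu]
      exact div_pos (norm_pos_iff.2 (mul_ne_zero hc₂ (gamma_add_one_ne_zero hGp.neg_one_lt)))
        (norm_pos_iff.2 hne1)
    · rw [tendsto_zero_iff_norm_tendsto_zero]
      simpa using hB 0
  · exact false_of_zeros hGp hGm hc₂ tendsto_id hz h₀ hS (Or.inl h) hzero

end

/-! ### Powers of z e^{1-z} near the arc and near 1. -/

theorem szegoFun_eq_exp_arcTau {ξ : ℂ} (h0 : ξ ≠ 0) (h : ‖szegoFun ξ‖ = 1) :
    szegoFun ξ = Complex.exp (-(Complex.I * arcTau ξ)) := by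
  have h1 : szegoFun ξ = Complex.exp (-(ξ - 1 - Complex.log ξ)) := by
    rw [szegoFun, neg_sub, sub_sub_eq_add_sub, add_sub_assoc, Complex.exp_add, Complex.exp_log h0]
  rw [h1, Complex.norm_exp, Real.exp_eq_one_iff, Complex.neg_re, neg_eq_zero] at h
  rw [h1]
  congr 2
  rw [arcTau]
  apply Complex.ext <;> simp [h]

theorem exp_I_mul_redTwoPi (x : ℝ) :
    Complex.exp (Complex.I * redTwoPi x) = Complex.exp (Complex.I * x) := by
  rw [Complex.exp_eq_exp_iff_exists_int]
  refine ⟨-toIocDiv Real.two_pi_pos (-Real.pi) x, ?_⟩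
  rw [redTwoPi, ← self_sub_toIocDiv_zsmul]
  push_cast
  rw [zsmul_eq_mul]
  ring

theorem abs_redTwoPi_le (x : ℝ) : |redTwoPi x| ≤ Real.pi := by
  have := toIocMod_mem_Ioc Real.two_pi_pos (-Real.pi) x
  rw [abs_le]
  exact ⟨this.1.le, this.2.trans_eq (by ring)⟩

section

variable {ι : Type*} {l : Filter ι} {N : ι → ℕ}

theorem tendsto_natCast_mul_log_one_add_sub (hN : Tendsto N l atTop) {d : ι → ℂ}
    (hd : Tendsto (fun i => d i / √(N i)) l (𝓝 0)) :
    Tendsto (fun i => (N i : ℂ) * (Complex.log (1 + d i / N i) - d i / N i)) l (𝓝 0) ∧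
      Tendsto (fun i => d i / N i) l (𝓝 0) := by
  have hs := tendsto_ofReal_div_zero (tendsto_sqrt_natCast hN) 1
  have h1 := hd.mul hs
  rw [mul_zero] at h1
  have h2 : Tendsto (fun i => d i / N i) l (𝓝 0) := by
    refine h1.congr fun i => ?_
    have hsq : (N i : ℂ) = (√(N i : ℝ) : ℂ) * (√(N i : ℝ) : ℂ) := by
      rw [← Complex.ofReal_mul, Real.mul_self_sqrt (Nat.cast_nonneg _), Complex.ofReal_natCast]
    rw [hsq]
    push_cast
    rw [div_mul_div_comm, mul_one]
  refine ⟨?_, h2⟩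
  have h3 := (hd.norm.pow 2)
  rw [norm_zero, zero_pow two_ne_zero] at h3
  refine squeeze_zero_norm' ?_ h3
  have h4 := h2.norm
  rw [norm_zero] at h4
  filter_upwards [h4.eventually_lt_const (by norm_num : (0:ℝ) < 1 / 2), hN.eventually_ge_atTop 1]
    with i hi h1
  have h5 := Complex.norm_log_one_add_sub_self_le (hi.trans (by norm_num))
  have hpos : (0 : ℝ) < N i := by exact_mod_cast h1
  have h6 : (1 - ‖d i / N i‖)⁻¹ ≤ 2 := by
    rw [inv_le_comm₀ (by linarith) two_pos]
    linarith
  rw [norm_mul, Complex.norm_natCast]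
  calc _ ≤ (N i : ℝ) * (‖d i / N i‖ ^ 2 * 2 / 2) := by
        gcongr
        exact h5.trans (by gcongr)
    _ = _ := by
        rw [norm_div, norm_div, Complex.norm_natCast, Complex.norm_real,
          Real.norm_of_nonneg (Real.sqrt_nonneg _), div_pow ‖d i‖ √(N i), Real.sq_sqrt hpos.le]
        field_simp

/-- With δ = d/((1-ξ)n), the exponent is n(-iτ + log(1+δ) - ξδ), and replacing log(1+δ) by δ gives d
- iτn. The error is O(|d|²/n), which explains the condition d = o(√n). -/
theorem tendsto_szegoFun_pow_arc (hN : Tendsto N l atTop) {ξ : ℂ} (h0 : ξ ≠ 0) (h1 : ξ ≠ 1)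
    (h : ‖szegoFun ξ‖ = 1) {d : ι → ℂ} (hd : Tendsto (fun i => d i / √(N i)) l (𝓝 0)) :
    Tendsto (fun i => szegoFun (ξ * (1 + d i / ((1 - ξ) * N i))) ^ N i
      * Complex.exp (Complex.I * arcTau ξ * N i - d i)) l (𝓝 1) := by
  have h1' : 1 - ξ ≠ 0 := sub_ne_zero.2 h1.symm
  have hd' : Tendsto (fun i => (d i / (1 - ξ)) / √(N i)) l (𝓝 0) := by
    have := hd.div_const (1 - ξ)
    rw [zero_div] at this
    refine this.congr fun i => ?_
    rw [div_right_comm]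
  obtain ⟨e1, e2⟩ := tendsto_natCast_mul_log_one_add_sub hN hd'
  have e3 := (Complex.continuous_exp.tendsto _).comp e1
  rw [Complex.exp_zero] at e3
  refine e3.congr' ?_
  have e4 : Tendsto (fun i => 1 + d i / (1 - ξ) / N i) l (𝓝 1) := by simpa using e2.const_add 1
  filter_upwards [e4.eventually_ne one_ne_zero, hN.eventually_ge_atTop 1] with i hi hN1
  have hN0 : (N i : ℂ) ≠ 0 := by exact_mod_cast (by omega : N i ≠ 0)
  simp only [Function.comp]
  rw [← div_div (d i)]
  have e5 : szegoFun (ξ * (1 + d i / (1 - ξ) / N i))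
      = Complex.exp (-(Complex.I * arcTau ξ)) * Complex.exp (Complex.log (1 + d i / (1 - ξ) / N i))
        * Complex.exp (-(ξ * (d i / (1 - ξ) / N i))) := by
    rw [← szegoFun_eq_exp_arcTau h0 h, Complex.exp_log hi, szegoFun, szegoFun]
    have : Complex.exp (1 - ξ * (1 + d i / (1 - ξ) / N i))
        = Complex.exp (1 - ξ) * Complex.exp (-(ξ * (d i / (1 - ξ) / N i))) := by
      rw [← Complex.exp_add]
      ring_nf
    rw [this]
    ring
  rw [e5, ← Complex.exp_add, ← Complex.exp_add, ← Complex.exp_nat_mul, ← Complex.exp_add]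
  congr 1
  generalize Complex.log _ = L
  field_simp
  ring

/-- At ξ = 1 the linear term of log(1+δ) - δ disappears; with δ = w/√n, the quadratic one gives
e^{-w²/2} and the cubic error is O(n^{-1/2}). -/
theorem tendsto_szegoFun_pow_corner (hN : Tendsto N l atTop) {w : ι → ℂ} {w₀ : ℂ}
    (hw : Tendsto w l (𝓝 w₀)) :
    Tendsto (fun i => szegoFun (1 + w i / √(N i)) ^ N i) l (𝓝 (Complex.exp (-(w₀ ^ 2 / 2)))) := by
  have hM := tendsto_sqrt_natCast hN
  have hs := tendsto_ofReal_div_zero hM 1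
  have h2 : Tendsto (fun i => w i / √(N i)) l (𝓝 0) := by
    have := hw.mul hs
    rw [mul_zero] at this
    refine this.congr fun i => ?_
    push_cast
    ring
  have h3 : Tendsto (fun i => (N i : ℂ) * (Complex.log (1 + w i / √(N i)) - w i / √(N i)
      + (w i / √(N i)) ^ 2 / 2)) l (𝓝 0) := by
    have hb := (hw.norm.pow 3).mul hs.norm
    simp only [norm_zero, mul_zero] at hb
    refine squeeze_zero_norm' ?_ hb
    have h4 := h2.norm
    rw [norm_zero] at h4
    filter_upwards [h4.eventually_lt_const (by norm_num : (0:ℝ) < 1 / 2),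
      hM.eventually_gt_atTop 0] with i hi hpos
    have h5 := Complex.norm_log_sub_logTaylor_le 2 (hi.trans (by norm_num))
    have h6 : Complex.logTaylor (2 + 1) (w i / √(N i))
        = w i / √(N i) - (w i / √(N i)) ^ 2 / 2 := by
      simp [Complex.logTaylor, Finset.sum_range_succ]
      ring
    rw [h6, ← sub_add] at h5
    have h7 : (1 - ‖w i / √(N i)‖)⁻¹ ≤ 2 := by
      rw [inv_le_comm₀ (by linarith) two_pos]
      linarith
    have hsq : (N i : ℝ) = √(N i : ℝ) * √(N i : ℝ) :=
      (Real.mul_self_sqrt (Nat.cast_nonneg _)).symm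
    rw [norm_mul, Complex.norm_natCast]
    calc _ ≤ (N i : ℝ) * (‖w i / √(N i)‖ ^ 3 * 2 / 2) := by
          gcongr
          refine h5.trans ?_
          have e : ((2 : ℕ) : ℝ) + 1 = 3 := by norm_num
          rw [e]
          have hx : 0 ≤ ‖w i / (√(N i : ℝ) : ℂ)‖ ^ (2 + 1) := by positivity
          generalize ‖w i / (√(N i : ℝ) : ℂ)‖ = x at *
          rw [show x ^ 3 = x ^ (2 + 1) from rfl]
          generalize x ^ (2 + 1) = X at *
          generalize (1 - x)⁻¹ = I at *
          nlinarith
      _ = _ := by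
          rw [norm_div, Complex.norm_real, Complex.norm_real, Real.norm_of_nonneg hpos.le,
            norm_div, norm_one, Real.norm_of_nonneg hpos.le, div_pow]
          rw [hsq]
          field_simp
          simp
          field_simp
  have h4 := (h3.sub ((hw.pow 2).div_const 2))
  rw [zero_sub] at h4
  refine ((Complex.continuous_exp.tendsto _).comp h4).congr' ?_
  have e4 : Tendsto (fun i => 1 + w i / √(N i)) l (𝓝 1) := by simpa using h2.const_add 1
  filter_upwards [e4.eventually_ne one_ne_zero, hM.eventually_gt_atTop 0] with i hi hpos
  have hs0 : (√(N i : ℝ) : ℂ) ≠ 0 := by exact_mod_cast hpos.ne'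
  have hsq : (N i : ℂ) = (√(N i : ℝ) : ℂ) * (√(N i : ℝ) : ℂ) := by
    rw [← Complex.ofReal_mul, Real.mul_self_sqrt (Nat.cast_nonneg _), Complex.ofReal_natCast]
  have e5 : szegoFun (1 + w i / √(N i))
      = Complex.exp (Complex.log (1 + w i / √(N i)) - w i / √(N i)) := by
    rw [Complex.exp_sub, Complex.exp_log hi, szegoFun, sub_add_cancel_left, Complex.exp_neg,
      div_eq_mul_inv (1 + w i / (√(N i : ℝ) : ℂ))]
  simp only [Function.comp]
  rw [e5, ← Complex.exp_nat_mul]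
  congr 1
  generalize Complex.log _ = L
  generalize hs : (√(N i : ℝ) : ℂ) = s at *
  rw [hsq]
  field_simp
  ring

end

/-! ### Half-line Gaussian integrals and erfc. -/

theorem integrable_cexp_linear_sub_sq (w : ℂ) :
    Integrable (fun u : ℝ => Complex.exp (w * u - u ^ 2 / 2)) := by
  have := integrable_cexp_quadratic' (b := -1 / 2) (by norm_num) w 0
  refine this.congr (ae_of_all _ fun u => ?_)
  beta_reduce
  congr 1
  ring

theorem halfGauss_add_neg (w : ℂ) :
    halfGauss w + halfGauss (-w) = √(2 * Real.pi) * Complex.exp (w ^ 2 / 2) := by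
  have h1 : ∫ u : ℝ, Complex.exp (w * u - u ^ 2 / 2)
      = √(2 * Real.pi) * Complex.exp (w ^ 2 / 2) := by
    have := integral_cexp_quadratic (b := -1 / 2) (by norm_num) w 0
    have e : (fun u : ℝ => Complex.exp (w * u - u ^ 2 / 2))
        = fun u : ℝ => Complex.exp (-1 / 2 * u ^ 2 + w * u + 0) := by
      ext u
      congr 1
      ring
    rw [e, this]
    congr 1
    · rw [Real.sqrt_eq_rpow, Complex.ofReal_cpow (by positivity)]
      push_cast
      congr 1
      ring
    · congr 1
      ring
  have h2 : halfGauss (-w) = ∫ u in Iic (0 : ℝ), Complex.exp (w * u - u ^ 2 / 2) := by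
    have := integral_comp_neg_Iic (0 : ℝ) (fun u : ℝ => Complex.exp (-w * u - u ^ 2 / 2))
    rw [neg_zero] at this
    rw [halfGauss, ← this]
    congr 1
    ext u
    push_cast
    ring_nf
  rw [h2, halfGauss, ← h1, add_comm]
  have hi := integrable_cexp_linear_sub_sq w
  exact intervalIntegral.integral_Iic_add_Ioi hi.integrableOn hi.integrableOn

theorem half_cerfc (w : ℂ) :
    1 / 2 * cerfc (w / (√2 : ℝ)) = Complex.exp (-(w ^ 2 / 2)) / √(2 * Real.pi) * halfGauss (-w) := by
  have h2 : (0 : ℝ) < √2 := by positivity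
  have h2c : ((√2 : ℝ) : ℂ) ≠ 0 := by exact_mod_cast h2.ne'
  have hsq : ((√2 : ℝ) : ℂ) ^ 2 = 2 := by
    rw [← Complex.ofReal_pow, Real.sq_sqrt (by norm_num)]
    norm_num
  have h1 := integral_comp_mul_left_Ioi
    (fun u : ℝ => Complex.exp (-w * u - u ^ 2 / 2)) 0 h2
  rw [mul_zero] at h1
  have h3 : ∫ s in Ioi (0 : ℝ), Complex.exp (-(w / (√2 : ℝ) + s) ^ 2)
      = Complex.exp (-(w ^ 2 / 2)) * ((√2 : ℝ)⁻¹ • halfGauss (-w)) := by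
    rw [halfGauss, ← h1, ← integral_const_mul]
    congr 1
    ext s
    rw [← Complex.exp_add]
    congr 1
    push_cast
    field_simp
    linear_combination (w + (√2 : ℝ) * s) ^ 2 * hsq
  have hpi : ((√Real.pi : ℝ) : ℂ) ≠ 0 := by
    exact_mod_cast (Real.sqrt_pos.2 Real.pi_pos).ne'
  rw [cerfc, h3, Complex.real_smul, Real.sqrt_mul (by norm_num)]
  push_cast
  field_simp

/-- The two half-line integrals at w and -w make up a full Gaussian, so subtracting the first from 1
leaves the second, which is erfc after completing the square. -/
theorem one_sub_half_gauss (w : ℂ) :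
    1 - Complex.exp (-(w ^ 2 / 2)) / √(2 * Real.pi) * halfGauss w = 1 / 2 * cerfc (w / (√2 : ℝ)) := by
  have h1 := halfGauss_add_neg w
  rw [half_cerfc]
  have hpi : ((√(2 * Real.pi) : ℝ) : ℂ) ≠ 0 := by
    exact_mod_cast (Real.sqrt_pos.2 (by positivity)).ne'
  have h2 : Complex.exp (-(w ^ 2 / 2)) * Complex.exp (w ^ 2 / 2) = 1 := by
    rw [← Complex.exp_add]
    simp
  rw [sub_eq_iff_eq_add, ← mul_add, add_comm (halfGauss (-w)), h1]
  field_simp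
  rw [h2]

/-! ### Scaling limits at the arc and at the corner. -/

/-- The correction `1 - p_{n-1} / f` in terms of the scaled quantities. -/
noncomputable def arcTerm (q : ℂ) (Gp Gm : ℝ → ℂ) (n : ℕ) (z : ℂ) : ℂ :=
  szegoFun z ^ n / (√n : ℂ) * bracket q Gp Gm n z * (stirlingFactor n / scaledInt q Gp Gm n z)

section

variable {ι : Type*} {l : Filter ι} {N : ι → ℕ} {Gp Gm : ℝ → ℂ} {p q c₁ c₂ : ℂ}

theorem tendsto_zero_of_bounded_div_sqrt (hN : Tendsto N l atTop) {x : ι → ℂ} {R : ℝ}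
    (hx : ∀ᶠ i in l, ‖x i‖ ≤ R) : Tendsto (fun i => x i / √(N i)) l (𝓝 0) := by
  have h := (tendsto_inv_atTop_zero.comp (tendsto_sqrt_natCast hN)).const_mul R
  rw [mul_zero] at h
  refine squeeze_zero_norm' ?_ h
  filter_upwards [hx] with i hi
  rw [norm_div, Complex.norm_real, Real.norm_of_nonneg (Real.sqrt_nonneg _), div_eq_mul_inv]
  exact mul_le_mul_of_nonneg_right hi (by positivity)

theorem tendsto_log_div_sqrt (hN : Tendsto N l atTop) :
    Tendsto (fun i => (Real.log (N i) : ℂ) / √(N i)) l (𝓝 0) := by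
  have h := ((isLittleO_log_rpow_atTop (r := 1 / 2) (by norm_num)).tendsto_div_nhds_zero).comp
    (tendsto_natCast_real hN)
  have h2 := (Complex.continuous_ofReal.tendsto 0).comp h
  rw [Complex.ofReal_zero] at h2
  refine h2.congr fun i => ?_
  simp only [Function.comp]
  rw [← Real.sqrt_eq_rpow]
  push_cast
  rfl

theorem tendsto_arc_point (hN : Tendsto N l atTop) (ξ : ℂ) {d : ι → ℂ}
    (hd : Tendsto (fun i => d i / √(N i)) l (𝓝 0)) :
    Tendsto (fun i => ξ * (1 + d i / ((1 - ξ) * N i))) l (𝓝 ξ) := by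
  have h := ((tendsto_natCast_mul_log_one_add_sub hN hd).2.mul_const (1 - ξ)⁻¹).const_add 1
  have h2 := h.const_mul ξ
  rw [zero_mul, add_zero, mul_one] at h2
  refine h2.congr fun i => ?_
  rw [mul_comm (1 - ξ), ← div_div, div_eq_mul_inv _ (1 - ξ)]

theorem natCast_cpow_eq_exp {n : ℕ} (hn : n ≠ 0) (a : ℂ) :
    (n : ℂ) ^ a = Complex.exp (a * (Real.log n : ℂ)) := by
  rw [Complex.cpow_def_of_ne_zero (by exact_mod_cast hn), Complex.natCast_log, mul_comm]

theorem sqrt_natCast_eq_exp {n : ℕ} (hn : n ≠ 0) :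
    ((√(n : ℝ) : ℝ) : ℂ) = Complex.exp (1 / 2 * (Real.log n : ℂ)) := by
  have hpos : (0 : ℝ) < n := by exact_mod_cast Nat.pos_of_ne_zero hn
  rw [Real.sqrt_eq_rpow, Real.rpow_def_of_pos hpos]
  push_cast
  congr 1
  ring

theorem exp_I_arcTauSeq (ξ : ℂ) (n : ℕ) :
    Complex.exp (Complex.I * arcTauSeq ξ n) = Complex.exp (Complex.I * arcTau ξ * n) := by
  rw [arcTauSeq, exp_I_mul_redTwoPi]
  push_cast
  rw [mul_assoc]

theorem exp_I_arcSigmaSeq (n : ℕ) :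
    Complex.exp (Complex.I * arcSigmaSeq n) = (-1) ^ n := by
  rw [arcSigmaSeq, exp_I_mul_redTwoPi, ← Complex.exp_pi_mul_I, ← Complex.exp_nat_mul]
  push_cast
  ring_nf

theorem arcZ₁_eq {ξ : ℂ} (h1 : ξ ≠ 1) {n : ℕ} (hn : n ≠ 0) (w : ℂ) :
    arcZ₁ ξ n w = ξ * (1 + (1 / 2 * (Real.log n : ℂ) + (-w + Complex.I * arcTauSeq ξ n))
      / ((1 - ξ) * n)) := by
  have hn' : (n : ℂ) ≠ 0 := by exact_mod_cast hn
  have h1' : 1 - ξ ≠ 0 := sub_ne_zero.2 h1.symm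
  rw [arcZ₁]
  field_simp
  ring

theorem arcZ₂_eq {ξ : ℂ} (h1 : ξ ≠ 1) {n : ℕ} (hn : n ≠ 0) (w : ℂ) :
    arcZ₂ p q ξ n w = ξ * (1 + ((p - q + 1 / 2) * (Real.log n : ℂ)
      + (-w + Complex.I * arcSigmaSeq n + Complex.I * arcTauSeq ξ n)) / ((1 - ξ) * n)) := by
  have hn' : (n : ℂ) ≠ 0 := by exact_mod_cast hn
  have h1' : 1 - ξ ≠ 0 := sub_ne_zero.2 h1.symm
  rw [arcZ₂]
  field_simp
  ring

theorem norm_I_mul_redTwoPi_le (x : ℝ) : ‖Complex.I * redTwoPi x‖ ≤ Real.pi := by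
  rw [norm_mul, Complex.norm_I, one_mul, Complex.norm_real]
  exact abs_redTwoPi_le x

/-- Here d = ½ log n - w + iτ_n: the logarithm offsets 1/√n and iτ_n the rotation e^{-iτn}. The
parameter w is merely bounded because it is later shifted by log K_n, which need not converge. -/
theorem tendsto_arcZ₁ (hN : Tendsto N l atTop) {ξ : ℂ} (hξ : ξ ∈ szegoArc) (h1 : ξ ≠ 1)
    {w : ι → ℂ} {R : ℝ} (hw : ∀ᶠ i in l, ‖w i‖ ≤ R) :
    Tendsto (fun i => arcZ₁ ξ (N i) (w i)) l (𝓝 ξ) ∧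
    Tendsto (fun i => szegoFun (arcZ₁ ξ (N i) (w i)) ^ N i / (√(N i) : ℂ) * Complex.exp (w i)) l
      (𝓝 1) := by
  have hd : Tendsto (fun i => (1 / 2 * (Real.log (N i) : ℂ)
      + (-w i + Complex.I * arcTauSeq ξ (N i))) / √(N i)) l (𝓝 0) := by
    have e1 := (tendsto_log_div_sqrt hN).const_mul (1 / 2)
    have e2 := tendsto_zero_of_bounded_div_sqrt hN (R := R + Real.pi)
      (x := fun i => -w i + Complex.I * arcTauSeq ξ (N i)) (by
        filter_upwards [hw] with i hi
        refine (norm_add_le _ _).trans (add_le_add (by rwa [norm_neg]) (norm_I_mul_redTwoPi_le _)))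
    have e3 := e1.add e2
    rw [mul_zero, add_zero] at e3
    refine e3.congr fun i => ?_
    ring
  constructor
  · refine (tendsto_arc_point hN ξ hd).congr' ?_
    filter_upwards [hN.eventually_ge_atTop 1] with i hi
    rw [arcZ₁_eq h1 (by omega)]
  · refine (tendsto_szegoFun_pow_arc hN (ne_zero_of_re_pos hξ.2.2) h1 hξ.1 hd).congr' ?_
    filter_upwards [hN.eventually_ge_atTop 1] with i hi
    rw [arcZ₁_eq h1 (by omega), sqrt_natCast_eq_exp (by omega), Complex.exp_sub, Complex.exp_add,
      Complex.exp_add, exp_I_arcTauSeq, Complex.exp_neg]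
    have e1 := Complex.exp_ne_zero (1 / 2 * (Real.log (N i) : ℂ))
    have e2 := Complex.exp_ne_zero (w i)
    have e3 := Complex.exp_ne_zero (Complex.I * arcTau ξ * N i)
    generalize szegoFun _ ^ N i = W
    generalize Complex.exp (1 / 2 * (Real.log (N i) : ℂ)) = a at *
    generalize Complex.exp (Complex.I * arcTau ξ * N i) = b at *
    field_simp

/-- The additional (p-q) log n and iσ_n in d offset n^{q-p} and (-1)^n, the weight of the left
endpoint. -/
theorem tendsto_arcZ₂ (hN : Tendsto N l atTop) {ξ : ℂ} (hξ : ξ ∈ szegoArc) (h1 : ξ ≠ 1)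
    {w : ι → ℂ} {R : ℝ} (hw : ∀ᶠ i in l, ‖w i‖ ≤ R) :
    Tendsto (fun i => arcZ₂ p q ξ (N i) (w i)) l (𝓝 ξ) ∧
    Tendsto (fun i => szegoFun (arcZ₂ p q ξ (N i) (w i)) ^ N i / (√(N i) : ℂ)
      * ((-1) ^ N i * (N i : ℂ) ^ (q - p)) * Complex.exp (w i)) l (𝓝 1) := by
  have hd : Tendsto (fun i => ((p - q + 1 / 2) * (Real.log (N i) : ℂ)
      + (-w i + Complex.I * arcSigmaSeq (N i) + Complex.I * arcTauSeq ξ (N i))) / √(N i)) l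
      (𝓝 0) := by
    have e1 := (tendsto_log_div_sqrt hN).const_mul (p - q + 1 / 2)
    have e2 := tendsto_zero_of_bounded_div_sqrt hN (R := R + Real.pi + Real.pi)
      (x := fun i => -w i + Complex.I * arcSigmaSeq (N i) + Complex.I * arcTauSeq ξ (N i)) (by
        filter_upwards [hw] with i hi
        refine (norm_add₃_le).trans (add_le_add (add_le_add (by rwa [norm_neg])
          (norm_I_mul_redTwoPi_le _)) (norm_I_mul_redTwoPi_le _)))
    have e3 := e1.add e2
    rw [mul_zero, add_zero] at e3
    refine e3.congr fun i => ?_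
    ring
  constructor
  · refine (tendsto_arc_point hN ξ hd).congr' ?_
    filter_upwards [hN.eventually_ge_atTop 1] with i hi
    rw [arcZ₂_eq h1 (by omega)]
  · refine (tendsto_szegoFun_pow_arc hN (ne_zero_of_re_pos hξ.2.2) h1 hξ.1 hd).congr' ?_
    filter_upwards [hN.eventually_ge_atTop 1] with i hi
    have e0 : (p - q + 1 / 2) * (Real.log (N i) : ℂ)
        = 1 / 2 * (Real.log (N i) : ℂ) - (q - p) * (Real.log (N i) : ℂ) := by ring
    rw [arcZ₂_eq h1 (by omega), sqrt_natCast_eq_exp (by omega), natCast_cpow_eq_exp (by omega),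
      Complex.exp_sub, Complex.exp_add, Complex.exp_add, Complex.exp_add, exp_I_arcTauSeq,
      exp_I_arcSigmaSeq, Complex.exp_neg]
    conv_lhs => rw [e0, Complex.exp_sub (1 / 2 * (Real.log (N i) : ℂ))]
    rw [e0]
    have e1 := Complex.exp_ne_zero (1 / 2 * (Real.log (N i) : ℂ))
    have e2 := Complex.exp_ne_zero (w i)
    have e3 := Complex.exp_ne_zero (Complex.I * arcTau ξ * N i)
    have e4 := Complex.exp_ne_zero ((q - p) * (Real.log (N i) : ℂ))
    have e5 : ((-1 : ℂ) ^ N i)⁻¹ = (-1) ^ N i := by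
      rw [← inv_pow]
      norm_num
    generalize szegoFun _ ^ N i = W
    generalize Complex.exp (1 / 2 * (Real.log (N i) : ℂ)) = a at *
    generalize Complex.exp (Complex.I * arcTau ξ * N i) = b at *
    generalize Complex.exp ((q - p) * (Real.log (N i) : ℂ)) = c at *
    rw [div_eq_mul_inv b, mul_inv, mul_inv, mul_inv, e5]
    field_simp

theorem tendsto_stirling_div_scaledInt [l.IsCountablyGenerated] (hGp : EndpointAsymp Gp q c₂)
    (hGm : IntegrableOn Gm (Ioo 0 1)) (hc₂ : c₂ ≠ 0) (hN : Tendsto N l atTop) {z : ι → ℂ} {z₀ : ℂ}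
    (hz : Tendsto z l (𝓝 z₀)) (h₀ : 0 < z₀.re) :
    Tendsto (fun i => stirlingFactor (N i) / scaledInt q Gp Gm (N i) (z i)) l
      (𝓝 (z₀ ^ (q + 1) / (√(2 * Real.pi) * (c₂ * Complex.Gamma (q + 1))))) ∧
    ∀ᶠ i in l, scaledInt q Gp Gm (N i) (z i) ≠ 0 := by
  have ha := tendsto_scaledInt hGp hGm hN hz h₀
  have h1 : z₀ ^ (q + 1) ≠ 0 := by
    rw [Complex.cpow_ne_zero_iff]
    exact Or.inl (ne_zero_of_re_pos h₀)
  have hne : c₂ * Complex.Gamma (q + 1) * z₀ ^ (-(q + 1)) ≠ 0 := by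
    rw [Complex.cpow_neg]
    exact mul_ne_zero (mul_ne_zero hc₂ (gamma_add_one_ne_zero hGp.neg_one_lt)) (inv_ne_zero h1)
  refine ⟨?_, ha.eventually_ne hne⟩
  have h := (tendsto_stirlingFactor hN).div ha hne
  convert! h using 2
  rw [Complex.cpow_neg]
  have := gamma_add_one_ne_zero hGp.neg_one_lt
  field_simp

theorem tendsto_arcTerm_right [l.IsCountablyGenerated] (hGp : EndpointAsymp Gp q c₂)
    (hGm : EndpointAsymp Gm p c₁) (hc₂ : c₂ ≠ 0) (hN : Tendsto N l atTop) {ξ : ℂ}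
    (hξ : ξ ∈ szegoArc) (h1 : ξ ≠ 1) {w : ι → ℂ} {R : ℝ} (hw : ∀ᶠ i in l, ‖w i‖ ≤ R)
    (h : q.re < p.re) :
    Tendsto (fun i => arcTerm q Gp Gm (N i) (arcZ₁ ξ (N i) (w i)) * Complex.exp (w i)
      - ξ ^ (q + 1) / ((1 - ξ) * √(2 * Real.pi))) l (𝓝 0) := by
  obtain ⟨hz, hE⟩ := tendsto_arcZ₁ hN hξ h1 hw
  obtain ⟨hU, hV⟩ := tendsto_bracket_terms hGp hGm hN hz (by linarith [hξ.2.2])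
    (szegoArc_re_lt_one hξ h1)
  have hS := (tendsto_stirling_div_scaledInt hGp hGm.integrableOn hc₂ hN hz hξ.2.2).1
  have hB := tendsto_bracket_right hN hU hV h
  have hT := ((hE.mul hB).mul hS).sub_const (ξ ^ (q + 1) / ((1 - ξ) * √(2 * Real.pi)))
  have e : 1 * (c₂ * Complex.Gamma (q + 1) * (1 / (1 - ξ)))
      * (ξ ^ (q + 1) / (√(2 * Real.pi) * (c₂ * Complex.Gamma (q + 1))))
      - ξ ^ (q + 1) / ((1 - ξ) * √(2 * Real.pi)) = 0 := by
    have := gamma_add_one_ne_zero hGp.neg_one_lt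
    have h1' : 1 - ξ ≠ 0 := sub_ne_zero.2 h1.symm
    field_simp
    ring
  rw [e] at hT
  refine hT.congr' ?_
  filter_upwards [hN.eventually_ge_atTop 1] with i hi
  rw [arcTerm, bracket_eq (by omega) p q]
  ring

theorem tendsto_arcTerm_left [l.IsCountablyGenerated] (hGp : EndpointAsymp Gp q c₂)
    (hGm : EndpointAsymp Gm p c₁) (hc₂ : c₂ ≠ 0) (hN : Tendsto N l atTop) {ξ A : ℂ}
    (hA : A = c₁ * Complex.Gamma (p + 1) / (c₂ * Complex.Gamma (q + 1)))
    (hξ : ξ ∈ szegoArc) (h1 : ξ ≠ 1) {w : ι → ℂ} {R : ℝ} (hw : ∀ᶠ i in l, ‖w i‖ ≤ R)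
    (h : p.re < q.re) :
    Tendsto (fun i => arcTerm q Gp Gm (N i) (arcZ₂ p q ξ (N i) (w i)) * Complex.exp (w i)
      - A * ξ ^ (q + 1) / ((1 + ξ) * √(2 * Real.pi))) l (𝓝 0) := by
  obtain ⟨hz, hE⟩ := tendsto_arcZ₂ (p := p) (q := q) hN hξ h1 hw
  obtain ⟨hU, hV⟩ := tendsto_bracket_terms hGp hGm hN hz (by linarith [hξ.2.2])
    (szegoArc_re_lt_one hξ h1)
  have hS := (tendsto_stirling_div_scaledInt hGp hGm.integrableOn hc₂ hN hz hξ.2.2).1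
  have hB := tendsto_bracket_left hN hU hV h
  have hT := ((hE.mul hB).mul hS).sub_const (A * ξ ^ (q + 1) / ((1 + ξ) * √(2 * Real.pi)))
  have e : 1 * (c₁ * Complex.Gamma (p + 1) * (1 / (1 + ξ)))
      * (ξ ^ (q + 1) / (√(2 * Real.pi) * (c₂ * Complex.Gamma (q + 1))))
      - A * ξ ^ (q + 1) / ((1 + ξ) * √(2 * Real.pi)) = 0 := by
    rw [hA, sub_eq_zero, one_mul, mul_one_div, div_mul_div_comm, div_mul_eq_mul_div, div_div]
    congr 1
    ring
  rw [e] at hT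
  refine hT.congr' ?_
  filter_upwards [hN.eventually_ge_atTop 1] with i hi
  have h1 : (N i : ℂ) ^ (p - q) * (N i : ℂ) ^ (q - p) = 1 := by
    rw [← Complex.cpow_add _ _ (by exact_mod_cast (by omega : N i ≠ 0))]
    simp
  have h2 : (-1 : ℂ) ^ N i * (-1) ^ N i = 1 := by
    rw [← mul_pow]
    simp
  rw [arcTerm, bracket_eq (by omega) p q]
  generalize (N i : ℂ) ^ (q + 1) * endTail Gp (N i) _
    + (-1) ^ N i * (N i : ℂ) ^ (q - p) * _ = B
  have h3 : ((-1 : ℂ) ^ N i * (-1) ^ N i) * ((N i : ℂ) ^ (p - q) * (N i : ℂ) ^ (q - p)) = 1 := by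
    rw [h1, h2, one_mul]
  generalize stirlingFactor (N i) / scaledInt _ _ _ _ _ = S
  linear_combination (szegoFun (arcZ₂ p q ξ (N i) (w i)) ^ N i / (√(N i) : ℂ)
    * Complex.exp (w i) * B * S) * h3

theorem tendsto_arcTerm_balanced [l.IsCountablyGenerated] (hGp : EndpointAsymp Gp q c₂)
    (hGm : EndpointAsymp Gm p c₁) (hc₂ : c₂ ≠ 0) (hN : Tendsto N l atTop) {ξ A : ℂ}
    (hA : A = c₁ * Complex.Gamma (p + 1) / (c₂ * Complex.Gamma (q + 1)))
    (hξ : ξ ∈ szegoArc) (h1 : ξ ≠ 1) {w : ι → ℂ} {R : ℝ} (hw : ∀ᶠ i in l, ‖w i‖ ≤ R)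
    (h : p.re = q.re) :
    Tendsto (fun i => arcTerm q Gp Gm (N i) (arcZ₁ ξ (N i) (w i)) * Complex.exp (w i)
      - (1 / (1 - ξ) + A * (-1) ^ N i * (N i : ℂ) ^ (q - p) / (1 + ξ))
        * (ξ ^ (q + 1) / √(2 * Real.pi))) l (𝓝 0) := by
  obtain ⟨hz, hE⟩ := tendsto_arcZ₁ hN hξ h1 hw
  obtain ⟨hU, hV⟩ := tendsto_bracket_terms hGp hGm hN hz (by linarith [hξ.2.2])
    (szegoArc_re_lt_one hξ h1)
  have hS := (tendsto_stirling_div_scaledInt hGp hGm.integrableOn hc₂ hN hz hξ.2.2).1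
  have hB := tendsto_bracket_balanced hN hU hV h
  have hES := hE.mul hS
  rw [one_mul] at hES
  set u := c₂ * Complex.Gamma (q + 1) * (1 / (1 - ξ)) with hu
  set v := c₁ * Complex.Gamma (p + 1) * (1 / (1 + ξ)) with hv
  set S₀ := ξ ^ (q + 1) / (√(2 * Real.pi) * (c₂ * Complex.Gamma (q + 1))) with hS₀
  -- The oscillating factor does not converge but is bounded by ‖u‖ + ‖v‖, so it may multiply a null
  -- sequence.
  have hcb : Tendsto (fun i => (szegoFun (arcZ₁ ξ (N i) (w i)) ^ N i / (√(N i) : ℂ)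
      * Complex.exp (w i) * (stirlingFactor (N i) / scaledInt q Gp Gm (N i) (arcZ₁ ξ (N i) (w i)))
      - S₀) * (u + (-1) ^ N i * (N i : ℂ) ^ (q - p) * v)) l (𝓝 0) := by
    have hb := ((hES.sub_const S₀).norm).mul_const (‖u‖ + ‖v‖)
    rw [sub_self, norm_zero, zero_mul] at hb
    refine squeeze_zero_norm' ?_ hb
    filter_upwards [hN.eventually_ge_atTop 1] with i hi
    rw [norm_mul]
    refine mul_le_mul_of_nonneg_left ((norm_add_le _ _).trans ?_) (norm_nonneg _)
    rw [norm_mul _ v, norm_alternating_cpow (by omega) h, one_mul]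
  have hT := (hES.mul hB).add hcb
  rw [mul_zero, add_zero] at hT
  refine hT.congr' ?_
  filter_upwards [hN.eventually_ge_atTop 1] with i hi
  have e : (1 / (1 - ξ) + A * (-1) ^ N i * (N i : ℂ) ^ (q - p) / (1 + ξ))
        * (ξ ^ (q + 1) / √(2 * Real.pi)) = S₀ * (u + (-1) ^ N i * (N i : ℂ) ^ (q - p) * v) := by
    rw [hA, hu, hv, hS₀]
    have := gamma_add_one_ne_zero hGp.neg_one_lt
    have hpi : ((√(2 * Real.pi) : ℝ) : ℂ) ≠ 0 := by
      exact_mod_cast (Real.sqrt_pos.2 (by positivity)).ne'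
    field_simp
  rw [e, arcTerm, bracket_eq (by omega) p q]
  ring

/-- At scale √n the right endpoint gains a factor √n over the left one, which cancels 1/√n and
leaves the left term with weight n^{q-p-1/2}. That term is kept explicit, since both directions of
the criterion depend on it. -/
theorem tendsto_corner [l.IsCountablyGenerated] (hGp : EndpointAsymp Gp q c₂)
    (hGm : EndpointAsymp Gm p c₁) (hc₂ : c₂ ≠ 0) (hN : Tendsto N l atTop) {w : ι → ℂ} {w₀ : ℂ}
    (hw : Tendsto w l (𝓝 w₀)) (h₀ : w₀.re < 0) :
    ∃ Q : ι → ℂ, Tendsto Q l (𝓝 (Complex.exp (-(w₀ ^ 2 / 2)) * (c₁ * Complex.Gamma (p + 1) * (1 / 2))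
        * (1 / (√(2 * Real.pi) * (c₂ * Complex.Gamma (q + 1)))))) ∧
      Tendsto (fun i => twoSum Gp Gm (N i) (N i * (1 + w i / √(N i)))
          / twoInt Gp Gm (N i * (1 + w i / √(N i)))
        + (-1) ^ N i * (N i : ℂ) ^ (q - p - 1 / 2) * Q i) l
        (𝓝 (1 / 2 * cerfc (w₀ / (√2 : ℝ)))) := by
  have hz : Tendsto (fun i => 1 + w i / √(N i)) l (𝓝 1) := by
    have := (hw.mul (tendsto_ofReal_div_zero (tendsto_sqrt_natCast hN) 1)).const_add 1
    rw [mul_zero, add_zero] at this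
    refine this.congr fun i => ?_
    push_cast
    ring
  obtain ⟨hS, hne⟩ := tendsto_stirling_div_scaledInt hGp hGm.integrableOn hc₂ hN hz (by simp)
  rw [Complex.one_cpow] at hS
  have hE := tendsto_szegoFun_pow_corner hN hw
  have hU := hGp.tendsto_endTail_corner hN hw h₀
  have hV := hGm.tendsto_endTail hN hz.neg (by simp)
  rw [sub_neg_eq_add, one_add_one_eq_two] at hV
  refine ⟨_, (hE.mul hV).mul hS, ?_⟩
  have hT := ((hE.mul hU).mul hS).const_sub 1
  have e : 1 - Complex.exp (-(w₀ ^ 2 / 2)) * (c₂ * Complex.Gamma (q + 1) * halfGauss w₀)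
      * (1 / (√(2 * Real.pi) * (c₂ * Complex.Gamma (q + 1)))) = 1 / 2 * cerfc (w₀ / (√2 : ℝ)) := by
    rw [← one_sub_half_gauss]
    have := gamma_add_one_ne_zero hGp.neg_one_lt
    field_simp
  rw [e] at hT
  refine hT.congr' ?_
  filter_upwards [hN.eventually_ge_atTop 1, hne] with i hi hne
  rw [twoSum_div_twoInt hGp.integrableOn hGm.integrableOn (by omega) q _ hne,
    bracket_eq (by omega) p q]
  have h1 : (N i : ℂ) ^ (q - p - 1 / 2) = (N i : ℂ) ^ (q - p) / √(N i) := by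
    rw [sqrt_natCast_eq_exp (by omega), natCast_cpow_eq_exp (by omega),
      natCast_cpow_eq_exp (by omega), ← Complex.exp_sub]
    ring_nf
  rw [h1]
  ring

end

/-! ### Uniformity, a Hurwitz argument, and generic points of the arc. -/

theorem tendstoUniformlyOn_of_tendsto_prod {F : ℕ → ℂ → ℂ} {f : ℂ → ℂ} {K : Set ℂ}
    (hK : IsCompact K) (hf : ContinuousOn f K)
    (h : ∀ w₀ ∈ K, Tendsto (fun x : ℕ × ℂ => F x.1 x.2) (atTop ×ˢ 𝓝 w₀) (𝓝 (f w₀))) :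
    TendstoUniformlyOn F f atTop K := by
  rw [← tendstoLocallyUniformlyOn_iff_tendstoUniformlyOn_of_compact hK,
    tendstoLocallyUniformlyOn_iff_filter]
  intro w hw
  rw [tendstoUniformlyOnFilter_iff_tendsto]
  have h1 : Tendsto (fun x : ℕ × ℂ => f x.2) (atTop ×ˢ 𝓝[K] w) (𝓝 (f w)) :=
    (hf w hw).tendsto.comp tendsto_snd
  have h2 : Tendsto (fun x : ℕ × ℂ => F x.1 x.2) (atTop ×ˢ 𝓝[K] w) (𝓝 (f w)) :=
    (h w hw).mono_left (prod_mono le_rfl nhdsWithin_le_nhds)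
  exact (h1.prodMk_nhds h2).mono_right (nhds_le_uniformity _)

/-- The zeros of 1 - e^{-w} are the multiples of 2πi, none of modulus 1. -/
theorem one_sub_exp_neg_ne_zero {w : ℂ} (h1 : ‖w‖ = 1) : 1 - Complex.exp (-w) ≠ 0 := by
  intro h
  have h2 : Complex.exp (-w) = 1 := (sub_eq_zero.1 h).symm
  rw [Complex.exp_eq_one_iff] at h2
  obtain ⟨n, hn⟩ := h2
  have h3 : ‖w‖ = |(n : ℝ)| * (2 * Real.pi) := by
    rw [← norm_neg, hn]
    simp [abs_of_pos Real.pi_pos]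
  rw [h1] at h3
  rcases eq_or_ne n 0 with rfl | hn0
  · simp at h3
  · have h4 : (1 : ℝ) ≤ |(n : ℝ)| := by exact_mod_cast Int.one_le_abs hn0
    nlinarith [Real.pi_gt_three]

/-- A form of Hurwitz's theorem for the limit function `κ (1 - e^{-w})`. -/
theorem eventually_exists_zero {H : ℕ → ℂ → ℂ} {κ : ℂ} (hκ : κ ≠ 0)
    (hH : ∀ n, Differentiable ℂ (H n))
    (hlim : ∀ w₀ : ℂ, Tendsto (fun x : ℕ × ℂ => H x.1 x.2) (atTop ×ˢ 𝓝 w₀)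
      (𝓝 (κ * (1 - Complex.exp (-w₀))))) :
    ∀ᶠ n in atTop, ∃ w ∈ Metric.closedBall (0 : ℂ) 1, H n w = 0 := by
  have hcont : Continuous fun w : ℂ => κ * (1 - Complex.exp (-w)) := by fun_prop
  have hU := tendstoUniformlyOn_of_tendsto_prod (isCompact_closedBall (0 : ℂ) 1)
    hcont.continuousOn (fun w₀ _ => hlim w₀)
  obtain ⟨m, hm, hmle⟩ : ∃ m : ℝ, 0 < m ∧
      ∀ w ∈ Metric.sphere (0 : ℂ) 1, m ≤ ‖κ * (1 - Complex.exp (-w))‖ := by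
    obtain ⟨w₁, hw₁, hmin⟩ := (isCompact_sphere (0 : ℂ) 1).exists_isMinOn
      (NormedSpace.sphere_nonempty.2 zero_le_one) hcont.norm.continuousOn
    refine ⟨_, ?_, fun w hw => hmin hw⟩
    exact norm_pos_iff.2 (mul_ne_zero hκ (one_sub_exp_neg_ne_zero (by simpa using hw₁)))
  filter_upwards [Metric.tendstoUniformlyOn_iff.1 hU (m / 2) (half_pos hm)] with n hn
  -- Without zeros, 1/H_n would be holomorphic on the disc and at most 2/m on the circle. The
  -- maximum principle then contradicts |H_n(0)| < m/2, valid because the limit function vanishes at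
  -- 0.
  by_contra! hno
  have hd : DiffContOnCl ℂ (fun w => (H n w)⁻¹) (Metric.ball 0 1) := by
    refine DifferentiableOn.diffContOnCl ?_
    rw [closure_ball _ one_ne_zero]
    intro w hw
    exact ((hH n w).inv (hno w hw)).differentiableWithinAt
  have hle : ∀ w ∈ frontier (Metric.ball (0 : ℂ) 1), ‖(H n w)⁻¹‖ ≤ (m / 2)⁻¹ := by
    intro w hw
    rw [frontier_ball _ one_ne_zero] at hw
    have h1 := hn w (Metric.sphere_subset_closedBall hw)
    have h2 := hmle w hw
    rw [dist_eq_norm] at h1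
    have h3 := norm_sub_norm_le (κ * (1 - Complex.exp (-w))) (H n w)
    rw [norm_inv]
    exact inv_anti₀ (half_pos hm) (by linarith)
  have h0 := Complex.norm_le_of_forall_mem_frontier_norm_le Metric.isBounded_ball hd hle
    (z := 0) (subset_closure (by simp))
  have h1 := hn 0 (by simp)
  simp only [neg_zero, Complex.exp_zero, sub_self, mul_zero, dist_zero_left] at h1
  rw [norm_inv] at h0
  have h2 := norm_pos_iff.2 (hno 0 (by simp))
  have h3 := (inv_le_inv₀ h2 (half_pos hm)).1 h0
  linarith

/-- Taking for each n a zero within 1/(n+1) of the smallest possible distance to z avoids a diagonal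
argument. -/
theorem isLimitOfZeros_of_forall {P : ℕ → ℂ → ℂ} {z : ℂ}
    (h : ∀ ε : ℝ, 0 < ε → ∀ᶠ n in atTop, ∃ ζ, ‖ζ - z‖ < ε ∧ P n ζ = 0) : IsLimitOfZeros P z := by
  classical
  have hch : ∀ n, ∃ ζ : ℂ, (∃ x, P n x = 0) →
      P n ζ = 0 ∧ ‖ζ - z‖ ≤ Metric.infDist z {x | P n x = 0} + 1 / ((n : ℝ) + 1) := by
    intro n
    by_cases hn : ∃ x, P n x = 0
    · have hne : {x | P n x = 0}.Nonempty := hn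
      obtain ⟨ζ, hζ, hlt⟩ := (Metric.infDist_lt_iff hne (x := z)).1
        (lt_add_of_pos_right _ (by positivity : 0 < 1 / ((n : ℝ) + 1)))
      refine ⟨ζ, fun _ => ⟨hζ, ?_⟩⟩
      rw [← dist_eq_norm, dist_comm]
      exact hlt.le
    · exact ⟨0, fun h => absurd h hn⟩
  choose ζ hζ using hch
  have hex : ∀ᶠ n in atTop, ∃ x, P n x = 0 := by
    filter_upwards [h 1 one_pos] with n ⟨x, _, hx⟩
    exact ⟨x, hx⟩
  refine ⟨ζ, hex.mono fun n hn => (hζ n hn).1, ?_⟩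
  rw [Metric.tendsto_atTop']
  intro ε hε
  have h1 := (tendsto_one_div_add_atTop_nhds_zero_nat (𝕜 := ℝ)).eventually_lt_const (half_pos hε)
  have h2 := (h (ε / 2) (half_pos hε)).and (h1.and hex)
  obtain ⟨n₀, hn₀⟩ := eventually_atTop.1 h2
  refine ⟨n₀, fun n hn => ?_⟩
  obtain ⟨⟨x, hx, hPx⟩, hlt, hn⟩ := hn₀ n hn.le
  have h3 : Metric.infDist z {x | P n x = 0} ≤ dist z x := Metric.infDist_le_dist_of_mem hPx
  rw [dist_comm, dist_eq_norm] at h3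
  rw [dist_eq_norm]
  linarith [(hζ n hn).2]

/-- With x = Re ξ' and |ξ'| = e^{x-1}, squaring the excluded equality gives b²(1+2x+e^{2x-2}) =
a²(1-2x+e^{2x-2}). For x ≤ 1 the left side is strictly increasing and the right side nonincreasing,
so it fails at one of any two values of x. -/
theorem exists_mem_szegoArc_near {ξ : ℂ} (hξ : ξ ∈ szegoArc) {a b : ℝ} (hb : 0 < b) {ε : ℝ}
    (hε : 0 < ε) : ∃ ξ' ∈ szegoArc, ξ' ≠ 1 ∧ ‖ξ' - ξ‖ < ε ∧ b * ‖1 + ξ'‖ ≠ a * ‖1 - ξ'‖ := by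
  -- the arc is `x + i s √(e^{2x-2} - x²)`, `0 < x ≤ 1`
  obtain ⟨s, hs, him⟩ : ∃ s : ℝ, s ^ 2 = 1 ∧ ξ.im = s * |ξ.im| := by
    rcases le_total 0 ξ.im with h | h
    · exact ⟨1, by norm_num, by rw [abs_of_nonneg h, one_mul]⟩
    · exact ⟨-1, by norm_num, by rw [abs_of_nonpos h]; ring⟩
  set γ : ℝ → ℂ := fun x => ⟨x, s * √(Real.exp (x - 1) ^ 2 - x ^ 2)⟩ with hγ
  have hγc : Continuous γ := by
    have : γ = fun x : ℝ => (x : ℂ) + ((s * √(Real.exp (x - 1) ^ 2 - x ^ 2) : ℝ) : ℂ) * Complex.I := by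
      ext x
      rw [hγ]
      apply Complex.ext <;> simp
    rw [this]
    fun_prop
  have hnn : ∀ x : ℝ, 0 < x → 0 ≤ Real.exp (x - 1) ^ 2 - x ^ 2 := by
    intro x hx
    have := Real.add_one_le_exp (x - 1)
    rw [sub_add_cancel] at this
    nlinarith
  have hnorm : ∀ x : ℝ, 0 < x → ‖γ x‖ = Real.exp (x - 1) := by
    intro x hx
    rw [← abs_of_nonneg (norm_nonneg (γ x)), ← abs_of_pos (Real.exp_pos (x - 1)), ← sq_eq_sq_iff_abs_eq_abs,
      Complex.sq_norm, Complex.normSq_apply]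
    simp only [hγ]
    have := Real.mul_self_sqrt (hnn x hx)
    linear_combination (√(Real.exp (x - 1) ^ 2 - x ^ 2)) ^ 2 * hs + this
  have hmem : ∀ x : ℝ, 0 < x → x ≤ 1 → γ x ∈ szegoArc := by
    intro x hx hx1
    refine ⟨?_, ?_, hx⟩
    · rw [norm_mul, hnorm x hx, Complex.norm_exp, ← Real.exp_add]
      simp [hγ]
    · rw [hnorm x hx]
      exact Real.exp_le_one_iff.2 (by linarith)
  have hre1 : ξ.re ≤ 1 := (Complex.re_le_norm ξ).trans hξ.2.1
  have hξγ : γ ξ.re = ξ := by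
    have h1 : ‖ξ‖ = Real.exp (ξ.re - 1) := by
      have := hξ.1
      rw [norm_mul, Complex.norm_exp, Complex.sub_re, Complex.one_re] at this
      have h2 : Real.exp (1 - ξ.re) * Real.exp (ξ.re - 1) = 1 := by
        rw [← Real.exp_add]
        simp
      have h3 := Real.exp_pos (ξ.re - 1)
      calc ‖ξ‖ = (‖ξ‖ * Real.exp (1 - ξ.re)) * Real.exp (ξ.re - 1) := by
            rw [mul_assoc, h2, mul_one]
        _ = _ := by rw [this, one_mul]
    have h2 : Real.exp (ξ.re - 1) ^ 2 - ξ.re ^ 2 = ξ.im ^ 2 := by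
      rw [← h1, Complex.sq_norm, Complex.normSq_apply]
      ring
    apply Complex.ext
    · rfl
    · simp only [hγ]
      rw [h2, Real.sqrt_sq_eq_abs, ← him]
  obtain ⟨η, hη, hclose⟩ := Metric.continuousAt_iff.1 (hγc.continuousAt (x := ξ.re)) ε hε
  have hpos := hξ.2.2
  -- Moving left by at most t keeps x positive and below 1, so the new point is on the arc, differs
  -- from 1, and stays within ε.
  set t := min (η / 2) (ξ.re / 2) with ht
  have ht0 : 0 < t := lt_min (half_pos hη) (half_pos hpos)
  have ht1 : t ≤ η / 2 := min_le_left _ _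
  have ht2 : t ≤ ξ.re / 2 := min_le_right _ _
  have hgood : ∀ x : ℝ, ξ.re - t ≤ x → x < ξ.re →
      γ x ∈ szegoArc ∧ γ x ≠ 1 ∧ ‖γ x - ξ‖ < ε := by
    intro x hx1 hx2
    refine ⟨hmem x (by linarith) (by linarith), fun h => ?_, ?_⟩
    · have : x = 1 := congrArg Complex.re h
      linarith
    · have := hclose (x := x) (by rw [Real.dist_eq, abs_lt]; constructor <;> linarith)
      rwa [hξγ, dist_eq_norm] at this
  by_contra! hcon
  have hsq : ∀ x : ℝ, ξ.re - t ≤ x → x < ξ.re →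
      b ^ 2 * (1 + 2 * x + Real.exp (x - 1) ^ 2) = a ^ 2 * (1 - 2 * x + Real.exp (x - 1) ^ 2) := by
    intro x hx1 hx2
    obtain ⟨h1, h2, h3⟩ := hgood x hx1 hx2
    have h4 := congrArg (· ^ 2) (hcon _ h1 h2 h3)
    simp only [mul_pow] at h4
    have h5 := congrArg (· ^ 2) (hnorm x (by linarith))
    rw [Complex.sq_norm, Complex.normSq_apply] at h5
    rw [Complex.sq_norm, Complex.normSq_apply, Complex.sq_norm, Complex.normSq_apply] at h4
    simp only [Complex.add_re, Complex.sub_re, Complex.add_im, Complex.sub_im, Complex.one_re,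
      Complex.one_im] at h4
    have hxre : (γ x).re = x := rfl
    rw [hxre] at h4 h5
    rw [← h5]
    linear_combination h4
  have e1 := hsq (ξ.re - t) le_rfl (by linarith)
  have e2 := hsq (ξ.re - t / 2) (by linarith) (by linarith)
  set x₁ := ξ.re - t
  set x₂ := ξ.re - t / 2
  have hx12 : x₂ - x₁ = t / 2 := by simp only [x₁, x₂]; ring
  have hx2 : x₂ ≤ 1 := by simp only [x₂]; linarith
  have hE1 : Real.exp (x₁ - 1) ^ 2 = Real.exp (x₂ - 1) ^ 2 * Real.exp (-t) := by
    rw [← Real.exp_nat_mul, ← Real.exp_nat_mul, ← Real.exp_add]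
    congr 1
    push_cast
    linarith
  have hE2 : Real.exp (x₂ - 1) ^ 2 ≤ 1 := pow_le_one₀ (Real.exp_pos _).le
    (Real.exp_le_one_iff.2 (by linarith))
  have h1 := Real.add_one_le_exp (-t)
  have h2 : Real.exp (-t) < 1 := by
    rw [← Real.exp_zero]
    exact Real.exp_lt_exp.2 (by linarith)
  have hE0 : 0 < Real.exp (x₂ - 1) ^ 2 := by positivity
  rw [hE1] at e1
  generalize Real.exp (x₂ - 1) ^ 2 = E at *
  generalize Real.exp (-t) = F at *
  have hΔ : E - E * F ≤ t := by nlinarith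
  have hΔ0 : 0 < E - E * F := by nlinarith
  have key : b ^ 2 * (t + (E - E * F)) + a ^ 2 * (t - (E - E * F)) = 0 := by
    linear_combination e2 - e1 - (2 * b ^ 2 + 2 * a ^ 2) * hx12
  have h3 : 0 < b ^ 2 * (t + (E - E * F)) := by positivity
  have h4 : 0 ≤ a ^ 2 * (t - (E - E * F)) := mul_nonneg (sq_nonneg _) (by linarith)
  linarith

/-! ### Zeros near every point of the arc. -/

section

variable {Gp Gm : ℝ → ℂ} {p q c₁ c₂ : ℂ}

/-- Shifting w by log K_n turns 1 - K_n e^{-w} into the fixed function 1 - e^{-w}, to which the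
Hurwitz argument applies even when K_n oscillates. -/
theorem eventually_exists_zero_near (hGp : EndpointAsymp Gp q c₂)
    (hGm : IntegrableOn Gm (Ioo 0 1)) (hc₂ : c₂ ≠ 0) (hdiff : ∀ n, Differentiable ℂ (twoSum Gp Gm n))
    {ξ : ℂ} (hξ : 0 < ξ.re) {Z : ℕ → ℂ → ℂ} (hZd : ∀ n, Differentiable ℂ (Z n)) {K : ℕ → ℂ}
    {m M : ℝ} (hm : 0 < m) (hK : ∀ᶠ n in atTop, m ≤ ‖K n‖ ∧ ‖K n‖ ≤ M)
    (hZ : ∀ (w₀ : ℂ) (R : ℝ) (w : ℕ × ℂ → ℂ), (∀ᶠ x in atTop ×ˢ 𝓝 w₀, ‖w x‖ ≤ R) →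
      Tendsto (fun x : ℕ × ℂ => Z x.1 (w x)) (atTop ×ˢ 𝓝 w₀) (𝓝 ξ) ∧
      Tendsto (fun x : ℕ × ℂ => arcTerm q Gp Gm x.1 (Z x.1 (w x)) * Complex.exp (w x) - K x.1)
        (atTop ×ˢ 𝓝 w₀) (𝓝 0))
    {ε : ℝ} (hε : 0 < ε) :
    ∀ᶠ n in atTop, ∃ ζ, ‖ζ - ξ‖ < ε ∧ twoSum Gp Gm n (n * ζ) = 0 := by
  -- The two-sided bounds on |K_n| keep these shifts bounded.
  set s : ℕ → ℂ := fun n => Complex.log (K n) with hs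
  have hsb : ∀ᶠ n in atTop, ‖s n‖ ≤ |Real.log m| + |Real.log M| + Real.pi := by
    filter_upwards [hK] with n hn
    have h0 : 0 < ‖K n‖ := hm.trans_le hn.1
    refine (Complex.norm_le_abs_re_add_abs_im _).trans ?_
    rw [hs]
    simp only [Complex.log_re, Complex.log_im]
    refine add_le_add ?_ (Complex.abs_arg_le_pi _)
    have h1 := Real.log_le_log hm hn.1
    have h2 := Real.log_le_log h0 hn.2
    rw [abs_le]
    constructor
    · linarith [neg_abs_le (Real.log m), abs_nonneg (Real.log M)]
    · linarith [le_abs_self (Real.log M), abs_nonneg (Real.log m)]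
  have hwb : ∀ w₀ : ℂ, ∀ᶠ x : ℕ × ℂ in atTop ×ˢ 𝓝 w₀,
      ‖x.2 + s x.1‖ ≤ (‖w₀‖ + 1) + (|Real.log m| + |Real.log M| + Real.pi) := by
    intro w₀
    have h1 : ∀ᶠ x : ℕ × ℂ in atTop ×ˢ 𝓝 w₀, ‖x.2‖ ≤ ‖w₀‖ + 1 :=
      tendsto_snd.eventually ((continuous_norm.tendsto w₀).eventually_le_const (lt_add_one _))
    filter_upwards [h1, tendsto_fst.eventually hsb] with x h1 h2
    exact (norm_add_le _ _).trans (add_le_add h1 h2)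
  have hZs : ∀ w₀ : ℂ, Tendsto (fun x : ℕ × ℂ => Z x.1 (x.2 + s x.1)) (atTop ×ˢ 𝓝 w₀) (𝓝 ξ) :=
    fun w₀ => (hZ w₀ _ _ (hwb w₀)).1
  set κ := c₂ * Complex.Gamma (q + 1) * ξ ^ (-(q + 1)) with hκ
  have hκ0 : κ ≠ 0 := by
    refine mul_ne_zero (mul_ne_zero hc₂ (gamma_add_one_ne_zero hGp.neg_one_lt)) ?_
    rw [Complex.cpow_ne_zero_iff]
    exact Or.inl (ne_zero_of_re_pos hξ)
  -- The scaled partial sum is used, not its quotient by f, because it is entire in w.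
  set H : ℕ → ℂ → ℂ := fun n w => (n : ℂ) ^ (q + 1) * (Complex.exp (-(n * Z n (w + s n)))
    * twoSum Gp Gm n (n * Z n (w + s n))) with hH
  have hzero := eventually_exists_zero (H := H) hκ0 (fun n => by
    have h1 := hZd n
    have h2 := hdiff n
    rw [hH]
    fun_prop) (fun w₀ => by
    have hfst : Tendsto (fun x : ℕ × ℂ => x.1) (atTop ×ˢ 𝓝 w₀) atTop := tendsto_fst
    have ha := tendsto_scaledInt hGp hGm hfst (hZs w₀) hξ
    have hT := (hZ w₀ _ _ (hwb w₀)).2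
    have hT1 : Tendsto (fun x : ℕ × ℂ => arcTerm q Gp Gm x.1 (Z x.1 (x.2 + s x.1))
        * Complex.exp x.2 - 1) (atTop ×ˢ 𝓝 w₀) (𝓝 0) := by
      have hb := hT.norm.mul_const m⁻¹
      rw [norm_zero, zero_mul] at hb
      refine squeeze_zero_norm' ?_ hb
      filter_upwards [hfst.eventually hK] with x hx
      have hx0 : 0 < ‖K x.1‖ := hm.trans_le hx.1
      rw [Complex.exp_add, hs]
      simp only
      rw [Complex.exp_log (norm_pos_iff.1 hx0), ← mul_assoc, ← sub_one_mul, norm_mul, mul_assoc]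
      refine le_mul_of_one_le_right (norm_nonneg _) ?_
      rw [← div_eq_mul_inv, one_le_div hm]
      exact hx.1
    have hexp : Tendsto (fun x : ℕ × ℂ => Complex.exp (-x.2)) (atTop ×ˢ 𝓝 w₀)
        (𝓝 (Complex.exp (-w₀))) :=
      ((by fun_prop : Continuous fun w : ℂ => Complex.exp (-w)).tendsto w₀).comp tendsto_snd
    have hT2 : Tendsto (fun x : ℕ × ℂ => arcTerm q Gp Gm x.1 (Z x.1 (x.2 + s x.1)))
        (atTop ×ˢ 𝓝 w₀) (𝓝 (Complex.exp (-w₀))) := by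
      have := (hT1.add_const 1).mul hexp
      rw [zero_add, one_mul] at this
      refine this.congr fun x => ?_
      rw [sub_add_cancel, mul_assoc, ← Complex.exp_add, add_neg_cancel, Complex.exp_zero, mul_one]
    refine (ha.mul (hT2.const_sub 1)).congr' ?_
    filter_upwards [hfst.eventually_ge_atTop 1, ha.eventually_ne hκ0] with x hx hne
    have h1 := scaledInt_sub hGp.integrableOn hGm (by omega : x.1 ≠ 0) q (Z x.1 (x.2 + s x.1))
    have h2 : scaledInt q Gp Gm x.1 (Z x.1 (x.2 + s x.1))
        * arcTerm q Gp Gm x.1 (Z x.1 (x.2 + s x.1))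
        = szegoFun (Z x.1 (x.2 + s x.1)) ^ x.1 / (√x.1 : ℂ)
          * bracket q Gp Gm x.1 (Z x.1 (x.2 + s x.1)) * stirlingFactor x.1 := by
      rw [arcTerm]
      field_simp
    rw [mul_one_sub, h2, ← h1, sub_sub_cancel])
  have hU := tendstoUniformlyOn_of_tendsto_prod (F := fun n w => Z n (w + s n)) (f := fun _ => ξ)
    (isCompact_closedBall (0 : ℂ) 1) continuousOn_const (fun w₀ _ => hZs w₀)
  filter_upwards [hzero, Metric.tendstoUniformlyOn_iff.1 hU ε hε, eventually_ge_atTop 1]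
    with n ⟨w, hw, h0⟩ h1 hn
  refine ⟨Z n (w + s n), ?_, ?_⟩
  · have := h1 w hw
    rwa [dist_comm, dist_eq_norm] at this
  · have h2 := natCast_cpow_ne_zero (by omega : n ≠ 0) (q + 1)
    simpa [hH, h2, Complex.exp_ne_zero] using h0

end

section

variable {Gp Gm : ℝ → ℂ} {p q c₁ c₂ A : ℂ}

theorem endSum_eq_sum {G : ℝ → ℂ} (hG : IntegrableOn G (Ioo 0 1)) (n : ℕ) (x : ℂ) :
    endSum G n x = ∑ k ∈ Finset.range n, x ^ k / (k.factorial : ℂ)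
      * ∫ y in Ioo (0 : ℝ) 1, G y * (1 - y : ℂ) ^ k := by
  simp_rw [← integral_const_mul]
  rw [endSum, ← integral_finsetSum]
  · refine integral_congr_ae (ae_of_all _ fun y => ?_)
    beta_reduce
    rw [expSum, Finset.mul_sum]
    refine Finset.sum_congr rfl fun k _ => ?_
    rw [mul_pow]
    ring
  · intro k _
    exact (integrableOn_mul_continuous hG (by fun_prop)).const_mul _

theorem differentiable_twoSum (hGp : IntegrableOn Gp (Ioo 0 1)) (hGm : IntegrableOn Gm (Ioo 0 1))
    (n : ℕ) : Differentiable ℂ (twoSum Gp Gm n) := by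
  have : twoSum Gp Gm n = fun x => (∑ k ∈ Finset.range n, x ^ k / (k.factorial : ℂ)
      * ∫ y in Ioo (0 : ℝ) 1, Gp y * (1 - y : ℂ) ^ k)
      + ∑ k ∈ Finset.range n, (-x) ^ k / (k.factorial : ℂ)
      * ∫ y in Ioo (0 : ℝ) 1, Gm y * (1 - y : ℂ) ^ k := by
    ext x
    rw [twoSum, endSum_eq_sum hGp, endSum_eq_sum hGm]
  rw [this]
  fun_prop

theorem twoSum_swap (n : ℕ) (x : ℂ) : twoSum Gm Gp n x = twoSum Gp Gm n (-x) := by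
  rw [twoSum, twoSum, neg_neg, add_comm]

theorem eventually_norm_snd_le (w₀ : ℂ) :
    ∀ᶠ x : ℕ × ℂ in atTop ×ˢ 𝓝 w₀, ‖x.2‖ ≤ ‖w₀‖ + 1 :=
  tendsto_snd.eventually ((continuous_norm.tendsto w₀).eventually_le_const (lt_add_one _))

theorem tendsto_ratio_arc (hGp : EndpointAsymp Gp q c₂)
    (hGm : IntegrableOn Gm (Ioo 0 1)) (hc₂ : c₂ ≠ 0) {ξ w₀ : ℂ} (hξ : 0 < ξ.re)
    {Z : ℕ → ℂ → ℂ} {K : ℕ → ℂ}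
    (hZ : Tendsto (fun x : ℕ × ℂ => Z x.1 x.2) (atTop ×ˢ 𝓝 w₀) (𝓝 ξ))
    (hT : Tendsto (fun x : ℕ × ℂ => arcTerm q Gp Gm x.1 (Z x.1 x.2) * Complex.exp x.2 - K x.1)
      (atTop ×ˢ 𝓝 w₀) (𝓝 0)) :
    Tendsto (fun x : ℕ × ℂ => twoSum Gp Gm x.1 (x.1 * Z x.1 x.2) / twoInt Gp Gm (x.1 * Z x.1 x.2)
      - (1 - K x.1 * Complex.exp (-x.2))) (atTop ×ˢ 𝓝 w₀) (𝓝 0) := by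
  have hfst : Tendsto (fun x : ℕ × ℂ => x.1) (atTop ×ˢ 𝓝 w₀) atTop := tendsto_fst
  have hne := (tendsto_stirling_div_scaledInt hGp hGm hc₂ hfst hZ hξ).2
  have hexp : Tendsto (fun x : ℕ × ℂ => Complex.exp (-x.2)) (atTop ×ˢ 𝓝 w₀)
      (𝓝 (Complex.exp (-w₀))) :=
    ((by fun_prop : Continuous fun w : ℂ => Complex.exp (-w)).tendsto w₀).comp tendsto_snd
  have h := (hT.mul hexp).neg
  rw [zero_mul, neg_zero] at h
  refine h.congr' ?_
  filter_upwards [hne, hfst.eventually_ge_atTop 1] with x hx h1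
  rw [twoSum_div_twoInt hGp.integrableOn hGm (by omega) q _ hx, ← arcTerm]
  have : Complex.exp x.2 * Complex.exp (-x.2) = 1 := by
    rw [← Complex.exp_add]
    simp
  linear_combination (-arcTerm q Gp Gm x.1 (Z x.1 x.2)) * this

/-- Limit points form a closed set, so it suffices to treat nearby arc points other than 1 with
distinct moduli of the two endpoint terms. There K_n stays away from 0 even when Re p = Re q. -/
theorem isLimitOfZeros_of_mem (hGp : EndpointAsymp Gp q c₂) (hGm : EndpointAsymp Gm p c₁)
    (hc₂ : c₂ ≠ 0) (hc₁ : q.re < p.re ∨ c₁ ≠ 0) {z : ℂ} (hz : z ∈ szegoArc) :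
    IsLimitOfZeros (fun n z => twoSum Gp Gm n (n * z)) z := by
  refine isLimitOfZeros_of_forall fun ε hε => ?_
  have hcR := mul_ne_zero hc₂ (gamma_add_one_ne_zero hGp.neg_one_lt)
  obtain ⟨ξ, hξ, h1, hdist, hA⟩ := exists_mem_szegoArc_near hz
    (a := ‖c₁ * Complex.Gamma (p + 1)‖) (norm_pos_iff.2 hcR) (half_pos hε)
  have h1' : 1 - ξ ≠ 0 := sub_ne_zero.2 h1.symm
  have h2' : 1 + ξ ≠ 0 := ne_zero_of_re_pos (by
    rw [Complex.add_re, Complex.one_re]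
    linarith [hξ.2.2])
  have hpi : ((√(2 * Real.pi) : ℝ) : ℂ) ≠ 0 := by
    exact_mod_cast (Real.sqrt_pos.2 (by positivity)).ne'
  have hξq : ξ ^ (q + 1) ≠ 0 := by
    rw [Complex.cpow_ne_zero_iff]
    exact Or.inl (ne_zero_of_re_pos hξ.2.2)
  have hdiff := differentiable_twoSum hGp.integrableOn hGm.integrableOn
  have hd1 : ∀ n, Differentiable ℂ (arcZ₁ ξ n) := fun n => by
    unfold arcZ₁
    fun_prop
  have hd2 : ∀ n, Differentiable ℂ (arcZ₂ p q ξ n) := fun n => by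
    unfold arcZ₂
    fun_prop
  suffices h : ∀ᶠ n in atTop, ∃ ζ, ‖ζ - ξ‖ < ε / 2 ∧ twoSum Gp Gm n (n * ζ) = 0 by
    filter_upwards [h] with n ⟨ζ, h3, h4⟩
    refine ⟨ζ, ?_, h4⟩
    calc ‖ζ - z‖ = ‖(ζ - ξ) + (ξ - z)‖ := by ring_nf
      _ ≤ _ := norm_add_le _ _
      _ < ε := by linarith
  rcases lt_trichotomy q.re p.re with h | h | h
  · have hK : ξ ^ (q + 1) / ((1 - ξ) * √(2 * Real.pi)) ≠ 0 := div_ne_zero hξq (mul_ne_zero h1' hpi)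
    exact eventually_exists_zero_near hGp hGm.integrableOn hc₂ hdiff hξ.2.2 hd1
      (norm_pos_iff.2 hK) (Eventually.of_forall fun _ => ⟨le_rfl, le_rfl⟩)
      (fun w₀ R w hw => ⟨(tendsto_arcZ₁ tendsto_fst hξ h1 hw).1,
        tendsto_arcTerm_right hGp hGm hc₂ tendsto_fst hξ h1 hw h⟩) (half_pos hε)
  · set A := c₁ * Complex.Gamma (p + 1) / (c₂ * Complex.Gamma (q + 1)) with hAdef
    have hS : 0 < ‖ξ ^ (q + 1) / √(2 * Real.pi)‖ := norm_pos_iff.2 (div_ne_zero hξq hpi)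
    have hne : ‖1 / (1 - ξ)‖ ≠ ‖A / (1 + ξ)‖ := by
      intro he
      apply hA
      rw [norm_div, norm_div, norm_one, hAdef, norm_div, div_div,
        div_eq_div_iff (norm_ne_zero_iff.2 h1') (mul_ne_zero (norm_ne_zero_iff.2 hcR)
        (norm_ne_zero_iff.2 h2')), one_mul] at he
      exact he
    refine eventually_exists_zero_near hGp hGm.integrableOn hc₂ hdiff hξ.2.2 hd1
      (K := fun n => (1 / (1 - ξ) + A * (-1) ^ n * (n : ℂ) ^ (q - p) / (1 + ξ))
        * (ξ ^ (q + 1) / √(2 * Real.pi)))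
      (m := |‖1 / (1 - ξ)‖ - ‖A / (1 + ξ)‖| * ‖ξ ^ (q + 1) / √(2 * Real.pi)‖)
      (M := (‖1 / (1 - ξ)‖ + ‖A / (1 + ξ)‖) * ‖ξ ^ (q + 1) / √(2 * Real.pi)‖)
      (mul_pos (abs_pos.2 (sub_ne_zero.2 hne)) hS) ?_
      (fun w₀ R w hw => ⟨(tendsto_arcZ₁ tendsto_fst hξ h1 hw).1,
        tendsto_arcTerm_balanced hGp hGm hc₂ tendsto_fst hAdef hξ h1 hw h.symm⟩) (half_pos hε)
    filter_upwards [eventually_ge_atTop 1] with n hn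
    have e : ‖A * (-1) ^ n * (n : ℂ) ^ (q - p) / (1 + ξ)‖ = ‖A / (1 + ξ)‖ := by
      rw [mul_assoc, mul_div_right_comm, norm_mul,
        norm_alternating_cpow (by omega : n ≠ 0) h.symm, mul_one]
    rw [norm_mul, ← e]
    refine ⟨mul_le_mul_of_nonneg_right ?_ hS.le,
      mul_le_mul_of_nonneg_right (norm_add_le _ _) hS.le⟩
    have h3 := abs_norm_sub_norm_le (1 / (1 - ξ)) (-(A * (-1) ^ n * (n : ℂ) ^ (q - p) / (1 + ξ)))
    rwa [norm_neg, sub_neg_eq_add] at h3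
  · have hc : c₁ ≠ 0 := hc₁.resolve_left (not_lt.2 h.le)
    set A := c₁ * Complex.Gamma (p + 1) / (c₂ * Complex.Gamma (q + 1)) with hAdef
    have hA0 : A ≠ 0 := div_ne_zero (mul_ne_zero hc (gamma_add_one_ne_zero hGm.neg_one_lt)) hcR
    have hK : A * ξ ^ (q + 1) / ((1 + ξ) * √(2 * Real.pi)) ≠ 0 :=
      div_ne_zero (mul_ne_zero hA0 hξq) (mul_ne_zero h2' hpi)
    exact eventually_exists_zero_near hGp hGm.integrableOn hc₂ hdiff hξ.2.2 hd2
      (norm_pos_iff.2 hK) (Eventually.of_forall fun _ => ⟨le_rfl, le_rfl⟩)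
      (fun w₀ R w hw => ⟨(tendsto_arcZ₂ tendsto_fst hξ h1 hw).1,
        tendsto_arcTerm_left hGp hGm hc₂ tendsto_fst hAdef hξ h1 hw h⟩) (half_pos hε)

theorem IsLimitOfZeros.isClusterOfZeros {P : ℕ → ℂ → ℂ} {z : ℂ} (h : IsLimitOfZeros P z) :
    IsClusterOfZeros P z := by
  obtain ⟨ζ, h0, hζ⟩ := h
  intro U hU
  refine Eventually.frequently ?_
  filter_upwards [h0, hζ hU] with n h1 h2
  exact ⟨ζ n, h2, h1⟩

/-- The pairs (n, zero of P_n) near (∞, z) form a nontrivial filter, along which zeros converge to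
z; no subsequence has to be extracted. -/
theorem IsClusterOfZeros.neBot {P : ℕ → ℂ → ℂ} {z : ℂ} (h : IsClusterOfZeros P z) :
    ((atTop ×ˢ 𝓝 z) ⊓ 𝓟 {x : ℕ × ℂ | P x.1 x.2 = 0}).NeBot := by
  rw [inf_principal_neBot_iff]
  intro U hU
  obtain ⟨s, hs, t, ht, hst⟩ := mem_prod_iff.1 hU
  obtain ⟨n, ⟨x, hx, h0⟩, hn⟩ := ((h t ht).and_eventually hs).exists
  exact ⟨(n, x), hst ⟨hn, hx⟩, h0⟩

theorem zeros_iff (hGp : EndpointAsymp Gp q c₂) (hGm : EndpointAsymp Gm p c₁)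
    (hc₂ : c₂ ≠ 0) (hc₁ : q.re < p.re ∨ c₁ ≠ 0) {z : ℂ} (hz : 0 < z.re) :
    (IsLimitOfZeros (fun n z => twoSum Gp Gm n (n * z)) z ↔ z ∈ szegoArc) ∧
    ((p.re ≠ q.re ∨
      ‖c₂ * Complex.Gamma (q + 1)‖ * ‖1 + z‖ ≠ ‖c₁ * Complex.Gamma (p + 1)‖ * ‖1 - z‖) →
      (IsClusterOfZeros (fun n z => twoSum Gp Gm n (n * z)) z ↔ z ∈ szegoArc)) := by
  refine ⟨⟨fun ⟨ζ, h0, hζ⟩ => ?_, isLimitOfZeros_of_mem hGp hGm hc₂ hc₁⟩, fun hcond =>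
    ⟨fun h => ?_, fun h => (isLimitOfZeros_of_mem hGp hGm hc₂ hc₁ h).isClusterOfZeros⟩⟩
  · by_contra hS
    exact false_of_zeros_atTop hGp hGm hc₂ hc₁ hζ hz hS h0
  · by_contra hS
    have := h.neBot
    refine false_of_zeros hGp hGm hc₂
      (l := (atTop ×ˢ 𝓝 z) ⊓ 𝓟 {x : ℕ × ℂ | twoSum Gp Gm x.1 (x.1 * x.2) = 0})
      (N := fun x => x.1) (z := fun x => x.2) (tendsto_fst.mono_left inf_le_left)
      (tendsto_snd.mono_left inf_le_left) hz hS ?_ (mem_inf_of_right (mem_principal_self _))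
    rcases lt_trichotomy p.re q.re with h | h | h
    · exact Or.inr (Or.inl ⟨h, hc₁.resolve_left (not_lt.2 h.le)⟩)
    · exact Or.inr (Or.inr ⟨h, hcond.resolve_left (fun h' => h' h)⟩)
    · exact Or.inl h

/-! ### The corner limit and its necessary condition. -/

theorem tendsto_alternating_cpow_zero {ι : Type*} {l : Filter ι} {N : ι → ℕ}
    (hN : Tendsto N l atTop) {a : ℂ} (ha : a.re < 0) :
    Tendsto (fun i => (-1 : ℂ) ^ N i * (N i : ℂ) ^ a) l (𝓝 0) := by
  refine squeeze_zero_norm' (a := fun i => (N i : ℝ) ^ (-(-a.re))) ?_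
    ((tendsto_rpow_neg_atTop (by linarith)).comp (tendsto_natCast_real hN))
  filter_upwards [hN.eventually_ge_atTop 1] with i hi
  rw [norm_mul, norm_pow, norm_neg, norm_one, one_pow, one_mul, norm_natCast_cpow (by omega),
    neg_neg]

theorem continuous_halfGauss : Continuous halfGauss := by
  rw [continuous_iff_continuousAt]
  intro w₀
  have hre : ∀ (w : ℂ) (u : ℝ), (w * u - u ^ 2 / 2 : ℂ).re = w.re * u - u ^ 2 / 2 := by
    intro w u
    have : (u ^ 2 / 2 : ℂ) = ((u ^ 2 / 2 : ℝ) : ℂ) := by push_cast; ring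
    rw [Complex.sub_re, Complex.re_mul_ofReal, this, Complex.ofReal_re]
  refine continuousAt_of_dominated
    (bound := fun u => ‖Complex.exp (((w₀.re + 1 : ℝ) : ℂ) * u - u ^ 2 / 2)‖) ?_ ?_ ?_ ?_
  · exact Eventually.of_forall fun w =>
      (integrable_cexp_linear_sub_sq w).aestronglyMeasurable.restrict
  · filter_upwards [(Complex.continuous_re.tendsto w₀).eventually_le_const (lt_add_one w₀.re)]
      with w hw
    refine (ae_restrict_iff' measurableSet_Ioi).2 (ae_of_all _ fun u hu => ?_)
    rw [Complex.norm_exp, Complex.norm_exp, hre, hre, Complex.ofReal_re]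
    have := mul_le_mul_of_nonneg_right hw (le_of_lt hu)
    exact Real.exp_le_exp.2 (by linarith)
  · exact (integrable_cexp_linear_sub_sq _).norm.integrableOn
  · exact ae_of_all _ fun u => by fun_prop

theorem continuous_half_cerfc : Continuous fun w : ℂ => 1 / 2 * cerfc (w / (√2 : ℝ)) := by
  have h := continuous_halfGauss
  have : (fun w : ℂ => 1 / 2 * cerfc (w / (√2 : ℝ)))
      = fun w => 1 - Complex.exp (-(w ^ 2 / 2)) / √(2 * Real.pi) * halfGauss w := by
    ext w
    rw [one_sub_half_gauss]
  rw [this]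
  fun_prop

theorem tendsto_corner_ratio (hGp : EndpointAsymp Gp q c₂) (hGm : EndpointAsymp Gm p c₁)
    (hc₂ : c₂ ≠ 0) (h : (q - p - 1 / 2).re < 0) {w₀ : ℂ} (hw₀ : w₀.re < 0) :
    Tendsto (fun x : ℕ × ℂ => twoSum Gp Gm x.1 (x.1 * (1 + x.2 / √x.1))
      / twoInt Gp Gm (x.1 * (1 + x.2 / √x.1))) (atTop ×ˢ 𝓝 w₀)
      (𝓝 (1 / 2 * cerfc (w₀ / (√2 : ℝ)))) := by
  obtain ⟨Q, hQ, hR⟩ := tendsto_corner hGp hGm hc₂ (N := fun x : ℕ × ℂ => x.1)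
    (w := fun x : ℕ × ℂ => x.2) (l := atTop ×ˢ 𝓝 w₀) tendsto_fst tendsto_snd hw₀
  have h1 := hR.sub ((tendsto_alternating_cpow_zero (N := fun x : ℕ × ℂ => x.1)
    (l := atTop ×ˢ 𝓝 w₀) tendsto_fst h).mul hQ)
  rw [zero_mul, sub_zero] at h1
  refine h1.congr fun x => ?_
  ring

theorem re_neg_of_tendsto_corner_ratio (hGp : EndpointAsymp Gp q c₂) (hGm : EndpointAsymp Gm p c₁)
    (hc₂ : c₂ ≠ 0) (hc₁ : c₁ ≠ 0) {w₀ : ℂ} (hw₀ : w₀.re < 0)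
    (h : Tendsto (fun n : ℕ => twoSum Gp Gm n (n * (1 + w₀ / √n))
      / twoInt Gp Gm (n * (1 + w₀ / √n))) atTop (𝓝 (1 / 2 * cerfc (w₀ / (√2 : ℝ))))) :
    (q - p - 1 / 2).re < 0 := by
  obtain ⟨Q, hQ, hR⟩ := tendsto_corner hGp hGm hc₂ (N := fun n : ℕ => n)
    (w := fun _ => w₀) tendsto_id tendsto_const_nhds hw₀
  have h1 := (hR.sub h).norm
  rw [sub_self, norm_zero] at h1
  -- If the exponent has nonnegative real part, |n^{q-p-1/2}| ≥ 1, so convergence of the ratio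
  -- forces Q → 0, while the limit of Q is nonzero.
  by_contra! hre
  have hQ0 : Tendsto Q atTop (𝓝 0) := by
    refine squeeze_zero_norm' ?_ h1
    filter_upwards [eventually_ge_atTop 1] with n hn
    rw [add_sub_cancel_left, norm_mul, norm_mul, norm_pow, norm_neg, norm_one, one_pow, one_mul,
      norm_natCast_cpow (by omega)]
    exact le_mul_of_one_le_left (norm_nonneg _)
      (Real.one_le_rpow (by exact_mod_cast hn) hre)
  have hpi : ((√(2 * Real.pi) : ℝ) : ℂ) ≠ 0 := by
    exact_mod_cast (Real.sqrt_pos.2 (by positivity)).ne'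
  refine mul_ne_zero (mul_ne_zero (Complex.exp_ne_zero _) (mul_ne_zero (mul_ne_zero hc₁
    (gamma_add_one_ne_zero hGm.neg_one_lt)) (by norm_num))) (one_div_ne_zero (mul_ne_zero hpi
    (mul_ne_zero hc₂ (gamma_add_one_ne_zero hGp.neg_one_lt)))) (tendsto_nhds_unique hQ hQ0)

end

/-! ### Splitting g at 0 into its two endpoint parts. -/

section

variable {r : ℝ} {g : ℝ → ℂ}

/-- The function `y ↦ g (1 - y)`, with `g` extended by zero outside `(r, 1]`. -/
noncomputable def rightPart (r : ℝ) (g : ℝ → ℂ) (y : ℝ) : ℂ := (Ioc r 1).indicator g (1 - y)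

/-- The function `y ↦ g (y - 1)`, with `g` extended by zero outside `(r, 1]`. -/
noncomputable def leftPart (r : ℝ) (g : ℝ → ℂ) (y : ℝ) : ℂ := (Ioc r 1).indicator g (y - 1)

theorem integrable_indicator_Ioc (hr1 : r < 1) (hg : IntervalIntegrable g volume r 1) :
    Integrable ((Ioc r 1).indicator g) :=
  (integrable_indicator_iff measurableSet_Ioc).2
    ((intervalIntegrable_iff_integrableOn_Ioc_of_le hr1.le).1 hg)

theorem integrable_rightPart (hr1 : r < 1) (hg : IntervalIntegrable g volume r 1) :
    Integrable (rightPart r g) := (integrable_indicator_Ioc hr1 hg).comp_sub_left 1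

theorem integrable_leftPart (hr1 : r < 1) (hg : IntervalIntegrable g volume r 1) :
    Integrable (leftPart r g) := (integrable_indicator_Ioc hr1 hg).comp_sub_right 1

theorem integral_eq_rightPart_add_leftPart (hr : -1 ≤ r) (hr1 : r < 1)
    (hg : IntervalIntegrable g volume r 1) {φ : ℝ → ℂ} (hφ : Continuous φ) :
    ∫ t in r..1, φ t * g t = (∫ y in Ioo (0 : ℝ) 1, rightPart r g y * φ (1 - y))
      + ∫ y in Ioo (0 : ℝ) 1, leftPart r g y * φ (y - 1) := by
  have h0 : ∫ t in r..1, φ t * g t = ∫ t in (-1 : ℝ)..1, (Ioc r 1).indicator g t * φ t := by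
    rw [intervalIntegral.integral_of_le hr1.le, intervalIntegral.integral_of_le (by norm_num),
      ← integral_indicator measurableSet_Ioc, ← integral_indicator measurableSet_Ioc]
    congr 1
    ext t
    by_cases ht : t ∈ Ioc r 1
    · have : t ∈ Ioc (-1 : ℝ) 1 := ⟨hr.trans_lt ht.1, ht.2⟩
      rw [indicator_of_mem ht, indicator_of_mem this, indicator_of_mem ht, mul_comm]
    · rw [indicator_of_notMem ht]
      by_cases h2 : t ∈ Ioc (-1 : ℝ) 1
      · rw [indicator_of_mem h2, indicator_of_notMem ht, zero_mul]
      · rw [indicator_of_notMem h2]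
  have hi : ∀ a b : ℝ, IntervalIntegrable (fun t => (Ioc r 1).indicator g t * φ t) volume a b :=
    fun a b => (integrable_indicator_Ioc hr1 hg).intervalIntegrable.mul_continuousOn hφ.continuousOn
  rw [h0, ← intervalIntegral.integral_add_adjacent_intervals (hi (-1) 0) (hi 0 1), add_comm]
  congr 1
  · have := intervalIntegral.integral_comp_sub_left (a := 0) (b := 1)
      (fun t => (Ioc r 1).indicator g t * φ t) 1
    rw [sub_self, sub_zero] at this
    rw [← this, intervalIntegral.integral_of_le zero_le_one, integral_Ioc_eq_integral_Ioo]
    rfl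
  · have := intervalIntegral.integral_comp_sub_right (a := 0) (b := 1)
      (fun t => (Ioc r 1).indicator g t * φ t) 1
    rw [sub_self, zero_sub] at this
    rw [← this, intervalIntegral.integral_of_le zero_le_one, integral_Ioc_eq_integral_Ioo]
    rfl

theorem expInt_eq_twoInt (hr : -1 ≤ r) (hr1 : r < 1) (hg : IntervalIntegrable g volume r 1) (x : ℂ) :
    expInt r g x = twoInt (rightPart r g) (leftPart r g) x := by
  rw [expInt, integral_eq_rightPart_add_leftPart hr hr1 hg (by fun_prop), twoInt, endInt, endInt]
  congr 1
  · congr 1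
    ext y
    push_cast
    rfl
  · congr 1
    ext y
    push_cast
    congr 2
    ring

theorem expIntPartialSum_eq_twoSum (hr : -1 ≤ r) (hr1 : r < 1)
    (hg : IntervalIntegrable g volume r 1) {n : ℕ} (hn : n ≠ 0) (x : ℂ) :
    expIntPartialSum r g (n - 1) x = twoSum (rightPart r g) (leftPart r g) n x := by
  rw [expIntPartialSum, twoSum, endSum_eq_sum (integrable_rightPart hr1 hg).integrableOn,
    endSum_eq_sum (integrable_leftPart hr1 hg).integrableOn, ← Finset.sum_add_distrib,
    Nat.sub_add_cancel (Nat.pos_of_ne_zero hn)]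
  refine Finset.sum_congr rfl fun k _ => ?_
  rw [integral_eq_rightPart_add_leftPart hr hr1 hg (φ := fun t => (t : ℂ) ^ k) (by fun_prop),
    mul_add]
  congr 1
  · congr 2
    ext y
    push_cast
    rfl
  · rw [neg_pow, mul_comm ((-1) ^ k) (x ^ k), mul_div_right_comm, mul_assoc,
      ← integral_const_mul ((-1 : ℂ) ^ k)]
    congr 2
    ext y
    rw [mul_left_comm, ← mul_pow]
    push_cast
    congr 2
    ring

theorem HasBoundedDerivNearZero.tendsto {h : ℝ → ℂ} (hh : HasBoundedDerivNearZero h) :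
    Tendsto h (𝓝[>] 0) (𝓝 (h 0)) := by
  obtain ⟨δ, M, h', hδ, hd⟩ := hh
  exact ((hd 0 ⟨le_rfl, hδ⟩).1.continuousWithinAt).mono_left (nhdsWithin_mono _ Ioi_subset_Ici_self)

theorem endpointAsymp_rightPart (hr1 : r < 1) (hg : IntervalIntegrable g volume r 1) {q : ℂ}
    (hq : -1 < q.re) {g₂ : ℝ → ℂ}
    (hg₂ : ∀ t ∈ Ioo r 1, g t = ((1 - t : ℝ) : ℂ) ^ q * g₂ (1 - t))
    (hg₂' : HasBoundedDerivNearZero g₂) : EndpointAsymp (rightPart r g) q (g₂ 0) where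
  integrableOn := (integrable_rightPart hr1 hg).integrableOn
  neg_one_lt := hq
  tendsto := by
    refine hg₂'.tendsto.congr' ?_
    filter_upwards [Ioo_mem_nhdsGT (sub_pos.2 hr1)] with y hy
    have h1 : 1 - y ∈ Ioo r 1 := ⟨by linarith [hy.2], by linarith [hy.1]⟩
    rw [rightPart, indicator_of_mem (Ioo_subset_Ioc_self h1), hg₂ _ h1, sub_sub_cancel, ← mul_assoc,
      ← Complex.cpow_add _ _ (by exact_mod_cast hy.1.ne'), neg_add_cancel, Complex.cpow_zero,
      one_mul]

theorem endpointAsymp_leftPart (hg : IntervalIntegrable g volume (-1) 1) {p : ℂ}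
    (hp : -1 < p.re) {g₁ : ℝ → ℂ}
    (hg₁ : ∀ t ∈ Ioo (-1 : ℝ) 1, g t = ((t - (-1) : ℝ) : ℂ) ^ p * g₁ (t - (-1)))
    (hg₁' : HasBoundedDerivNearZero g₁) : EndpointAsymp (leftPart (-1) g) p (g₁ 0) where
  integrableOn := (integrable_leftPart (by norm_num) hg).integrableOn
  neg_one_lt := hp
  tendsto := by
    refine hg₁'.tendsto.congr' ?_
    filter_upwards [Ioo_mem_nhdsGT (by norm_num : (0:ℝ) < 2)] with y hy
    have h1 : y - 1 ∈ Ioo (-1 : ℝ) 1 := ⟨by linarith [hy.1], by linarith [hy.2]⟩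
    rw [leftPart, indicator_of_mem (Ioo_subset_Ioc_self h1), hg₁ _ h1, sub_neg_eq_add,
      sub_add_cancel, ← mul_assoc,
      ← Complex.cpow_add _ _ (by exact_mod_cast hy.1.ne'), neg_add_cancel, Complex.cpow_zero,
      one_mul]

/-- For r > -1 the zero extension of g vanishes near -1, so every admissible exponent works, with
coefficient 0. -/
theorem endpointAsymp_leftPart_zero (hr : -1 < r) (hr1 : r < 1)
    (hg : IntervalIntegrable g volume r 1) {p : ℂ} (hp : -1 < p.re) :
    EndpointAsymp (leftPart r g) p 0 where
  integrableOn := (integrable_leftPart hr1 hg).integrableOn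
  neg_one_lt := hp
  tendsto := by
    refine tendsto_const_nhds.congr' ?_
    filter_upwards [Ioo_mem_nhdsGT (by linarith : 0 < r + 1)] with y hy
    rw [leftPart, indicator_of_notMem (fun h => by linarith [h.1, hy.2]), mul_zero]

end

/-! ### Invariance of limit and cluster points, and reflection. -/

theorem IsLimitOfZeros.congr {P P' : ℕ → ℂ → ℂ} (h : ∀ᶠ n in atTop, P n = P' n) (z : ℂ) :
    IsLimitOfZeros P z ↔ IsLimitOfZeros P' z := by
  refine exists_congr fun ζ => and_congr_left fun _ => eventually_congr ?_
  filter_upwards [h] with n hn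
  rw [hn]

theorem IsClusterOfZeros.congr {P P' : ℕ → ℂ → ℂ} (h : ∀ᶠ n in atTop, P n = P' n) (z : ℂ) :
    IsClusterOfZeros P z ↔ IsClusterOfZeros P' z := by
  refine forall₂_congr fun U _ => frequently_congr ?_
  filter_upwards [h] with n hn
  rw [hn]

theorem isLimitOfZeros_comp_neg {P P' : ℕ → ℂ → ℂ} (hPP' : ∀ n z, P' n z = P n (-z)) {z : ℂ} :
    IsLimitOfZeros P' (-z) ↔ IsLimitOfZeros P z := by
  constructor
  · rintro ⟨ζ, h, hζ⟩
    exact ⟨fun n => -ζ n, by simpa [hPP'] using h, by simpa using hζ.neg⟩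
  · rintro ⟨ζ, h, hζ⟩
    exact ⟨fun n => -ζ n, by simpa [hPP'] using h, hζ.neg⟩

theorem isClusterOfZeros_comp_neg {P P' : ℕ → ℂ → ℂ} (hPP' : ∀ n z, P' n z = P n (-z)) {z : ℂ} :
    IsClusterOfZeros P' (-z) ↔ IsClusterOfZeros P z := by
  have hneg : ∀ z : ℂ, Tendsto (fun x : ℂ => -x) (𝓝 z) (𝓝 (-z)) := fun z => continuous_neg.tendsto z
  constructor
  · intro h U hU
    have hU' : (fun x => -x) ⁻¹' U ∈ 𝓝 (-z) := by
      have := hneg (-z)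
      rw [neg_neg] at this
      exact this hU
    refine (h _ hU').mono ?_
    rintro n ⟨x, hx, h0⟩
    exact ⟨-x, hx, by rwa [← hPP']⟩
  · intro h U hU
    refine (h _ (hneg z hU)).mono ?_
    rintro n ⟨x, hx, h0⟩
    exact ⟨-x, hx, by rwa [hPP', neg_neg]⟩

/-! ### Return to f and its partial sums. -/

section

variable {r : ℝ} {g : ℝ → ℂ} {p q c₁ c₂ A : ℂ}

theorem expIntRatio_eq (hr : -1 ≤ r) (hr1 : r < 1) (hg : IntervalIntegrable g volume r 1) {n : ℕ}
    (hn : n ≠ 0) (x : ℂ) : expIntRatio r g n x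
      = twoSum (rightPart r g) (leftPart r g) n x / twoInt (rightPart r g) (leftPart r g) x := by
  rw [expIntRatio, expInt_eq_twoInt hr hr1 hg, expIntPartialSum_eq_twoSum hr hr1 hg hn]

theorem tendstoUniformlyOn_arc (hr : -1 ≤ r) (hr1 : r < 1) (hg : IntervalIntegrable g volume r 1)
    (hGp : EndpointAsymp (rightPart r g) q c₂) (hc₂ : c₂ ≠ 0) {ξ : ℂ} (hξ : 0 < ξ.re)
    {Z : ℕ → ℂ → ℂ} {K : ℕ → ℂ}
    (hZ : ∀ w₀ : ℂ, Tendsto (fun x : ℕ × ℂ => Z x.1 x.2) (atTop ×ˢ 𝓝 w₀) (𝓝 ξ) ∧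
      Tendsto (fun x : ℕ × ℂ => arcTerm q (rightPart r g) (leftPart r g) x.1 (Z x.1 x.2)
        * Complex.exp x.2 - K x.1) (atTop ×ˢ 𝓝 w₀) (𝓝 0)) {S : Set ℂ} (hS : IsCompact S) :
    TendstoUniformlyOn (fun (n : ℕ) (w : ℂ) => expIntRatio r g n (n * Z n w)
      - (1 - K n * Complex.exp (-w))) (fun _ => 0) atTop S := by
  refine tendstoUniformlyOn_of_tendsto_prod hS continuousOn_const fun w₀ _ => ?_
  have hfst : Tendsto (fun x : ℕ × ℂ => x.1) (atTop ×ˢ 𝓝 w₀) atTop := tendsto_fst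
  refine (tendsto_ratio_arc hGp (integrable_leftPart hr1 hg).integrableOn hc₂ hξ (hZ w₀).1
    (hZ w₀).2).congr' ?_
  filter_upwards [hfst.eventually_ge_atTop 1] with x hx
  rw [expIntRatio_eq hr hr1 hg (by omega)]

theorem TendstoUniformlyOn.of_sub {F : ℕ → ℂ → ℂ} {f : ℂ → ℂ} {S : Set ℂ}
    (h : TendstoUniformlyOn (fun n w => F n w - f w) (fun _ => 0) atTop S) :
    TendstoUniformlyOn F f atTop S := by
  rw [Metric.tendstoUniformlyOn_iff] at h ⊢
  intro ε hε
  filter_upwards [h ε hε] with n hn w hw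
  have := hn w hw
  rwa [dist_zero_left, ← dist_eq_norm, dist_comm] at this

theorem tendstoUniformlyOn_arc_right (hr : -1 ≤ r) (hr1 : r < 1)
    (hg : IntervalIntegrable g volume r 1)
    (hGp : EndpointAsymp (rightPart r g) q c₂) (hGm : EndpointAsymp (leftPart r g) p c₁)
    (hc₂ : c₂ ≠ 0) {ξ : ℂ} (hξ : ξ ∈ szegoArc) (h1 : ξ ≠ 1) (h : q.re < p.re) {S : Set ℂ}
    (hS : IsCompact S) :
    TendstoUniformlyOn (fun (n : ℕ) (w : ℂ) => expIntRatio r g n ((n : ℂ) * arcZ₁ ξ n w))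
      (fun w : ℂ => 1 - ξ ^ (q + 1) * Complex.exp (-w)
        / ((1 - ξ) * (Real.sqrt (2 * Real.pi) : ℂ))) atTop S := by
  refine TendstoUniformlyOn.of_sub ?_
  have := tendstoUniformlyOn_arc hr hr1 hg hGp hc₂ hξ.2.2 (Z := arcZ₁ ξ)
    (K := fun _ => ξ ^ (q + 1) / ((1 - ξ) * √(2 * Real.pi)))
    (fun w₀ => ⟨(tendsto_arcZ₁ tendsto_fst hξ h1 (eventually_norm_snd_le w₀)).1,
      tendsto_arcTerm_right hGp hGm hc₂ tendsto_fst hξ h1 (eventually_norm_snd_le w₀) h⟩) hS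
  refine this.congr (Eventually.of_forall fun n w _ => ?_)
  beta_reduce
  ring

theorem tendstoUniformlyOn_arc_left (hr : -1 ≤ r) (hr1 : r < 1)
    (hg : IntervalIntegrable g volume r 1)
    (hGp : EndpointAsymp (rightPart r g) q c₂) (hGm : EndpointAsymp (leftPart r g) p c₁)
    (hc₂ : c₂ ≠ 0) (hA : A = c₁ * Complex.Gamma (p + 1) / (c₂ * Complex.Gamma (q + 1)))
    {ξ : ℂ} (hξ : ξ ∈ szegoArc) (h1 : ξ ≠ 1) (h : p.re < q.re) {S : Set ℂ}
    (hS : IsCompact S) :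
    TendstoUniformlyOn (fun (n : ℕ) (w : ℂ) => expIntRatio r g n ((n : ℂ) * arcZ₂ p q ξ n w))
      (fun w : ℂ => 1 - A * ξ ^ (q + 1) * Complex.exp (-w)
        / ((1 + ξ) * (Real.sqrt (2 * Real.pi) : ℂ))) atTop S := by
  refine TendstoUniformlyOn.of_sub ?_
  have := tendstoUniformlyOn_arc hr hr1 hg hGp hc₂ hξ.2.2 (Z := arcZ₂ p q ξ)
    (K := fun _ => A * ξ ^ (q + 1) / ((1 + ξ) * √(2 * Real.pi)))
    (fun w₀ => ⟨(tendsto_arcZ₂ tendsto_fst hξ h1 (eventually_norm_snd_le w₀)).1,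
      tendsto_arcTerm_left hGp hGm hc₂ tendsto_fst hA hξ h1 (eventually_norm_snd_le w₀) h⟩) hS
  refine this.congr (Eventually.of_forall fun n w _ => ?_)
  beta_reduce
  ring

theorem tendstoUniformlyOn_arc_balanced (hr : -1 ≤ r) (hr1 : r < 1)
    (hg : IntervalIntegrable g volume r 1)
    (hGp : EndpointAsymp (rightPart r g) q c₂) (hGm : EndpointAsymp (leftPart r g) p c₁)
    (hc₂ : c₂ ≠ 0) (hA : A = c₁ * Complex.Gamma (p + 1) / (c₂ * Complex.Gamma (q + 1)))
    {ξ : ℂ} (hξ : ξ ∈ szegoArc) (h1 : ξ ≠ 1) (h : p.re = q.re) {S : Set ℂ}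
    (hS : IsCompact S) :
    TendstoUniformlyOn
      (fun (n : ℕ) (w : ℂ) => expIntRatio r g n ((n : ℂ) * arcZ₁ ξ n w)
        - (1 - (1 / (1 - ξ) + A * (-1) ^ n * (n : ℂ) ^ (q - p) / (1 + ξ))
          * (ξ ^ (q + 1) * Complex.exp (-w) / (Real.sqrt (2 * Real.pi) : ℂ))))
      (fun _ : ℂ => 0) atTop S := by
  have := tendstoUniformlyOn_arc hr hr1 hg hGp hc₂ hξ.2.2 (Z := arcZ₁ ξ)
    (K := fun n => (1 / (1 - ξ) + A * (-1) ^ n * (n : ℂ) ^ (q - p) / (1 + ξ))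
        * (ξ ^ (q + 1) / √(2 * Real.pi)))
    (fun w₀ => ⟨(tendsto_arcZ₁ tendsto_fst hξ h1 (eventually_norm_snd_le w₀)).1,
      tendsto_arcTerm_balanced hGp hGm hc₂ tendsto_fst hA hξ h1 (eventually_norm_snd_le w₀) h⟩) hS
  refine this.congr (Eventually.of_forall fun n w _ => ?_)
  beta_reduce
  ring

theorem natCast_mul_one_add_div_sqrt {n : ℕ} (hn : n ≠ 0) (w : ℂ) :
    (n : ℂ) * (1 + w / √n) = n + w * √n := by
  have hs : ((√(n : ℝ) : ℝ) : ℂ) ≠ 0 := by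
    exact_mod_cast (Real.sqrt_pos.2 (by exact_mod_cast Nat.pos_of_ne_zero hn)).ne'
  have hsq : (n : ℂ) = (√(n : ℝ) : ℂ) * (√(n : ℝ) : ℂ) := by
    rw [← Complex.ofReal_mul, Real.mul_self_sqrt (Nat.cast_nonneg _), Complex.ofReal_natCast]
  have : (n : ℂ) * (w / √n) = w * √n := by
    rw [← mul_div_assoc, div_eq_iff hs, mul_assoc, ← hsq, mul_comm]
  rw [mul_add, this, mul_one]

theorem cornerLimit_of_re_neg (hr : -1 ≤ r) (hr1 : r < 1) (hg : IntervalIntegrable g volume r 1)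
    (hGp : EndpointAsymp (rightPart r g) q c₂) (hGm : EndpointAsymp (leftPart r g) p c₁)
    (hc₂ : c₂ ≠ 0) (h : (q - p - 1 / 2).re < 0) : CornerLimit r g := by
  intro K hK hKre
  refine tendstoUniformlyOn_of_tendsto_prod hK continuous_half_cerfc.continuousOn fun w₀ hw₀ => ?_
  have hfst : Tendsto (fun x : ℕ × ℂ => x.1) (atTop ×ˢ 𝓝 w₀) atTop := tendsto_fst
  refine (tendsto_corner_ratio hGp hGm hc₂ h (hKre hw₀)).congr' ?_
  filter_upwards [hfst.eventually_ge_atTop 1] with x hx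
  rw [expIntRatio_eq hr hr1 hg (by omega), natCast_mul_one_add_div_sqrt (by omega)]

theorem CornerLimit.re_neg (hr : -1 ≤ r) (hr1 : r < 1) (hg : IntervalIntegrable g volume r 1)
    (hGp : EndpointAsymp (rightPart r g) q c₂) (hGm : EndpointAsymp (leftPart r g) p c₁)
    (hc₂ : c₂ ≠ 0) (hc₁ : c₁ ≠ 0) (h : CornerLimit r g) : (q - p - 1 / 2).re < 0 := by
  -- Pointwise convergence at the single point w = -1 already forces the condition on p and q.
  have h1 := (h {-1} isCompact_singleton (by simp)).tendsto_at (mem_singleton (-1 : ℂ))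
  refine re_neg_of_tendsto_corner_ratio hGp hGm hc₂ hc₁ (w₀ := -1) (by simp) (h1.congr' ?_)
  filter_upwards [eventually_ge_atTop 1] with n hn
  rw [expIntRatio_eq hr hr1 hg (by omega), natCast_mul_one_add_div_sqrt (by omega)]

end

theorem mainTheorem11 (r : ℝ) (hr : -1 ≤ r) (hr1 : r < 1)
    (g g₁ g₂ : ℝ → ℂ) (p q : ℂ)
    (hg : IntervalIntegrable g MeasureTheory.volume r 1)
    (hg₁ : ∀ t ∈ Set.Ioo r 1, g t = ((t - r : ℝ) : ℂ) ^ p * g₁ (t - r))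
    (hg₂ : ∀ t ∈ Set.Ioo r 1, g t = ((1 - t : ℝ) : ℂ) ^ q * g₂ (1 - t))
    (hp : -1 < p.re) (hq : -1 < q.re)
    (hg₁0 : g₁ 0 ≠ 0) (hg₂0 : g₂ 0 ≠ 0)
    (hg₁' : HasBoundedDerivNearZero g₁) (hg₂' : HasBoundedDerivNearZero g₂)
    (A : ℂ)
    (hA : A = g₁ 0 * Complex.Gamma (p + 1) / (g₂ 0 * Complex.Gamma (q + 1)))
    (P : ℕ → ℂ → ℂ)
    (hP : ∀ (n : ℕ) (z : ℂ), P n z = expIntPartialSum r g (n - 1) ((n : ℂ) * z)) :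
    -- limit points of the zeros, `-1 < r < 1`
    (-1 < r → ∀ z : ℂ, 0 < z.re →
      (IsLimitOfZeros P z ↔ z ∈ szegoArc) ∧ (IsClusterOfZeros P z ↔ z ∈ szegoArc)) ∧
    -- limit points of the zeros, `r = -1`
    (r = -1 → ∀ z : ℂ, z.re ≠ 0 →
      (IsLimitOfZeros P z ↔ (z ∈ szegoArc ∨ -z ∈ szegoArc)) ∧
      ((p.re ≠ q.re ∨ ‖1 + z‖ ≠ ‖A‖ * ‖1 - z‖) →
        (IsClusterOfZeros P z ↔ (z ∈ szegoArc ∨ -z ∈ szegoArc)))) ∧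
    -- scaling limits at the arcs
    (∀ ξ ∈ szegoArc, ξ ≠ 1 → ∀ K : Set ℂ, IsCompact K →
      ((-1 < r ∨ (r = -1 ∧ q.re < p.re)) →
        TendstoUniformlyOn
          (fun (n : ℕ) (w : ℂ) => expIntRatio r g n ((n : ℂ) * arcZ₁ ξ n w))
          (fun w : ℂ => 1 - ξ ^ (q + 1) * Complex.exp (-w)
            / ((1 - ξ) * (Real.sqrt (2 * Real.pi) : ℂ)))
          atTop K) ∧
      (r = -1 → p.re < q.re →
        TendstoUniformlyOn
          (fun (n : ℕ) (w : ℂ) => expIntRatio r g n ((n : ℂ) * arcZ₂ p q ξ n w))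
          (fun w : ℂ => 1 - A * ξ ^ (q + 1) * Complex.exp (-w)
            / ((1 + ξ) * (Real.sqrt (2 * Real.pi) : ℂ)))
          atTop K) ∧
      (r = -1 → q.re = p.re →
        TendstoUniformlyOn
          (fun (n : ℕ) (w : ℂ) => expIntRatio r g n ((n : ℂ) * arcZ₁ ξ n w)
            - (1 - (1 / (1 - ξ) + A * (-1) ^ n * (n : ℂ) ^ (q - p) / (1 + ξ))
              * (ξ ^ (q + 1) * Complex.exp (-w) / (Real.sqrt (2 * Real.pi) : ℂ))))
          (fun _ : ℂ => 0) atTop K)) ∧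
    -- scaling limit at the corner
    (-1 < r → CornerLimit r g) ∧
    (r = -1 → (CornerLimit r g ↔ 0 < p.re - q.re + 1 / 2)) := by
  have hGp := endpointAsymp_rightPart hr1 hg hq hg₂ hg₂'
  -- The exponent q+1 is chosen so that Re q is smaller and the endpoint 1 wins.
  have hGm0 : -1 < r → EndpointAsymp (leftPart r g) (q + 1) 0 := fun h =>
    endpointAsymp_leftPart_zero h hr1 hg (by rw [Complex.add_re, Complex.one_re]; linarith)
  have hq1 : q.re < (q + 1).re := by rw [Complex.add_re, Complex.one_re]; linarith
  have hGm : r = -1 → EndpointAsymp (leftPart r g) p (g₁ 0) := by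
    rintro rfl
    exact endpointAsymp_leftPart hg hp hg₁ hg₁'
  have hPev : ∀ᶠ n in atTop, P n
      = (fun (n : ℕ) z => twoSum (rightPart r g) (leftPart r g) n (n * z)) n := by
    filter_upwards [eventually_ge_atTop 1] with n hn
    ext z
    rw [hP, expIntPartialSum_eq_twoSum hr hr1 hg (by omega)]
  have hcR := mul_ne_zero hg₂0 (gamma_add_one_ne_zero hq)
  have hnA : ∀ z : ℂ, (‖1 + z‖ ≠ ‖A‖ * ‖1 - z‖ ↔ ‖g₂ 0 * Complex.Gamma (q + 1)‖ * ‖1 + z‖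
      ≠ ‖g₁ 0 * Complex.Gamma (p + 1)‖ * ‖1 - z‖) := by
    intro z
    rw [hA, norm_div, div_mul_eq_mul_div, Ne, Ne, eq_div_iff (norm_ne_zero_iff.2 hcR), mul_comm]
  refine ⟨fun h z hz => ?_, fun h z hz => ?_, fun ξ hξ h1 K hK => ⟨?_, fun h hpq => ?_,
    fun h hpq => ?_⟩, fun h => ?_, fun h => ?_⟩
  · rw [IsLimitOfZeros.congr hPev, IsClusterOfZeros.congr hPev]
    have := zeros_iff hGp (hGm0 h) hg₂0 (Or.inl hq1) hz
    exact ⟨this.1, this.2 (Or.inl hq1.ne')⟩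
  · rw [IsLimitOfZeros.congr hPev, IsClusterOfZeros.congr hPev, hnA]
    rcases lt_or_gt_of_ne hz with hneg | hpos
    · have hz' : 0 < (-z).re := by rw [Complex.neg_re]; linarith
      have hS : z ∉ szegoArc := fun h => absurd h.2.2 (not_lt.2 hneg.le)
      -- The left half-plane is the right one for t ↦ g(-t): swapping the two parts replaces z by
      -- -z, exchanges p and q, and preserves the modulus condition.
      have hzi := zeros_iff (hGm h) hGp hg₁0 (Or.inr hg₂0) hz'
      have e : ∀ (n : ℕ) (z : ℂ), twoSum (leftPart r g) (rightPart r g) n (n * z)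
          = twoSum (rightPart r g) (leftPart r g) n (n * -z) := fun n z => by
        rw [twoSum_swap, ← mul_neg]
      rw [isLimitOfZeros_comp_neg
        (P := fun (n : ℕ) z => twoSum (rightPart r g) (leftPart r g) n (n * z)) e, isClusterOfZeros_comp_neg
        (P := fun (n : ℕ) z => twoSum (rightPart r g) (leftPart r g) n (n * z)) e, sub_neg_eq_add,
        ← sub_eq_add_neg] at hzi
      rw [or_iff_right hS]
      exact ⟨hzi.1, fun hc => hzi.2 (hc.imp Ne.symm Ne.symm)⟩
    · have hS : -z ∉ szegoArc := fun h => absurd h.2.2 (by rw [Complex.neg_re]; linarith)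
      rw [or_iff_left hS]
      exact zeros_iff hGp (hGm h) hg₂0 (Or.inr hg₁0) hpos
  · rintro (h | ⟨h, hpq⟩)
    · exact tendstoUniformlyOn_arc_right hr hr1 hg hGp (hGm0 h) hg₂0 hξ h1 hq1 hK
    · exact tendstoUniformlyOn_arc_right hr hr1 hg hGp (hGm h) hg₂0 hξ h1 hpq hK
  · exact tendstoUniformlyOn_arc_left hr hr1 hg hGp (hGm h) hg₂0 hA hξ h1 hpq hK
  · exact tendstoUniformlyOn_arc_balanced hr hr1 hg hGp (hGm h) hg₂0 hA hξ h1 hpq.symm hK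
  · refine cornerLimit_of_re_neg hr hr1 hg hGp (hGm0 h) hg₂0 ?_
    have : q - (q + 1) - 1 / 2 = ((-3 / 2 : ℝ) : ℂ) := by push_cast; ring
    rw [this, Complex.ofReal_re]
    norm_num
  · have e : (q - p - 1 / 2).re = q.re - p.re - 1 / 2 := by
      have : (1 / 2 : ℂ) = ((1 / 2 : ℝ) : ℂ) := by push_cast; ring
      rw [this, Complex.sub_re, Complex.sub_re, Complex.ofReal_re]
    constructor
    · intro hc
      have := hc.re_neg hr hr1 hg hGp (hGm h) hg₂0 hg₁0
      rw [e] at this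
      linarith
    · intro hc
      refine cornerLimit_of_re_neg hr hr1 hg hGp (hGm h) hg₂0 ?_
      rw [e]
      linarith
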